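/- For $n\ge 0$ let $\mathcal P^n$ be the free abelian group generated by all $n$-dimensional combinatorial convex polytopes (convex polytopes up to isomorphism of face lattices; $\mathcal P^0=\mathbb Z$). For an $n$-dimensional polytope $P$ and $S=\{a_1<\dots<a_k\}\subseteq\{0,\dots,n-1\}$ let the flag number $f_S(P)=f_{a_1,\dots,a_k}(P)$ be the number of chains of faces $F^{a_1}\subset\dots\subset F^{a_k}$ of $P$ with $\dim F^{a_i}=a_i$ (so $f_\emptyset(P)=1$). For a composition $\omega=(j_1,\dots,j_k)$, $j_i\ge1$, put $M_\omega=\sum_{1\le l_1<\dots<l_k\le m}t_{l_1}^{j_1}\cdots t_{l_k}^{j_k}$, let $\mathrm{Qsym}[t_1,\dots,t_m]\subseteq\mathbb Z[t_1,\dots,t_m]$ be the ring of integer combinations of the $M_\omega$, and define the generalized $f$-polynomial as the linear map $f_m:\mathcal P^n\to\mathrm{Qsym}[t_1,\dots,t_m][\alpha]$ with $$f_m(P)=\alpha^n+\sum_{k=1}^{\min\{m,n\}}\ \sum_{0\le a_1<\dots<a_k\le n-1}f_{a_1,\dots,a_k}(P)\,\alpha^{a_1}M_{(n-a_k,\dots,a_2-a_1)}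 .$$ **Theorem 2.** Let $m\ge n\ge 0$. The image of $\mathcal P^n$ in $\mathrm{Qsym}[t_1,\dots,t_m][\alpha]$ under $f_m$ consists of all polynomials $g\in\mathrm{Qsym}[t_1,\dots,t_m][\alpha]$, homogeneous of degree $n$ (in $\alpha,t_1,\dots,t_m$ together, $0$ included), that satisfy the equations 1. $g(\alpha,t_1,\dots,t_q,-t_q,t_{q+2},\dots,t_m)=g(\alpha,t_1,\dots,t_{q-1},0,0,t_{q+2},\dots,t_m)$ for $1\le q\le m-1$; 2. $g(-\alpha,t_1,\dots,t_{m-1},\alpha)=g(\alpha,t_1,\dots,t_{m-1},0)$ (no condition if $m=0$). Moreover, these equations are equivalent to the Bayer–Billera (generalized Dehn–Sommerville) relations: if $g\in\mathrm{Qsym}[t_1,\dots,t_m][\alpha]$ is homogeneous of degree $n$ and, for $S=\{a_1<\dots<a_k\}\subseteq\{0,\dots,n-1\}$, $g_S$ denotes the coefficient of $\alpha^{a_1}M_{(n-a_k,\dots,a_2-a_1)}$ in $g$ (of $\alpha^n$ if $S=\emptyset$), then $g$ satisfies 1 and 2 if and only if for all $S\subseteq\{0,\dots,n-1\}$ and $\{i,k\}\subseteq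 S\cup\{-1,n\}$ with $i<k-1$ and $S\cap\{i+1,\dots,k-1\}=\emptyset$ $$\sum_{j=i+1}^{k-1}(-1)^{j-i-1}g_{S\cup\{j\}}=\bigl(1-(-1)^{k-i-1}\bigr)g_S .$$ -/

import Mathlib

open MvPolynomial

noncomputable section

namespace FlagPoly

/-! Convex polytopes and their faces -/

/-- An `n`-dimensional convex polytope, realised in `ℝⁿ` as the convex hull of finitely many points
that affinely span `ℝⁿ`. -/
structure Polytope (n : ℕ) where
  carrier : Set (Fin n → ℝ)
  exists_vertices : ∃ V : Finset (Fin n → ℝ), carrier = convexHull ℝ (V : Set (Fin n → ℝ))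
  affineSpan_eq_top : affineSpan ℝ carrier = ⊤

/-- The nonempty faces of `P` (the polytope `P` itself included): the nonempty subsets on which some
linear functional attains its maximum over `P`. They are ordered by inclusion. -/
def Face {n : ℕ} (P : Polytope n) : Type :=
  {F : Set (Fin n → ℝ) // F.Nonempty ∧ IsExposed ℝ P.carrier F}

instance {n : ℕ} (P : Polytope n) : PartialOrder (Face P) :=
  inferInstanceAs (PartialOrder {F : Set (Fin n → ℝ) // F.Nonempty ∧ IsExposed ℝ P.carrier F})

/-- The (affine) dimension of a face. -/
def Face.dim {n : ℕ} {P : Polytope n} (F : Face P) : ℕ :=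
  Module.finrank ℝ (vectorSpan ℝ F.1)

/-- Two polytopes are combinatorially equivalent if their posets of faces are isomorphic, as posets
graded by the dimension. (The empty face can be left out of the posets: it would be their least
element. An isomorphism of face posets always respects dimensions.) -/
def combSetoid (n : ℕ) : Setoid (Polytope n) where
  r P Q := ∃ e : Face P ≃o Face Q, ∀ F, (e F).dim = F.dim
  iseqv :=
    { refl := fun P => ⟨OrderIso.refl _, fun _ => rfl⟩
      symm := by
        rintro P Q ⟨e, he⟩
        exact ⟨e.symm, fun F => by rw [← he (e.symm F), e.apply_symm_apply]⟩
      trans := by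
        rintro P Q R ⟨e, he⟩ ⟨e', he'⟩
        exact ⟨e.trans e', fun F => by rw [OrderIso.trans_apply, he', he]⟩ }

/-- `n`-dimensional combinatorial polytopes. -/
def CombPolytope (n : ℕ) : Type := Quotient (combSetoid n)

/-- `𝒫ⁿ`: the free abelian group on the `n`-dimensional combinatorial polytopes. -/
abbrev PolytopeGroup (n : ℕ) : Type := CombPolytope n →₀ ℤ

/-! Flag numbers -/

/-- The flags `(F^a)_{a ∈ S}` of faces of `P` with `dim F^a = a` and `F^a ⊂ F^b` for `a < b`. -/
def Flag {n : ℕ} (P : Polytope n) (S : Finset ℕ) : Type :=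
  {F : {a // a ∈ S} → Face P // StrictMono F ∧ ∀ a, (F a).dim = a.1}

/-- The flag number `f_S(P)`. -/
def flagNumber {n : ℕ} (P : Polytope n) (S : Finset ℕ) : ℕ := Nat.card (Flag P S)

theorem flagNumber_congr {n : ℕ} (P Q : Polytope n) (h : (combSetoid n).r P Q) :
    flagNumber P = flagNumber Q := by
  obtain ⟨e, he⟩ := h
  funext S
  refine Nat.card_congr
    { toFun := fun F => ⟨fun a => e (F.1 a), e.strictMono.comp F.2.1, fun a => by
        rw [he]; exact F.2.2 a⟩
      invFun := fun F => ⟨fun a => e.symm (F.1 a), e.symm.strictMono.comp F.2.1, fun a => by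
        rw [← he, e.apply_symm_apply]; exact F.2.2 a⟩
      left_inv := fun F => Subtype.ext (funext fun a => e.symm_apply_apply _)
      right_inv := fun F => Subtype.ext (funext fun a => e.apply_symm_apply _) }

/-- The flag number `f_S` of a combinatorial polytope. -/
def CombPolytope.flagNumber {n : ℕ} (P : CombPolytope n) (S : Finset ℕ) : ℕ :=
  Quotient.lift (s := combSetoid n) FlagPoly.flagNumber flagNumber_congr P S

/-! The ring `Qsym[t_1, …, t_m][α]` -/

/-- The polynomial ring `ℤ[α, t_1, …, t_m]`. -/
abbrev Poly (m : ℕ) : Type := MvPolynomial (Option (Fin m)) ℤ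

/-- The variable `α`. -/
def α (m : ℕ) : Poly m := X none

/-- The variables `t_1, …, t_m` (indexed from `0` to `m - 1`). -/
def t (m : ℕ) (i : Fin m) : Poly m := X (some i)

open Classical in
/-- The quasi-symmetric monomial `M_ω = ∑_{l_1 < ⋯ < l_k} t_{l_1}^{j_1} ⋯ t_{l_k}^{j_k}` of
`ω = (j_1, …, j_k)`. -/
def M (m : ℕ) (ω : List ℕ) : Poly m :=
  ∑ l : Fin ω.length → Fin m with StrictMono l, ∏ i, t m (l i) ^ ω.get i

/-- `Qsym[t_1, …, t_m][α]`: the integer combinations of the products `α ^ a * M_ω`, where `ω` is a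
composition, that is, a finite sequence of positive integers. -/
def QsymPoly (m : ℕ) : Submodule ℤ (Poly m) :=
  Submodule.span ℤ {g | ∃ (a : ℕ) (ω : List ℕ), (∀ j ∈ ω, 0 < j) ∧ g = α m ^ a * M m ω}

/-! The generalized `f`-polynomial -/

/-- The sequence `(n - a_k, a_k - a_{k-1}, …, a_2 - a_1)` for `S = {a_1 < ⋯ < a_k}`. -/
def comp (n : ℕ) (S : Finset ℕ) : List ℕ :=
  List.zipWith (· - ·) (n :: S.sort (· ≥ ·)) (S.sort (· ≥ ·))

/-- The number `a_1` for `S = {a_1 < ⋯ < a_k}`, and `n` for `S = ∅`. -/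
def low (n : ℕ) (S : Finset ℕ) : ℕ := (S.sort (· ≥ ·)).getLastD n

/-- The generalized `f`-polynomial of a combinatorial polytope,
`f_m(P) = α ^ n + ∑_{k ≥ 1} ∑_{0 ≤ a_1 < ⋯ < a_k ≤ n - 1}
  f_{a_1, …, a_k}(P) α ^ a_1 M_{(n - a_k, …, a_2 - a_1)}`
(the summand `α ^ n` is the one of `S = ∅`, and `M_ω = 0` if `ω` has more than `m` parts). -/
def CombPolytope.fPoly (m : ℕ) {n : ℕ} (P : CombPolytope n) : Poly m :=
  ∑ S ∈ (Finset.range n).powerset, (P.flagNumber S : ℤ) • (α m ^ low n S * M m (comp n S))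

/-- The linear map `f_m : 𝒫ⁿ → ℤ[α, t_1, …, t_m]`. -/
def fMap (n m : ℕ) : PolytopeGroup n →ₗ[ℤ] Poly m :=
  Finsupp.linearCombination ℤ (CombPolytope.fPoly m)

/-! The functional equations and the generalized Dehn-Sommerville relations -/

/-- The value `g(a, u_1, …, u_m)`. -/
def subst {m : ℕ} (g : Poly m) (a : Poly m) (u : Fin m → Poly m) : Poly m :=
  aeval (fun v : Option (Fin m) => v.elim a u) g

/-- The equations `g(α, …, t_q, -t_q, …) = g(α, …, 0, 0, …)`, for `1 ≤ q ≤ m - 1`, where the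
changes are in the places `q` and `q' = q + 1`. -/
def Eqs1 {m : ℕ} (g : Poly m) : Prop :=
  ∀ q q' : Fin m, q.1 + 1 = q'.1 →
    subst g (α m) (Function.update (t m) q' (-t m q)) =
      subst g (α m) (Function.update (Function.update (t m) q 0) q' 0)

/-- The equation `g(-α, t_1, …, t_{m-1}, α) = g(α, t_1, …, t_{m-1}, 0)` (no condition if
`m = 0`). -/
def Eq2 {m : ℕ} (g : Poly m) : Prop :=
  ∀ l : Fin m, l.1 + 1 = m →
    subst g (-α m) (Function.update (t m) l (α m)) = subst g (α m) (Function.update (t m) l 0)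

/-- The Bayer-Billera (generalized Dehn-Sommerville) relations for a family of integers `c_S`,
`S ⊆ {0, …, n - 1}`: if `i, k ∈ S ∪ {-1, n}`, `i < k - 1` and `S ∩ {i + 1, …, k - 1} = ∅`, then
`∑_{j = i + 1}^{k - 1} (-1) ^ (j - i - 1) c_{S ∪ {j}} = (1 - (-1) ^ (k - i - 1)) c_S`. -/
def BayerBillera (n : ℕ) (c : Finset ℕ → ℤ) : Prop :=
  ∀ S ⊆ Finset.range n, ∀ i k : ℤ,
    (i = -1 ∨ i = n ∨ ∃ a ∈ S, i = a) → (k = -1 ∨ k = n ∨ ∃ a ∈ S, k = a) →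
    i < k - 1 → (∀ a ∈ S, ¬(i < a ∧ (a : ℤ) < k)) →
    ∑ j ∈ Finset.Ioo i k, (-1) ^ (j - i - 1).toNat * c (insert j.toNat S) =
      (1 - (-1) ^ (k - i - 1).toNat) * c S

/-- For `S = {a_1 < ⋯ < a_k} ⊆ {0, …, n - 1}` and `n ≤ m`, the coefficient in `g` of
`α ^ a_1 t_1 ^ (n - a_k) ⋯ t_k ^ (a_2 - a_1)`. For `g` in `Qsym[t_1, …, t_m][α]` it is the
coefficient of `α ^ a_1 M_{(n - a_k, …, a_2 - a_1)}`. -/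
def flagCoeff (n : ℕ) {m : ℕ} (g : Poly m) (S : Finset ℕ) : ℤ :=
  coeff (Finsupp.equivFunOnFinite.symm fun v : Option (Fin m) =>
    v.elim (low n S) fun i => (comp n S).getD i 0) g

end FlagPoly

end

/-! Since `n ≤ m`, a homogeneous quasi-symmetric polynomial of degree `n` is the same as a family of
integers indexed by the subsets of `{0, …, n - 1}`. The theorem then becomes a statement about such
families, with three ingredients.

Functional equations. Comparing coefficients after a substitution gives alternating sums over all
ways to split an exponent `k` between two neighbouring variables. Moving the split changes the set
of a monomial only by one element inside a gap of `S`. Hence equation 1 amounts to the Bayer-Billera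
relations with `i ∈ S` (`eqs1_iff_innerRelation`), and equation 2, where `α` and the last variable
are merged, to those with `i = -1` (`eq2_iff_outerRelation`).

Necessity. The relations hold for flag numbers because every interval of the face lattice satisfies
Euler's relation (`setCount_bayerBillera`). Euler's relation itself is an Euler characteristic
count: a space of functionals is cut into relatively open cells according to where a minimum is
attained, the nonempty cells correspond to faces, and the signs `(-1) ^ dim` add up
(`sum_cellSign_min`, `sum_isFaceSet_neg_one_pow`).

Sufficiency over `ℤ`. Order the sets colexicographically. The relations determine the value at `S`
from smaller sets if `S` contains two consecutive numbers or `n - 1` (`BayerBillera.eq_zero`). For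
every other set `T` some integer combination of polytopes has value `1` at `T` and `0` at all
smaller sets (`exists_leading`), so a solution can be matched set by set without denominators. These
combinations come from the pyramid `C` and the bipyramid `B`: the commutator `BC - CB` inserts the
element `n` into the leading set, while `C` alone keeps the leading set and raises the dimension.
Both facts follow from formulas for the flag numbers of `C` and `B`, in which chains of cones
contribute sets with a final piece shifted down by `1`. -/

namespace FlagPoly

/-! ### Euler characteristics of cells cut out by linear functionals -/

section Cells

variable {K : Type*} [AddCommGroup K] [Module ℝ K]

/-- A convex set that contains, with each of its points, an initial piece of each ray from there. -/
def IsOpenCell (U : Set K) : Prop :=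
  Convex ℝ U ∧ ∀ x ∈ U, ∀ v : K, ∃ ε > (0 : ℝ), ∀ δ, 0 < δ → δ ≤ ε → x + δ • v ∈ U

theorem isOpenCell_univ : IsOpenCell (Set.univ : Set K) :=
  ⟨convex_univ, fun _ _ _ => ⟨1, one_pos, fun _ _ _ => trivial⟩⟩

theorem IsOpenCell.inter {U V : Set K} (hU : IsOpenCell U) (hV : IsOpenCell V) :
    IsOpenCell (U ∩ V) := by
  refine ⟨hU.1.inter hV.1, fun x hx v => ?_⟩
  obtain ⟨a, ha, h⟩ := hU.2 x hx.1 v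
  obtain ⟨b, hb, h'⟩ := hV.2 x hx.2 v
  exact ⟨min a b, lt_min ha hb, fun δ h0 h1 =>
    ⟨h δ h0 (h1.trans (min_le_left _ _)), h' δ h0 (h1.trans (min_le_right _ _))⟩⟩

theorem isOpenCell_pos (h : K →ₗ[ℝ] ℝ) : IsOpenCell {x | 0 < h x} := by
  refine ⟨(convex_Ioi (0 : ℝ)).linear_preimage h, fun x hx v => ?_⟩
  have hx : 0 < h x := hx
  have hp : 0 < |h v| + 1 := by positivity
  refine ⟨h x / (2 * (|h v| + 1)), by positivity, fun δ h0 h1 => ?_⟩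
  rw [le_div_iff₀ (by positivity)] at h1
  have h2 := neg_abs_le (h v)
  simp only [Set.mem_ofPred_eq, map_add, map_smul, smul_eq_mul]
  nlinarith [mul_le_mul_of_nonneg_left h2 h0.le]

theorem isOpenCell_lt (f g : K →ₗ[ℝ] ℝ) : IsOpenCell {x | f x < g x} := by
  have := isOpenCell_pos (g - f)
  simpa only [LinearMap.sub_apply, sub_pos] using this

theorem isOpenCell_forall_lt {κ : Type*} (T : Finset κ) (f g : κ → K →ₗ[ℝ] ℝ) :
    IsOpenCell {x | ∀ p ∈ T, f p x < g p x} := by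
  classical
  induction T using Finset.induction_on with
  | empty => simpa using isOpenCell_univ
  | insert a T _ ih =>
    convert (isOpenCell_lt (f a) (g a)).inter ih using 1
    ext x
    simp

open Classical in
/-- The sign `(-1) ^ dim N` if the cell `N ∩ U` is not empty, and `0` otherwise. -/
noncomputable def cellSign (N : Submodule ℝ K) (U : Set K) : ℤ :=
  if ∃ x ∈ N, x ∈ U then (-1) ^ Module.finrank ℝ N else 0

theorem cellSign_of_exists {N : Submodule ℝ K} {U : Set K} (h : ∃ x ∈ N, x ∈ U) :
    cellSign N U = (-1) ^ Module.finrank ℝ N := if_pos h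

theorem cellSign_of_not_exists {N : Submodule ℝ K} {U : Set K} (h : ¬ ∃ x ∈ N, x ∈ U) :
    cellSign N U = 0 := if_neg h

theorem cellSign_congr {N N' : Submodule ℝ K} {U U' : Set K} (h : N = N')
    (hU : ∀ x ∈ N, x ∈ U ↔ x ∈ U') : cellSign N U = cellSign N' U' := by
  subst h
  have : (∃ x ∈ N, x ∈ U) ↔ ∃ x ∈ N, x ∈ U' :=
    exists_congr fun x => and_congr_right fun hx => hU x hx
  by_cases h0 : ∃ x ∈ N, x ∈ U
  · rw [cellSign_of_exists h0, cellSign_of_exists (this.1 h0)]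
  · rw [cellSign_of_not_exists h0, cellSign_of_not_exists (mt this.2 h0)]

theorem finrank_inf_ker_add_one [FiniteDimensional ℝ K] {N : Submodule ℝ K} {h : K →ₗ[ℝ] ℝ} {v : K}
    (hv : v ∈ N) (hh : h v ≠ 0) :
    Module.finrank ℝ (N ⊓ LinearMap.ker h : Submodule ℝ K) + 1 = Module.finrank ℝ N := by
  have e : (N ⊓ LinearMap.ker h) ⊔ Submodule.span ℝ {v} = N := by
    refine le_antisymm (sup_le inf_le_left (by simpa using hv)) fun x hx => ?_
    refine Submodule.mem_sup.2 ⟨x - (h x / h v) • v, ⟨N.sub_mem hx (N.smul_mem _ hv), ?_⟩,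
      (h x / h v) • v, Submodule.smul_mem _ _ (Submodule.mem_span_singleton_self v), by simp⟩
    simp [hh]
  have i : (N ⊓ LinearMap.ker h) ⊓ Submodule.span ℝ {v} = ⊥ := by
    refine (Submodule.eq_bot_iff _).2 fun x hx => ?_
    obtain ⟨⟨-, h1⟩, h2⟩ := hx
    obtain ⟨c, rfl⟩ := Submodule.mem_span_singleton.1 h2
    have : c * h v = 0 := by simpa using h1
    rw [(mul_eq_zero.1 this).resolve_right hh, zero_smul]
  have := Submodule.finrank_sup_add_finrank_inf_eq (N ⊓ LinearMap.ker h) (Submodule.span ℝ {v})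
  rw [e, i, finrank_bot, finrank_span_singleton (fun h0 => hh (by simp [h0]))] at this
  omega

/-- Additivity of the Euler characteristic. If the hyperplane meets the cell properly, both open
sides are nonempty and the signs read `ε = ε - ε + ε`. If it misses the cell, convexity leaves the
cell on one side. -/
theorem cellSign_split [FiniteDimensional ℝ K] (N : Submodule ℝ K) {U : Set K} (hU : IsOpenCell U)
    (h : K →ₗ[ℝ] ℝ) :
    cellSign N U = cellSign N (U ∩ {x | 0 < h x}) + cellSign (N ⊓ LinearMap.ker h) U +
      cellSign N (U ∩ {x | h x < 0}) := by
  classical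
  by_cases hN : N ≤ LinearMap.ker h
  · have h1 : ¬ ∃ x ∈ N, x ∈ U ∩ {x | 0 < h x} := by
      rintro ⟨x, hx, -, hp⟩
      exact (ne_of_gt hp) (hN hx)
    have h2 : ¬ ∃ x ∈ N, x ∈ U ∩ {x | h x < 0} := by
      rintro ⟨x, hx, -, hp⟩
      exact (ne_of_lt hp) (hN hx)
    rw [inf_eq_left.2 hN, cellSign_of_not_exists h1, cellSign_of_not_exists h2]
    ring
  obtain ⟨v, hv, hh⟩ : ∃ v ∈ N, 0 < h v := by
    obtain ⟨v, hv, hh⟩ := Set.not_subset.1 hN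
    rcases lt_or_gt_of_ne (show h v ≠ 0 from hh) with h0 | h0
    · exact ⟨-v, N.neg_mem hv, by simpa using h0⟩
    · exact ⟨v, hv, h0⟩
  have hd := finrank_inf_ker_add_one hv hh.ne'
  by_cases hz : ∃ x ∈ N ⊓ LinearMap.ker h, x ∈ U
  · obtain ⟨x, ⟨hxN, hx0⟩, hxU⟩ := id hz
    have hx0 : h x = 0 := hx0
    have h0 : ∃ x ∈ N, x ∈ U := ⟨x, hxN, hxU⟩
    have h1 : ∃ x ∈ N, x ∈ U ∩ {x | 0 < h x} := by
      obtain ⟨ε, hε, he⟩ := hU.2 x hxU v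
      refine ⟨x + ε • v, N.add_mem hxN (N.smul_mem _ hv), he ε hε le_rfl, ?_⟩
      simp only [Set.mem_ofPred_eq, map_add, map_smul, smul_eq_mul, hx0]
      positivity
    have h2 : ∃ x ∈ N, x ∈ U ∩ {x | h x < 0} := by
      obtain ⟨ε, hε, he⟩ := hU.2 x hxU (-v)
      refine ⟨x + ε • -v, N.add_mem hxN (N.smul_mem _ (N.neg_mem hv)), he ε hε le_rfl, ?_⟩
      simp only [Set.mem_ofPred_eq, map_add, map_smul, smul_eq_mul, hx0, map_neg]
      nlinarith
    rw [cellSign_of_exists h0, cellSign_of_exists h1, cellSign_of_exists h2, cellSign_of_exists hz,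
      ← hd]
    ring
  -- Otherwise the zero of `h` on the segment from `x` to `y` would be a point of the cell on the
  -- hyperplane.
  · have key : ∀ x ∈ N, x ∈ U → ∀ y ∈ N, y ∈ U → 0 < h x → ¬ h y < 0 := by
      intro x hx hxU y hy hyU h0 h1
      refine hz ⟨(-h y / (h x - h y)) • x + (h x / (h x - h y)) • y,
        ⟨N.add_mem (N.smul_mem _ hx) (N.smul_mem _ hy), ?_⟩, hU.1 hxU hyU ?_ ?_ ?_⟩
      · simp only [SetLike.mem_coe, LinearMap.mem_ker, map_add, map_smul, smul_eq_mul]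
        field_simp
        ring
      · exact div_nonneg (by linarith) (by linarith)
      · exact div_nonneg (by linarith) (by linarith)
      · rw [← add_div, div_eq_one_iff_eq (by linarith)]
        ring
    by_cases h0 : ∃ x ∈ N, x ∈ U
    · obtain ⟨x, hx, hxU⟩ := id h0
      rcases lt_trichotomy (h x) 0 with hx0 | hx0 | hx0
      · have h1 : ¬ ∃ x ∈ N, x ∈ U ∩ {x | 0 < h x} := by
          rintro ⟨y, hy, hyU, hy0⟩
          exact key y hy hyU x hx hxU hy0 hx0
        have h2 : ∃ x ∈ N, x ∈ U ∩ {x | h x < 0} := ⟨x, hx, hxU, hx0⟩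
        rw [cellSign_of_exists h0, cellSign_of_not_exists h1, cellSign_of_exists h2,
          cellSign_of_not_exists hz, zero_add, zero_add]
      · exact absurd ⟨x, ⟨hx, hx0⟩, hxU⟩ hz
      · have h1 : ¬ ∃ x ∈ N, x ∈ U ∩ {x | h x < 0} := by
          rintro ⟨y, hy, hyU, hy0⟩
          exact key x hx hxU y hy hyU hx0 hy0
        have h2 : ∃ x ∈ N, x ∈ U ∩ {x | 0 < h x} := ⟨x, hx, hxU, hx0⟩
        rw [cellSign_of_exists h0, cellSign_of_not_exists h1, cellSign_of_exists h2,
          cellSign_of_not_exists hz, add_zero, add_zero]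
    · have h1 : ¬ ∃ x ∈ N, x ∈ U ∩ {x | 0 < h x} := fun ⟨x, hx, hxU, _⟩ => h0 ⟨x, hx, hxU⟩
      have h2 : ¬ ∃ x ∈ N, x ∈ U ∩ {x | h x < 0} := fun ⟨x, hx, hxU, _⟩ => h0 ⟨x, hx, hxU⟩
      rw [cellSign_of_not_exists h0, cellSign_of_not_exists h1, cellSign_of_not_exists h2,
        cellSign_of_not_exists hz, add_zero, add_zero]

variable {ι : Type*}

/-- The subspace on which the functionals `f s`, `s ∈ S`, agree. -/
def agree (f : ι → K →ₗ[ℝ] ℝ) (S : Finset ι) : Submodule ℝ K where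
  carrier := {x | ∀ s ∈ S, ∀ t ∈ S, f s x = f t x}
  add_mem' := fun ha hb s hs t ht => by simp [ha s hs t ht, hb s hs t ht]
  zero_mem' := by simp
  smul_mem' := fun c x hx s hs t ht => by simp [hx s hs t ht]

theorem mem_agree {f : ι → K →ₗ[ℝ] ℝ} {S : Finset ι} {x : K} :
    x ∈ agree f S ↔ ∀ s ∈ S, ∀ t ∈ S, f s x = f t x := Iff.rfl

/-- The set on which the values `f s`, `s ∈ S`, are less than the values `f y`, `y ∈ X \ S`. -/
def below (f : ι → K →ₗ[ℝ] ℝ) (X S : Finset ι) : Set K :=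
  {x | ∀ s ∈ S, ∀ y ∈ X, y ∉ S → f s x < f y x}

theorem isOpenCell_below (f : ι → K →ₗ[ℝ] ℝ) (X S : Finset ι) : IsOpenCell (below f X S) := by
  classical
  convert isOpenCell_forall_lt (S ×ˢ (X \ S)) (fun p => f p.1) (fun p => f p.2) using 1
  ext x
  simp only [below, Set.mem_ofPred_eq, Finset.mem_product, Finset.mem_sdiff, Prod.forall]
  exact ⟨fun h a b hab => h a hab.1 b hab.2.1 hab.2.2, fun h a ha b hb hb' => h a b ⟨ha, hb, hb'⟩⟩

open Classical in
/-- The cells on which the minimum of finitely many functionals is attained exactly by those in a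
given nonempty subset `S` decompose each cell. -/
theorem sum_cellSign_min [FiniteDimensional ℝ K] (f : ι → K →ₗ[ℝ] ℝ) (X : Finset ι)
    (hX : X.Nonempty) (N : Submodule ℝ K) {U : Set K} (hU : IsOpenCell U) :
    ∑ S ∈ X.powerset, (if S.Nonempty then cellSign (N ⊓ agree f S) (U ∩ below f X S) else 0) =
      cellSign N U := by
  induction hX using Finset.Nonempty.cons_induction generalizing U with
  | singleton a =>
    have h0 : ({a} : Finset ι).powerset = {∅, {a}} := by
      ext s; simp [Finset.subset_singleton_iff]
    rw [h0, Finset.sum_pair (Finset.singleton_ne_empty a).symm]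
    simp only [Finset.not_nonempty_empty, if_false, Finset.singleton_nonempty, if_true, zero_add]
    refine cellSign_congr (inf_eq_left.2 fun x _ => ?_) fun x _ => ?_
    · simp [mem_agree]
    · simp [below]
  | cons x X hx hX ih =>
    rw [Finset.cons_eq_insert, Finset.sum_powerset_insert hx, ← Finset.sum_add_distrib]
    have hU' : IsOpenCell (U ∩ {z | ∀ y ∈ X, f x z < f y z}) :=
      hU.inter (isOpenCell_forall_lt X (fun _ => f x) f)
    -- For nonempty `S`, split the cell of `S` by the sign of `f x - f s`, `s ∈ S`. The positive
    -- part is the new cell of `S`, the zero part that of `insert x S`, and the negative part is a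
    -- cell of `X` inside the region where `f x` is the strict minimum. By induction these negative
    -- parts add up to the sign of that region, which cancels with the term of `{x}`.
    have h1 : ∀ S ∈ X.powerset,
        ((if S.Nonempty then cellSign (N ⊓ agree f S) (U ∩ below f (insert x X) S) else 0) +
          if (insert x S).Nonempty then
            cellSign (N ⊓ agree f (insert x S)) (U ∩ below f (insert x X) (insert x S)) else 0) =
        ((if S.Nonempty then cellSign (N ⊓ agree f S) (U ∩ below f X S) else 0) -
          (if S.Nonempty then cellSign (N ⊓ agree f S)
            (U ∩ {z | ∀ y ∈ X, f x z < f y z} ∩ below f X S) else 0)) +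
        (if S = ∅ then cellSign N (U ∩ {z | ∀ y ∈ X, f x z < f y z}) else 0) := by
      intro S hS
      have hSX := Finset.mem_powerset.1 hS
      have hxS : x ∉ S := fun h => hx (hSX h)
      rcases S.eq_empty_or_nonempty with rfl | hne
      · simp only [Finset.not_nonempty_empty, if_false, Finset.insert_nonempty, if_true, sub_zero,
          zero_add]
        refine cellSign_congr (inf_eq_left.2 fun z _ => ?_) fun z _ => ?_
        · simp [mem_agree]
        · simp only [below, Set.mem_inter_iff, Set.mem_ofPred_eq, insert_empty_eq,
            Finset.mem_singleton, forall_eq, Finset.mem_insert]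
          refine and_congr_right fun _ => ⟨fun h y hy => h y (Or.inr hy) fun e => hx (e ▸ hy),
            fun h y hy hy' => h y (hy.resolve_left hy')⟩
      · obtain ⟨s, hs⟩ := id hne
        have hsx : s ≠ x := fun e => hxS (e ▸ hs)
        simp only [hne, if_true, Finset.insert_nonempty, hne.ne_empty, if_false, add_zero]
        rw [cellSign_split (N ⊓ agree f S) (hU.inter (isOpenCell_below f X S)) (f x - f s)]
        have e1 : cellSign (N ⊓ agree f S) (U ∩ below f (insert x X) S) =
            cellSign (N ⊓ agree f S) (U ∩ below f X S ∩ {z | 0 < (f x - f s) z}) := by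
          refine cellSign_congr rfl fun z hz => ?_
          have hz := mem_agree.1 hz.2
          simp only [below, Set.mem_inter_iff, Set.mem_ofPred_eq, LinearMap.sub_apply, sub_pos,
            and_assoc]
          refine and_congr_right fun _ => ⟨fun h => ⟨fun a ha y hy => h a ha y (by simp [hy]),
            h s hs x (by simp) hxS⟩, fun h a ha y hy hyS => ?_⟩
          rcases Finset.mem_insert.1 hy with rfl | hy
          · rw [hz a ha s hs]; exact h.2
          · exact h.1 a ha y hy hyS
        have e2 : cellSign (N ⊓ agree f (insert x S)) (U ∩ below f (insert x X) (insert x S)) =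
            cellSign (N ⊓ agree f S ⊓ LinearMap.ker (f x - f s)) (U ∩ below f X S) := by
          refine cellSign_congr ?_ fun z hz => ?_
          · ext z
            simp only [Submodule.mem_inf, mem_agree, LinearMap.mem_ker, LinearMap.sub_apply,
              sub_eq_zero, and_assoc]
            refine and_congr_right fun _ => ⟨fun h => ⟨fun a ha b hb => h a (by simp [ha]) b
              (by simp [hb]), h x (by simp) s (by simp [hs])⟩, fun h a ha b hb => ?_⟩
            have : ∀ a ∈ insert x S, f a z = f s z := by
              intro a ha
              rcases Finset.mem_insert.1 ha with rfl | ha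
              · exact h.2
              · exact h.1 a ha s hs
            rw [this a ha, this b hb]
          · have hz := mem_agree.1 hz.2
            simp only [below, Set.mem_inter_iff, Set.mem_ofPred_eq]
            refine and_congr_right fun _ => ⟨fun h a ha y hy hyS => h a (by simp [ha]) y
              (by simp [hy]) ?_, fun h a ha y hy hyS => ?_⟩
            · simp only [Finset.mem_insert, not_or]
              exact ⟨fun e => hx (e ▸ hy), hyS⟩
            · simp only [Finset.mem_insert, not_or] at hyS hy
              rw [hz a ha s (by simp [hs])]
              exact h s hs y (hy.resolve_left hyS.1) hyS.2
        have e3 : cellSign (N ⊓ agree f S) (U ∩ {z | ∀ y ∈ X, f x z < f y z} ∩ below f X S) =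
            cellSign (N ⊓ agree f S) (U ∩ below f X S ∩ {z | (f x - f s) z < 0}) := by
          refine cellSign_congr rfl fun z hz => ?_
          have hz := mem_agree.1 hz.2
          simp only [below, Set.mem_inter_iff, Set.mem_ofPred_eq, LinearMap.sub_apply, sub_neg]
          refine ⟨fun h => ⟨⟨h.1.1, h.2⟩, h.1.2 s (hSX hs)⟩,
            fun h => ⟨⟨h.1.1, fun y hy => ?_⟩, h.1.2⟩⟩
          by_cases hyS : y ∈ S
          · rw [hz y hyS s hs]; exact h.2
          · exact h.2.trans (h.1.2 s hs y hy hyS)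
        rw [e1, e2, e3]
        ring
    rw [Finset.sum_congr rfl h1, Finset.sum_add_distrib, Finset.sum_sub_distrib, ih hU, ih hU',
      Finset.sum_ite_eq' , if_pos (Finset.empty_mem_powerset X)]
    ring

end Cells

/-! ### Face sets of vector configurations and Euler's relation -/

section Configurations

variable {ι E : Type*} [AddCommGroup E] [Module ℝ E]

/-- The set of indices on which a functional that is nonnegative on the configuration `w`
vanishes. -/
def IsFaceSet (w : ι → E) (W : Finset ι) : Prop :=
  ∃ φ : E →ₗ[ℝ] ℝ, (∀ i, 0 ≤ φ (w i)) ∧ ∀ i, i ∈ W ↔ φ (w i) = 0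

/-- The rank of a set of indices in a configuration. -/
noncomputable def rk (w : ι → E) (W : Finset ι) : ℕ :=
  Module.finrank ℝ (Submodule.span ℝ (w '' (W : Set ι)))

theorem isFaceSet_univ [Fintype ι] (w : ι → E) : IsFaceSet w Finset.univ :=
  ⟨0, by simp, by simp⟩

/-- The functional that cuts out `W` vanishes on the span of `W` but not on a vector of `W'` outside
`W`. -/
theorem rk_lt_rk [FiniteDimensional ℝ E] {w : ι → E} {W W' : Finset ι} (hW : IsFaceSet w W)
    (h : W < W') : rk w W < rk w W' := by
  obtain ⟨φ, -, h2⟩ := hW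
  obtain ⟨i, hi, hi'⟩ := Finset.exists_of_ssubset h
  refine Submodule.finrank_lt_finrank_of_lt
    (lt_of_le_of_ne (Submodule.span_mono (Set.image_mono (by exact_mod_cast h.le))) fun e => ?_)
  have h3 : Submodule.span ℝ (w '' (W : Set ι)) ≤ LinearMap.ker φ := by
    rw [Submodule.span_le]
    rintro _ ⟨j, hj, rfl⟩
    exact (h2 j).1 hj
  have h4 : w i ∈ Submodule.span ℝ (w '' (W' : Set ι)) :=
    Submodule.subset_span ⟨i, hi, rfl⟩
  rw [← e] at h4
  exact hi' ((h2 i).2 (h3 h4))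

theorem finrank_dualAnnihilator_span [FiniteDimensional ℝ E] (w : ι → E) (W : Finset ι) :
    rk w W + Module.finrank ℝ (Submodule.span ℝ (w '' (W : Set ι))).dualAnnihilator =
      Module.finrank ℝ E :=
  Subspace.finrank_add_finrank_dualAnnihilator_eq _

theorem mem_dualAnnihilator_span {w : ι → E} {W : Finset ι} {φ : Module.Dual ℝ E} :
    φ ∈ (Submodule.span ℝ (w '' (W : Set ι))).dualAnnihilator ↔ ∀ i ∈ W, φ (w i) = 0 := by
  rw [Submodule.mem_dualAnnihilator]
  refine ⟨fun h i hi => h _ (Submodule.subset_span ⟨i, hi, rfl⟩), fun h x hx => ?_⟩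
  have : Submodule.span ℝ (w '' (W : Set ι)) ≤ LinearMap.ker φ := by
    rw [Submodule.span_le]
    rintro _ ⟨j, hj, rfl⟩
    exact h j hj
  exact this hx

/-- A set cut out of a face by a functional that is nonnegative there is a face. -/
theorem IsFaceSet.of_face [Fintype ι] {w : ι → E} {G : Finset ι} (hG : IsFaceSet w G)
    {W : Finset ι} (hW : W ⊆ G) (φ : E →ₗ[ℝ] ℝ) (h0 : ∀ i ∈ W, φ (w i) = 0)
    (h1 : ∀ i ∈ G, i ∉ W → 0 < φ (w i)) : IsFaceSet w W := by
  obtain ⟨γ, g1, g2⟩ := hG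
  -- A large multiple of the functional of `G` makes `φ` positive off `G` without changing it on
  -- `G`. For `i ∈ G` the quotient is `0` by the convention for division and does no harm.
  obtain ⟨c, hc⟩ : ∃ c : ℝ, ∀ i, i ∉ G → 0 < φ (w i) + c * γ (w i) := by
    obtain ⟨c, hc⟩ := (Set.finite_range fun i => (1 - φ (w i)) / γ (w i)).bddAbove
    refine ⟨c, fun i hi => ?_⟩
    have hp : 0 < γ (w i) := lt_of_le_of_ne (g1 i) fun e => hi ((g2 i).2 e.symm)
    have := hc ⟨i, rfl⟩
    simp only [div_le_iff₀ hp] at this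
    linarith
  have key : ∀ i, (i ∈ W → (φ + c • γ) (w i) = 0) ∧ (i ∉ W → 0 < (φ + c • γ) (w i)) := by
    intro i
    simp only [LinearMap.add_apply, LinearMap.smul_apply, smul_eq_mul]
    refine ⟨fun hi => by rw [h0 i hi, (g2 i).1 (hW hi)]; simp, fun hi => ?_⟩
    by_cases hiG : i ∈ G
    · rw [(g2 i).1 hiG]; simpa using h1 i hiG hi
    · exact hc i hiG
  refine ⟨φ + c • γ, fun i => ?_, fun i => ⟨(key i).1, fun h => ?_⟩⟩
  · by_cases hi : i ∈ W
    · exact ((key i).1 hi).ge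
    · exact ((key i).2 hi).le
  · by_contra hi
    exact ((key i).2 hi).ne' h

open Classical in
/-- Euler's relation for the intervals in the poset of faces of a configuration. -/
theorem sum_isFaceSet_neg_one_pow [Fintype ι] [FiniteDimensional ℝ E] {w : ι → E} {F G : Finset ι}
    (hF : IsFaceSet w F) (hG : IsFaceSet w G) (h : F < G) :
    ∑ W : Finset ι with IsFaceSet w W ∧ F ⊆ W ∧ W ⊆ G, (-1 : ℤ) ^ rk w W = 0 := by
  obtain ⟨u, u1, u2⟩ := id hF
  have upos : ∀ i, i ∉ F → 0 < u (w i) := fun i hi =>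
    lt_of_le_of_ne (u1 i) fun e => hi ((u2 i).2 e.symm)
  set N : Submodule ℝ (Module.Dual ℝ E) := (Submodule.span ℝ (w '' (F : Set ι))).dualAnnihilator
    with hN
  -- The normalisation gives `f i u = 1` off `F`, so adding a multiple of `u` shifts all these
  -- values equally and preserves the set where the minimum is attained.
  let f : ι → Module.Dual ℝ E →ₗ[ℝ] ℝ := fun i => (u (w i))⁻¹ • Module.Dual.eval ℝ E (w i)
  have hf : ∀ i φ, f i φ = (u (w i))⁻¹ * φ (w i) := fun i φ => rfl
  have hfu : ∀ i, i ∉ F → f i u = 1 := fun i hi => by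
    rw [hf, inv_mul_cancel₀ (upos i hi).ne']
  have huN : u ∈ N := mem_dualAnnihilator_span.2 fun i hi => (u2 i).1 hi
  have hX : (G \ F).Nonempty := Finset.sdiff_nonempty.2 h.not_ge
  have hd := finrank_dualAnnihilator_span w F
  have key := sum_cellSign_min f (G \ F) hX N isOpenCell_univ
  have hs : ∀ S ∈ (G \ F).powerset,
      (if S.Nonempty then cellSign (N ⊓ agree f S) (Set.univ ∩ below f (G \ F) S) else 0) =
      if S.Nonempty then
        (if IsFaceSet w (F ∪ S) then (-1) ^ (Module.finrank ℝ E + rk w (F ∪ S) + 1) else 0)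
      else 0 := by
    intro S hS
    have hS := Finset.mem_powerset.1 hS
    have hSF : ∀ i ∈ S, i ∉ F := fun i hi => (Finset.mem_sdiff.1 (hS hi)).2
    have hSG : ∀ i ∈ S, i ∈ G := fun i hi => (Finset.mem_sdiff.1 (hS hi)).1
    refine if_ctx_congr Iff.rfl (fun hne => ?_) fun _ => rfl
    obtain ⟨s, hs⟩ := hne
    -- The functionals in `N` that agree on `S` are those vanishing on `F ∪ S` together with the
    -- extra direction `u`.
    have hdim : Module.finrank ℝ (N ⊓ agree f S : Submodule ℝ (Module.Dual ℝ E)) + rk w (F ∪ S) =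
        Module.finrank ℝ E + 1 := by
      have h1 : u ∈ N ⊓ agree f S := ⟨huN, mem_agree.2 fun a ha b hb => by
        rw [hfu a (hSF a ha), hfu b (hSF b hb)]⟩
      rw [← finrank_inf_ker_add_one (h := f s) h1 (by rw [hfu s (hSF s hs)]; exact one_ne_zero),
        ← finrank_dualAnnihilator_span w (F ∪ S)]
      have : N ⊓ agree f S ⊓ LinearMap.ker (f s) =
          (Submodule.span ℝ (w '' ((F ∪ S : Finset ι) : Set ι))).dualAnnihilator := by
        ext φ
        rw [Submodule.mem_inf, Submodule.mem_inf, hN, mem_dualAnnihilator_span,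
          mem_dualAnnihilator_span, mem_agree, LinearMap.mem_ker]
        constructor
        · rintro ⟨⟨h1, h2⟩, h3⟩ i hi
          rcases Finset.mem_union.1 hi with hi | hi
          · exact h1 i hi
          · have := h2 i hi s hs
            rw [h3, hf] at this
            exact (mul_eq_zero.1 this).resolve_left (inv_ne_zero (upos i (hSF i hi)).ne')
        · intro h1
          have h2 : ∀ i ∈ S, f i φ = 0 := fun i hi => by
            rw [hf, h1 i (Finset.mem_union_right _ hi), mul_zero]
          exact ⟨⟨fun i hi => h1 i (Finset.mem_union_left _ hi), fun a ha b hb => by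
            rw [h2 a ha, h2 b hb]⟩, h2 s hs⟩
      rw [this]
      omega
    -- Subtracting the minimal value times `u` turns a point of the cell into a functional that
    -- vanishes on `F ∪ S` and is positive on the rest of `G`.
    have hex : (∃ φ ∈ N ⊓ agree f S, φ ∈ Set.univ ∩ below f (G \ F) S) ↔
        IsFaceSet w (F ∪ S) := by
      constructor
      · rintro ⟨φ, ⟨h1, h2⟩, -, h3⟩
        refine hG.of_face (Finset.union_subset h.le hSG) (φ - f s φ • u) ?_ ?_
        · intro i hi
          rcases Finset.mem_union.1 hi with hi | hi
          · simp [mem_dualAnnihilator_span.1 h1 i hi, (u2 i).1 hi]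
          · have hp := upos i (hSF i hi)
            have := mem_agree.1 h2 s hs i hi
            rw [LinearMap.sub_apply, LinearMap.smul_apply, this, hf, smul_eq_mul]
            field_simp
            ring
        · intro i hi hi'
          simp only [Finset.mem_union, not_or] at hi'
          have hp := upos i hi'.1
          have := h3 s hs i (Finset.mem_sdiff.2 ⟨hi, hi'.1⟩) hi'.2
          rw [hf i, inv_mul_eq_div, lt_div_iff₀ hp] at this
          simpa using this
      · rintro ⟨φ, h1, h2⟩
        have h3 : ∀ i ∈ S, f i φ = 0 := fun i hi => by
          rw [hf, (h2 i).1 (Finset.mem_union_right _ hi), mul_zero]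
        refine ⟨φ, ⟨mem_dualAnnihilator_span.2 fun i hi =>
          (h2 i).1 (Finset.mem_union_left _ hi), fun a ha b hb => by rw [h3 a ha, h3 b hb]⟩,
          trivial, fun a ha y hy hyS => ?_⟩
        have hyF := (Finset.mem_sdiff.1 hy).2
        rw [h3 a ha, hf]
        refine mul_pos (inv_pos.2 (upos y hyF)) (lt_of_le_of_ne (h1 y) fun e => ?_)
        rcases Finset.mem_union.1 ((h2 y).2 e.symm) with h | h
        · exact hyF h
        · exact hyS h
    rw [cellSign, if_congr hex rfl rfl]
    refine if_ctx_congr Iff.rfl (fun _ => ?_) fun _ => rfl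
    rw [show Module.finrank ℝ E + rk w (F ∪ S) + 1 =
      Module.finrank ℝ (N ⊓ agree f S : Submodule ℝ (Module.Dual ℝ E)) + 2 * rk w (F ∪ S) by omega,
      pow_add, pow_mul]
    simp
  rw [Finset.sum_congr rfl hs, cellSign, if_pos ⟨0, N.zero_mem, trivial⟩] at key
  have hsum : ∑ W : Finset ι with IsFaceSet w W ∧ F ⊆ W ∧ W ⊆ G, (-1 : ℤ) ^ rk w W =
      ∑ S ∈ (G \ F).powerset, if IsFaceSet w (F ∪ S) then (-1 : ℤ) ^ rk w (F ∪ S) else 0 := by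
    rw [← Finset.sum_filter]
    refine Finset.sum_nbij' (fun W => W \ F) (fun S => F ∪ S) ?_ ?_ ?_ ?_ ?_
    · intro W hW
      simp only [Finset.mem_filter, Finset.mem_univ, true_and] at hW
      simp only [Finset.mem_filter, Finset.mem_powerset, Finset.union_sdiff_of_subset hW.2.1]
      exact ⟨Finset.sdiff_subset_sdiff hW.2.2 le_rfl, hW.1⟩
    · intro S hS
      simp only [Finset.mem_filter, Finset.mem_powerset] at hS
      simp only [Finset.mem_filter, Finset.mem_univ, true_and]
      exact ⟨hS.2, Finset.subset_union_left, Finset.union_subset h.le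
        (hS.1.trans Finset.sdiff_subset)⟩
    · intro W hW
      simp only [Finset.mem_filter, Finset.mem_univ, true_and] at hW
      exact Finset.union_sdiff_of_subset hW.2.1
    · intro S hS
      simp only [Finset.mem_filter, Finset.mem_powerset] at hS
      have : Disjoint F S := (Finset.disjoint_of_subset_left hS.1 Finset.sdiff_disjoint).symm
      rw [Finset.union_sdiff_left, Finset.sdiff_eq_self_of_disjoint this.symm]
    · intro W hW
      simp only [Finset.mem_filter, Finset.mem_univ, true_and] at hW
      rw [Finset.union_sdiff_of_subset hW.2.1]
  have hsplit : ∀ S ∈ (G \ F).powerset,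
      (if IsFaceSet w (F ∪ S) then (-1 : ℤ) ^ rk w (F ∪ S) else 0) =
      (if S = ∅ then (-1) ^ rk w F else 0) - (-1) ^ Module.finrank ℝ E *
      if S.Nonempty then
        (if IsFaceSet w (F ∪ S) then (-1) ^ (Module.finrank ℝ E + rk w (F ∪ S) + 1) else 0)
      else 0 := by
    intro S _
    rcases S.eq_empty_or_nonempty with rfl | hne
    · simp [hF]
    · simp only [hne.ne_empty, hne, if_true, if_false, zero_sub]
      split_ifs
      · rw [pow_succ, pow_add, mul_neg_one, mul_neg, ← mul_assoc, ← pow_add, ← two_mul, pow_mul]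
        simp
      · simp
  rw [hsum, Finset.sum_congr rfl hsplit, Finset.sum_sub_distrib, ← Finset.mul_sum, key,
    Finset.sum_ite_eq', if_pos (Finset.empty_mem_powerset _), ← pow_add, ← hd, add_assoc, ← two_mul,
    pow_add, pow_mul]
  simp

end Configurations

/-! ### Counting chains in ranked posets and in cones over them -/

section Chains

variable {α β κ : Type*} [Fintype α] [PartialOrder α] [Fintype β] [PartialOrder β]

open Classical in
/-- For a list `a > b > ⋯` of dimensions, the number of chains `x > y > z > ⋯` of elements `y, z, …`
of `𝓕` of ranks `a + 1, b + 1, …`. -/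
noncomputable def chainCount (𝓕 : α → Prop) (r : α → ℕ) : List ℕ → α → ℤ
  | [], _ => 1
  | a :: l, x => ∑ y with 𝓕 y ∧ y < x ∧ r y = a + 1, chainCount 𝓕 r l y

open Classical in
/-- The number of chains below the cone over `x`. -/
noncomputable def coneCount (𝓕 : α → Prop) (r : α → ℕ) : List ℕ → α → ℤ
  | [], _ => 1
  | a :: l, x => ∑ y with 𝓕 y ∧ y ≤ x ∧ r y = a + 1, chainCount 𝓕 r l y +
      ∑ y with 𝓕 y ∧ y < x ∧ r y = a, coneCount 𝓕 r l y

open Classical in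
theorem chainCount_cons_eq_zero {𝓕 : α → Prop} {r : α → ℕ} {a : ℕ} {l : List ℕ} {x : α}
    (h : ∀ y, 𝓕 y → y < x → r y ≠ a + 1) : chainCount 𝓕 r (a :: l) x = 0 := by
  rw [chainCount]
  refine Finset.sum_eq_zero fun y hy => ?_
  obtain ⟨h1, h2, h3⟩ := (Finset.mem_filter.1 hy).2
  exact absurd h3 (h y h1 h2)

/-- The list without its head if the head is `d`. -/
def dropHead (d : ℕ) : List ℕ → List ℕ
  | [] => []
  | a :: l => if a = d then l else a :: l

/-- The lists obtained from a strictly decreasing list by lowering the elements of a nonempty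
initial piece by `1`, duplicates and `-1` being deleted. -/
def shifts : List ℕ → List (List ℕ)
  | [] => []
  | a :: l => if a = 0 then [[]] else (dropHead (a - 1) l :: shifts l).map ((a - 1) :: ·)

theorem sum_sum_map {γ δ : Type*} (s : Finset γ) (L : List δ) (f : δ → γ → ℤ) :
    ∑ y ∈ s, (L.map fun l => f l y).sum = (L.map fun l => ∑ y ∈ s, f l y).sum := by
  induction L with
  | nil => simp
  | cons a L ih => simp [Finset.sum_add_distrib, ih]

open Classical in
-- The sum counts the chains whose largest element is a cone. The cones form an initial piece of the
-- list, and passing to their bases lowers this piece by `1`. For `a = 0` the cone is the apex,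
-- whose base is the least element `b`; this entry disappears from the list.
theorem sum_coneCount {𝓕 : α → Prop} {r : α → ℕ} {b : α} (hb : 𝓕 b) (hb0 : r b = 0)
    (hb' : ∀ y, 𝓕 y → r y = 0 → y = b) {a : ℕ} {l : List ℕ} (hl : (a :: l).Pairwise (· > ·))
    (ih : ∀ d x, 𝓕 x → r x = d + 1 → (∀ c ∈ l, c ≤ d) →
      coneCount 𝓕 r l x = chainCount 𝓕 r (dropHead d l) x +
        ((shifts l).map fun m => chainCount 𝓕 r m x).sum)
    {x : α} (hx : b < x) :
    ∑ y with 𝓕 y ∧ y < x ∧ r y = a, coneCount 𝓕 r l y =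
      ((shifts (a :: l)).map fun m => chainCount 𝓕 r m x).sum := by
  have hl' := List.pairwise_cons.1 hl
  cases a with
  | zero =>
    have : l = [] := List.eq_nil_iff_forall_not_mem.2 fun c hc => absurd (hl'.1 c hc) (by simp)
    subst this
    have : ({y | 𝓕 y ∧ y < x ∧ r y = 0} : Finset α) = {b} := by
      ext y
      simp only [Finset.mem_filter, Finset.mem_univ, true_and, Finset.mem_singleton]
      exact ⟨fun h => hb' y h.1 h.2.2, fun h => h ▸ ⟨hb, hx, hb0⟩⟩
    simp [shifts, chainCount, this, coneCount]
  | succ a =>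
    simp only [shifts, Nat.succ_ne_zero, if_false, Nat.add_sub_cancel, List.map_map, List.map_cons,
      List.sum_cons]
    rw [Finset.sum_congr rfl fun y hy => ih a y (Finset.mem_filter.1 hy).2.1
      (Finset.mem_filter.1 hy).2.2.2 fun c hc => Nat.lt_succ_iff.1 (hl'.1 c hc),
      Finset.sum_add_distrib, sum_sum_map]
    simp only [chainCount, Function.comp_def]

open Classical in
-- The largest element of the chain either lies in the base or is a cone. In the first case it may
-- be `x` itself, the only element of dimension `d`, and is then forced; hence `dropHead`.
theorem coneCount_eq {𝓕 : α → Prop} {r : α → ℕ} {b : α} (hb : 𝓕 b) (hb0 : r b = 0)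
    (hb' : ∀ y, 𝓕 y → r y = 0 → y = b) (hb'' : ∀ x, b ≤ x)
    (hr : ∀ x y, 𝓕 x → x < y → r x < r y) :
    ∀ (l : List ℕ), l.Pairwise (· > ·) → ∀ d x, 𝓕 x → r x = d + 1 → (∀ c ∈ l, c ≤ d) →
      coneCount 𝓕 r l x = chainCount 𝓕 r (dropHead d l) x +
        ((shifts l).map fun m => chainCount 𝓕 r m x).sum := by
  intro l
  induction l with
  | nil => intros; simp [coneCount, dropHead, shifts, chainCount]
  | cons a l ih =>
    intro hl d x hx hd hc
    have hbx : b < x := lt_of_le_of_ne (hb'' x) fun e => by rw [← e] at hd; omega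
    rw [← sum_coneCount hb hb0 hb' hl (ih (List.pairwise_cons.1 hl).2) hbx, coneCount]
    congr 1
    by_cases had : a = d
    · have : ({y | 𝓕 y ∧ y ≤ x ∧ r y = a + 1} : Finset α) = {x} := by
        ext y
        simp only [Finset.mem_filter, Finset.mem_univ, true_and, Finset.mem_singleton]
        refine ⟨fun h => ?_, fun h => ?_⟩
        · by_contra hne
          have := hr y x h.1 (lt_of_le_of_ne h.2.1 hne)
          omega
        · subst h
          exact ⟨hx, le_rfl, by omega⟩
      rw [this, Finset.sum_singleton, dropHead, if_pos had]
    · rw [dropHead, if_neg had, chainCount]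
      refine Finset.sum_congr ?_ fun _ _ => rfl
      ext y
      simp only [Finset.mem_filter, Finset.mem_univ, true_and]
      refine and_congr_right fun _ => and_congr_left fun hy => ⟨fun h => lt_of_le_of_ne h ?_, le_of_lt⟩
      rintro rfl
      omega

/-- `j` and `k c` (`c ∈ κ`) embed `𝓕` as a base and as the cones over the base. -/
structure IsConing (𝓕 : α → Prop) (r : α → ℕ) (𝓖 : β → Prop) (s : β → ℕ) (D : α → Prop)
    (j : α → β) (k : κ → α → β) : Prop where
  lower : ∀ x y, D x → y ≤ x → D y
  inj_base : Function.Injective j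
  inj_cone : ∀ c, Function.Injective (k c)
  ne_base : ∀ c x y, j x ≠ k c y
  ne_cone : ∀ c c' x y, c ≠ c' → k c x ≠ k c' y
  rank_base : ∀ x, 𝓕 x → s (j x) = r x
  rank_cone : ∀ c x, 𝓕 x → s (k c x) = r x + 1
  lt_base : ∀ x, D x → ∀ y, (𝓖 y ∧ y < j x) ↔ ∃ z, 𝓕 z ∧ z < x ∧ y = j z
  lt_cone : ∀ c x, D x → ∀ y, (𝓖 y ∧ y < k c x) ↔
    ∃ z, 𝓕 z ∧ (z ≤ x ∧ y = j z ∨ z < x ∧ y = k c z)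

namespace IsConing

variable {𝓕 : α → Prop} {r : α → ℕ} {𝓖 : β → Prop} {s : β → ℕ} {D : α → Prop} {j : α → β}
  {k : κ → α → β}

theorem chainCount_base (h : IsConing 𝓕 r 𝓖 s D j k) (l : List ℕ) :
    ∀ x, D x → chainCount 𝓖 s l (j x) = chainCount 𝓕 r l x := by
  classical
  induction l with
  | nil => intros; rfl
  | cons a l ih =>
    intro x hx
    have : ({y | 𝓖 y ∧ y < j x ∧ s y = a + 1} : Finset β) =
        ({y | 𝓕 y ∧ y < x ∧ r y = a + 1} : Finset α).image j := by
      ext y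
      simp only [Finset.mem_filter, Finset.mem_univ, true_and, Finset.mem_image, ← and_assoc,
        h.lt_base x hx]
      constructor
      · rintro ⟨⟨z, ⟨h1, h2⟩, rfl⟩, h3⟩
        exact ⟨z, ⟨⟨h1, h2⟩, by rw [← h3, h.rank_base z h1]⟩, rfl⟩
      · rintro ⟨z, ⟨⟨h1, h2⟩, h3⟩, rfl⟩
        exact ⟨⟨z, ⟨h1, h2⟩, rfl⟩, by rw [h.rank_base z h1, h3]⟩
    rw [chainCount, chainCount, this, Finset.sum_image h.inj_base.injOn]
    exact Finset.sum_congr rfl fun y hy =>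
      ih y (h.lower x y hx (Finset.mem_filter.1 hy).2.2.1.le)

theorem chainCount_cone (h : IsConing 𝓕 r 𝓖 s D j k) (c : κ) (l : List ℕ) :
    ∀ x, D x → chainCount 𝓖 s l (k c x) = coneCount 𝓕 r l x := by
  classical
  induction l with
  | nil => intros; rfl
  | cons a l ih =>
    intro x hx
    have : ({y | 𝓖 y ∧ y < k c x ∧ s y = a + 1} : Finset β) =
        ({y | 𝓕 y ∧ y ≤ x ∧ r y = a + 1} : Finset α).image j ∪
        ({y | 𝓕 y ∧ y < x ∧ r y = a} : Finset α).image (k c) := by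
      ext y
      simp only [Finset.mem_filter, Finset.mem_univ, true_and, Finset.mem_image, Finset.mem_union]
      rw [← and_assoc, h.lt_cone c x hx]
      constructor
      · rintro ⟨⟨z, h1, ⟨h2, rfl⟩ | ⟨h2, rfl⟩⟩, h3⟩
        · exact Or.inl ⟨z, ⟨h1, h2, by rw [← h3, h.rank_base z h1]⟩, rfl⟩
        · rw [h.rank_cone c z h1] at h3
          exact Or.inr ⟨z, ⟨h1, h2, by omega⟩, rfl⟩
      · rintro (⟨z, ⟨h1, h2, h3⟩, rfl⟩ | ⟨z, ⟨h1, h2, h3⟩, rfl⟩)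
        · exact ⟨⟨z, h1, Or.inl ⟨h2, rfl⟩⟩, by rw [h.rank_base z h1, h3]⟩
        · exact ⟨⟨z, h1, Or.inr ⟨h2, rfl⟩⟩, by rw [h.rank_cone c z h1, h3]⟩
    rw [chainCount, coneCount, this, Finset.sum_union, Finset.sum_image h.inj_base.injOn,
      Finset.sum_image (h.inj_cone c).injOn]
    · congr 1
      · exact Finset.sum_congr rfl fun y hy =>
          h.chainCount_base l y (h.lower x y hx (Finset.mem_filter.1 hy).2.2.1)
      · exact Finset.sum_congr rfl fun y hy =>
          ih y (h.lower x y hx (Finset.mem_filter.1 hy).2.2.1.le)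
    · rw [Finset.disjoint_left]
      simp only [Finset.mem_image]
      rintro _ ⟨z, -, rfl⟩ ⟨z', -, e⟩
      exact h.ne_base c z z' e.symm

open Classical in
-- Made for bipyramids, whose top element is neither a base element nor a cone: what lies below it
-- comes from proper faces of the base, taken as they are or coned from one of the apices.
theorem chainCount_top [Fintype κ] (h : IsConing 𝓕 r 𝓖 s D j k) {x : α} {t : β} (hD : ∀ y, y < x → D y)
    (ht : ∀ y, (𝓖 y ∧ y < t) ↔ ∃ z, 𝓕 z ∧ z < x ∧ (y = j z ∨ ∃ c, y = k c z)) (a : ℕ)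
    (l : List ℕ) :
    chainCount 𝓖 s (a :: l) t = chainCount 𝓕 r (a :: l) x +
      Fintype.card κ * ∑ y with 𝓕 y ∧ y < x ∧ r y = a, coneCount 𝓕 r l y := by
  have : ({y | 𝓖 y ∧ y < t ∧ s y = a + 1} : Finset β) =
      ({y | 𝓕 y ∧ y < x ∧ r y = a + 1} : Finset α).image j ∪
      (Finset.univ ×ˢ ({y | 𝓕 y ∧ y < x ∧ r y = a} : Finset α)).image fun p : κ × α => k p.1 p.2 := by
    ext y
    simp only [Finset.mem_filter, Finset.mem_univ, true_and, Finset.mem_image, Finset.mem_union,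
      Finset.mem_product, Prod.exists]
    rw [← and_assoc, ht]
    constructor
    · rintro ⟨⟨z, h1, h2, rfl | ⟨c, rfl⟩⟩, h3⟩
      · exact Or.inl ⟨z, ⟨h1, h2, by rw [← h3, h.rank_base z h1]⟩, rfl⟩
      · rw [h.rank_cone c z h1] at h3
        exact Or.inr ⟨c, z, ⟨h1, h2, by omega⟩, rfl⟩
    · rintro (⟨z, ⟨h1, h2, h3⟩, rfl⟩ | ⟨c, z, ⟨h1, h2, h3⟩, rfl⟩)
      · exact ⟨⟨z, h1, h2, Or.inl rfl⟩, by rw [h.rank_base z h1, h3]⟩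
      · exact ⟨⟨z, h1, h2, Or.inr ⟨c, rfl⟩⟩, by rw [h.rank_cone c z h1, h3]⟩
  rw [chainCount, chainCount, this, Finset.sum_union, Finset.sum_image h.inj_base.injOn,
    Finset.sum_image, Finset.sum_product]
  · congr 1
    · exact Finset.sum_congr rfl fun y hy =>
        h.chainCount_base l y (hD y (Finset.mem_filter.1 hy).2.2.1)
    · rw [← nsmul_eq_mul, ← Finset.card_univ, ← Finset.sum_const]
      exact Finset.sum_congr rfl fun c _ => Finset.sum_congr rfl fun y hy =>
        h.chainCount_cone c l y (hD y (Finset.mem_filter.1 hy).2.2.1)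
  · rintro ⟨c, z⟩ - ⟨c', z'⟩ - e
    obtain rfl : c = c' := by
      by_contra hc
      exact h.ne_cone c c' z z' hc e
    rw [show z = z' from h.inj_cone c e]
  · rw [Finset.disjoint_left]
    simp only [Finset.mem_image]
    rintro _ ⟨z, -, rfl⟩ ⟨z', -, e⟩
    exact h.ne_base _ z _ e.symm

end IsConing

end Chains

/-! ### Exposed faces of polytopes as face sets of homogenised points -/

section Geometry

variable {ι V : Type*} [AddCommGroup V] [Module ℝ V]

/-- The homogenisation `i ↦ (v i, 1)` of a family of points. -/
def hom (v : ι → V) (i : ι) : V × ℝ := (v i, 1)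

theorem isFaceSet_hom_iff {v : ι → V} {W : Finset ι} :
    IsFaceSet (hom v) W ↔ ∃ (l : V →ₗ[ℝ] ℝ) (c : ℝ), (∀ i, l (v i) ≤ c) ∧
      ∀ i, i ∈ W ↔ l (v i) = c := by
  constructor
  · rintro ⟨φ, h1, h2⟩
    have key : ∀ i, φ (hom v i) = φ (0, 1) + φ.comp (LinearMap.inl ℝ V ℝ) (v i) := fun i => by
      rw [LinearMap.comp_apply, ← map_add]
      simp [hom]
    refine ⟨-φ.comp (LinearMap.inl ℝ V ℝ), φ (0, 1), fun i => ?_, fun i => ?_⟩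
    · have := h1 i
      rw [key] at this
      rw [LinearMap.neg_apply]
      linarith
    · rw [h2, key, LinearMap.neg_apply]
      constructor <;> intro h <;> linarith
  · rintro ⟨l, c, h1, h2⟩
    have key : ∀ i, (c • LinearMap.snd ℝ V ℝ - l.comp (LinearMap.fst ℝ V ℝ)) (hom v i) =
        c - l (v i) := fun i => by simp [hom]
    refine ⟨c • LinearMap.snd ℝ V ℝ - l.comp (LinearMap.fst ℝ V ℝ), fun i => ?_, fun i => ?_⟩
    · rw [key]; linarith [h1 i]
    · rw [h2, key, sub_eq_zero, eq_comm]

/-- The open half space together with the hull of the points on the hyperplane is convex and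
contains all the points, hence contains their hull. -/
theorem setOf_convexHull_eq {v : ι → V} {l : V →ₗ[ℝ] ℝ} {c : ℝ} (h : ∀ i, l (v i) ≤ c) :
    {x ∈ convexHull ℝ (Set.range v) | l x = c} = convexHull ℝ (v '' {i | l (v i) = c}) := by
  set B := convexHull ℝ (v '' {i | l (v i) = c}) with hB
  have hBc : ∀ x ∈ B, l x = c := fun x hx => by
    have : B ⊆ l ⁻¹' {c} := convexHull_min (by rintro _ ⟨i, hi, rfl⟩; exact hi)
      ((convex_singleton c).linear_preimage l)
    exact this hx
  refine Set.Subset.antisymm ?_ fun x hx =>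
    ⟨convexHull_mono (Set.image_subset_range _ _) hx, hBc x hx⟩
  have hT : Convex ℝ ({x | l x < c} ∪ B) := by
    have hle : ∀ x ∈ {x | l x < c} ∪ B, l x ≤ c := by
      rintro x (hx | hx)
      · exact le_of_lt hx
      · exact (hBc x hx).le
    intro x hx y hy a b ha hb hab
    have hx' := hle x hx
    have hy' := hle y hy
    rcases ha.eq_or_lt with rfl | ha
    · rw [zero_add] at hab
      subst hab
      simpa using hy
    rcases hb.eq_or_lt with rfl | hb
    · rw [add_zero] at hab
      subst hab
      simpa using hx
    by_cases hxy : x ∈ B ∧ y ∈ B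
    · exact Or.inr (convex_convexHull ℝ _ hxy.1 hxy.2 ha.le hb.le hab)
    · refine Or.inl ?_
      have hc : a * c + b * c = c := by rw [← add_mul, hab, one_mul]
      simp only [Set.mem_ofPred_eq, map_add, map_smul, smul_eq_mul]
      rcases not_and_or.1 hxy with h | h
      · have : l x < c := hx.resolve_right h
        nlinarith
      · have : l y < c := hy.resolve_right h
        nlinarith
  rintro x ⟨hx, hxc⟩
  have : x ∈ {x | l x < c} ∪ B := by
    refine convexHull_min ?_ hT hx
    rintro _ ⟨i, rfl⟩
    rcases (h i).lt_or_eq with h | h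
    · exact Or.inl h
    · exact Or.inr (subset_convexHull ℝ _ ⟨i, h, rfl⟩)
  rcases this with h | h
  · exact absurd hxc (ne_of_lt h)
  · exact h

theorem mem_convexHull_image_iff {v : ι → V} {W : Finset ι} (hW : IsFaceSet (hom v) W) (i : ι) :
    v i ∈ convexHull ℝ (v '' W) ↔ i ∈ W := by
  obtain ⟨l, c, h1, h2⟩ := isFaceSet_hom_iff.1 hW
  have : (W : Set ι) = {i | l (v i) = c} := by ext i; exact h2 i
  rw [this, ← setOf_convexHull_eq h1, h2]
  exact ⟨fun h => h.2, fun h => ⟨subset_convexHull ℝ _ ⟨i, rfl⟩, h⟩⟩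

theorem rk_hom [FiniteDimensional ℝ V] {v : ι → V} {W : Finset ι} (hW : W.Nonempty) :
    rk (hom v) W = Module.finrank ℝ (vectorSpan ℝ (v '' W)) + 1 := by
  obtain ⟨i, hi⟩ := hW
  set S := Submodule.span ℝ (hom v '' (W : Set ι)) with hS
  have hiS : hom v i ∈ S := Submodule.subset_span ⟨i, hi, rfl⟩
  have h1 : (vectorSpan ℝ (v '' (W : Set ι))).map (LinearMap.inl ℝ V ℝ) ≤
      S ⊓ LinearMap.ker (LinearMap.snd ℝ V ℝ) := by
    rw [vectorSpan_eq_span_vsub_set_right ℝ (Set.mem_image_of_mem v hi), Submodule.map_span_le]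
    rintro _ ⟨_, ⟨j, hj, rfl⟩, rfl⟩
    refine ⟨?_, by simp⟩
    have : LinearMap.inl ℝ V ℝ (v j -ᵥ v i) = hom v j - hom v i := by simp [hom]
    rw [this]
    exact S.sub_mem (Submodule.subset_span ⟨j, hj, rfl⟩) hiS
  -- The map `x ↦ x - x.2 • hom v i` is the identity on vectors with last coordinate `0` and sends
  -- each `hom v j` to a difference of points. So the part of `S` at height `0` is the direction
  -- space, of codimension `1` in `S`.
  have h2 : S ≤ ((vectorSpan ℝ (v '' (W : Set ι))).map (LinearMap.inl ℝ V ℝ)).comap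
      (LinearMap.id - (LinearMap.snd ℝ V ℝ).smulRight (hom v i)) := by
    rw [hS, Submodule.span_le]
    rintro _ ⟨j, hj, rfl⟩
    refine ⟨v j -ᵥ v i, vsub_mem_vectorSpan ℝ ⟨j, hj, rfl⟩ ⟨i, hi, rfl⟩, by simp [hom]⟩
  have h3 : S ⊓ LinearMap.ker (LinearMap.snd ℝ V ℝ) =
      (vectorSpan ℝ (v '' (W : Set ι))).map (LinearMap.inl ℝ V ℝ) := by
    refine le_antisymm (fun x hx => ?_) h1
    have h4 : x.2 = 0 := hx.2
    simpa [h4] using h2 hx.1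
  rw [rk, ← hS, ← finrank_inf_ker_add_one (h := LinearMap.snd ℝ V ℝ) hiS (by simp [hom]), h3,
    LinearEquiv.finrank_eq (Submodule.equivMapOfInjective (LinearMap.inl ℝ V ℝ)
      LinearMap.inl_injective (vectorSpan ℝ (v '' (W : Set ι))))]

end Geometry

/-- A family of points whose convex hull is the polytope `P`. -/
def Presents {ι : Type*} {n : ℕ} (v : ι → Fin n → ℝ) (P : Polytope n) : Prop :=
  P.carrier = convexHull ℝ (Set.range v)

theorem Presents.nonempty {ι : Type*} {n : ℕ} {v : ι → Fin n → ℝ} {P : Polytope n}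
    (h : Presents v P) : Nonempty ι := by
  by_contra hne
  rw [not_nonempty_iff] at hne
  have h1 := P.affineSpan_eq_top
  rw [show P.carrier = _ from h, affineSpan_convexHull, Set.range_eq_empty, AffineSubspace.span_empty] at h1
  exact AffineSubspace.bot_ne_top ℝ (Fin n → ℝ) (Fin n → ℝ) h1

open Classical in
/-- The indices of the points on a face. -/
noncomputable def faceSet {ι : Type*} [Fintype ι] {n : ℕ} (v : ι → Fin n → ℝ) {P : Polytope n}
    (F : Face P) : Finset ι := {i | v i ∈ F.1}

namespace Presents

variable {ι : Type*} [Fintype ι] {n : ℕ} {v : ι → Fin n → ℝ} {P : Polytope n}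

/-- Together with `exists_faceSet_eq` this identifies the faces of `P` with the nonempty face sets,
whether or not every `v i` is a vertex. -/
theorem isFaceSet_faceSet (h : Presents v P) (F : Face P) :
    IsFaceSet (hom v) (faceSet v F) ∧ F.1 = convexHull ℝ (v '' faceSet v F) := by
  obtain ⟨F, hF, hE⟩ := F
  obtain ⟨l, rfl⟩ := hE hF
  obtain ⟨x, hx⟩ := hF
  have h0 : ∀ i, v i ∈ P.carrier := fun i => by
    rw [show P.carrier = _ from h]; exact subset_convexHull ℝ _ ⟨i, rfl⟩
  have h1 : ∀ i, (l : (Fin n → ℝ) →ₗ[ℝ] ℝ) (v i) ≤ l x := fun i => hx.2 _ (h0 i)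
  have h2 : {x ∈ P.carrier | ∀ y ∈ P.carrier, l y ≤ l x} =
      {y ∈ convexHull ℝ (Set.range v) | (l : (Fin n → ℝ) →ₗ[ℝ] ℝ) y = l x} := by
    ext y
    rw [Set.mem_ofPred_eq, Set.mem_ofPred_eq, ← show P.carrier = _ from h]
    exact and_congr_right fun hy => ⟨fun h => le_antisymm (hx.2 y hy) (h x hx.1),
      fun h z hz => (hx.2 z hz).trans (ge_of_eq h)⟩
  have h3 : ∀ i, i ∈ faceSet v (⟨_, ⟨x, hx⟩, hE⟩ : Face P) ↔
      (l : (Fin n → ℝ) →ₗ[ℝ] ℝ) (v i) = l x := fun i => by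
    simp only [faceSet, Finset.mem_filter, Finset.mem_univ, true_and]
    rw [h2]
    exact ⟨fun h => h.2, fun h => ⟨subset_convexHull ℝ _ ⟨i, rfl⟩, h⟩⟩
  refine ⟨isFaceSet_hom_iff.2 ⟨l, l x, h1, h3⟩, ?_⟩
  change {x ∈ P.carrier | ∀ y ∈ P.carrier, l y ≤ l x} = _
  refine h2.trans ((setOf_convexHull_eq h1).trans ?_)
  congr 2
  ext i
  exact (h3 i).symm

theorem faceSet_nonempty (h : Presents v P) (F : Face P) : (faceSet v F).Nonempty := by
  have := F.2.1
  rw [(h.isFaceSet_faceSet F).2, convexHull_nonempty_iff, Set.image_nonempty] at this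
  exact_mod_cast this

theorem exists_faceSet_eq (h : Presents v P) {W : Finset ι} (hW : IsFaceSet (hom v) W)
    (hne : W.Nonempty) : ∃ F : Face P, faceSet v F = W := by
  obtain ⟨l, c, h1, h2⟩ := isFaceSet_hom_iff.1 hW
  obtain ⟨i, hi⟩ := id hne
  have hWs : (W : Set ι) = {i | l (v i) = c} := by ext i; exact h2 i
  have hc : P.carrier = _ := h
  have hle : ∀ y ∈ P.carrier, l y ≤ c := fun y hy => by
    rw [hc] at hy
    have : convexHull ℝ (Set.range v) ⊆ l ⁻¹' Set.Iic c := convexHull_min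
      (by rintro _ ⟨i, rfl⟩; exact h1 i) ((convex_Iic c).linear_preimage l)
    exact this hy
  have hi' : v i ∈ P.carrier := by rw [hc]; exact subset_convexHull ℝ _ ⟨i, rfl⟩
  have hic := (h2 i).1 hi
  refine ⟨⟨convexHull ℝ (v '' W), (Set.Nonempty.image v (by exact_mod_cast hne)).convexHull, fun _ =>
    ⟨LinearMap.toContinuousLinearMap l, ?_⟩⟩, ?_⟩
  · rw [hWs, ← setOf_convexHull_eq h1, ← hc]
    ext y
    simp only [Set.mem_ofPred_eq, LinearMap.coe_toContinuousLinearMap']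
    exact and_congr_right fun hy => ⟨fun h z hz => (hle z hz).trans (ge_of_eq h),
      fun h => le_antisymm (hle y hy) (hic ▸ h _ hi')⟩
  · ext j
    simp only [faceSet, Finset.mem_filter, Finset.mem_univ, true_and]
    exact mem_convexHull_image_iff hW j

theorem faceSet_le_iff (h : Presents v P) (F F' : Face P) : faceSet v F ≤ faceSet v F' ↔ F ≤ F' := by
  constructor
  · intro hle
    change F.1 ⊆ F'.1
    rw [(h.isFaceSet_faceSet F).2, (h.isFaceSet_faceSet F').2]
    exact convexHull_mono (Set.image_mono (by exact_mod_cast hle))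
  · intro hle i hi
    simp only [faceSet, Finset.mem_filter, Finset.mem_univ, true_and] at hi ⊢
    exact hle hi

theorem faceSet_lt_iff (h : Presents v P) (F F' : Face P) : faceSet v F < faceSet v F' ↔ F < F' := by
  rw [lt_iff_le_not_ge, lt_iff_le_not_ge, h.faceSet_le_iff, h.faceSet_le_iff]

theorem faceSet_injective (h : Presents v P) : Function.Injective (faceSet v : Face P → Finset ι) :=
  fun F F' e => le_antisymm ((h.faceSet_le_iff F F').1 e.le) ((h.faceSet_le_iff F' F).1 e.ge)

theorem rk_faceSet (h : Presents v P) (F : Face P) : rk (hom v) (faceSet v F) = F.dim + 1 := by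
  rw [rk_hom (h.faceSet_nonempty F), Face.dim, (h.isFaceSet_faceSet F).2,
    ← direction_affineSpan, ← direction_affineSpan, affineSpan_convexHull]

theorem rk_univ (h : Presents v P) : rk (hom v) Finset.univ = n + 1 := by
  have := h.nonempty
  rw [rk_hom Finset.univ_nonempty, Finset.coe_univ, Set.image_univ, ← direction_affineSpan,
    ← affineSpan_convexHull, ← show P.carrier = _ from h, P.affineSpan_eq_top, AffineSubspace.direction_top]
  simp

end Presents

theorem rk_empty {ι E : Type*} [AddCommGroup E] [Module ℝ E] (w : ι → E) : rk w ∅ = 0 := by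
  rw [rk, Finset.coe_empty, Set.image_empty, Submodule.span_empty, finrank_bot]

/-- The height functional is `1` on all homogenised points. So the empty face, left out of `Face`,
is present among the face sets as the bottom element of rank `0`. -/
theorem isFaceSet_hom_empty {ι V : Type*} [AddCommGroup V] [Module ℝ V] (v : ι → V) :
    IsFaceSet (hom v) ∅ :=
  ⟨LinearMap.snd ℝ V ℝ, by simp [hom], by simp [hom]⟩

theorem eq_empty_of_rk_hom {ι V : Type*} [AddCommGroup V] [Module ℝ V] [FiniteDimensional ℝ V]
    {v : ι → V} {W : Finset ι} (h : rk (hom v) W = 0) : W = ∅ := by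
  by_contra hne
  rw [rk_hom (Finset.nonempty_iff_ne_empty.2 hne)] at h
  omega

theorem Polytope.exists_presents {n : ℕ} (P : Polytope n) :
    ∃ (ι : Type) (_ : Fintype ι) (v : ι → Fin n → ℝ), Presents v P := by
  obtain ⟨V, hV⟩ := P.exists_vertices
  exact ⟨V, inferInstance, fun i => i.1, by rw [Presents, hV]; simp⟩

/-! ### From Euler's relation to the Bayer-Billera relations -/

section ChainSets

variable {α : Type*} [Fintype α] [PartialOrder α]

/-- The number of chains below `x` of elements of `𝓕` with ranks `a + 1`, `a ∈ S`. -/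
noncomputable def setCount (𝓕 : α → Prop) (r : α → ℕ) (S : Finset ℕ) (x : α) : ℤ :=
  chainCount 𝓕 r (S.sort (· ≥ ·)) x

theorem sort_insert_max {a : ℕ} {S : Finset ℕ} (h : ∀ b ∈ S, b < a) :
    (insert a S).sort (· ≥ ·) = a :: S.sort (· ≥ ·) :=
  Finset.sort_insert (· ≥ ·) (fun b hb => (h b hb).le) fun ha => (h a ha).false

theorem setCount_empty (𝓕 : α → Prop) (r : α → ℕ) (x : α) : setCount 𝓕 r ∅ x = 1 := by
  simp [setCount, chainCount]

open Classical in
theorem setCount_insert_max (𝓕 : α → Prop) (r : α → ℕ) {a : ℕ} {S : Finset ℕ}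
    (h : ∀ b ∈ S, b < a) (x : α) : setCount 𝓕 r (insert a S) x =
      ∑ y with 𝓕 y ∧ y < x ∧ r y = a + 1, setCount 𝓕 r S y := by
  rw [setCount, sort_insert_max h, chainCount]
  rfl

open Classical in
/-- The alternating number of elements of an open interval that satisfies Euler's relation. -/
theorem sum_Ioo_card {𝓕 : α → Prop} {r : α → ℕ} (hr : ∀ x y, 𝓕 x → x < y → r x < r y)
    {z x : α} (hz : 𝓕 z) (hx : 𝓕 x) (hzx : z < x)
    (he : ∑ y with 𝓕 y ∧ z ≤ y ∧ y ≤ x, (-1 : ℤ) ^ r y = 0) {i : ℤ} {d : ℕ} (hi : (r z : ℤ) = i + 1)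
    (hd : r x = d + 1) :
    ∑ j ∈ Finset.Ioo i d, (-1 : ℤ) ^ (j - i - 1).toNat *
      ∑ y with (𝓕 y ∧ y < x ∧ r y = j.toNat + 1) ∧ z < y, 1 = 1 - (-1) ^ ((d : ℤ) - i - 1).toNat := by
  have h1 : ∀ j ∈ Finset.Ioo i d, (-1 : ℤ) ^ (j - i - 1).toNat *
      ∑ y with (𝓕 y ∧ y < x ∧ r y = j.toNat + 1) ∧ z < y, 1 =
      ∑ y ∈ {y | 𝓕 y ∧ z < y ∧ y < x} with (r y : ℤ) - 1 = j, -((-1 : ℤ) ^ r z * (-1) ^ r y) := by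
    intro j hj
    rw [Finset.mem_Ioo] at hj
    rw [Finset.mul_sum, Finset.filter_filter]
    refine Finset.sum_congr ?_ fun y hy => ?_
    · ext y
      simp only [Finset.mem_filter, Finset.mem_univ, true_and]
      constructor
      · rintro ⟨⟨h1, h2, h3⟩, h4⟩; exact ⟨⟨h1, h4, h2⟩, by omega⟩
      · rintro ⟨⟨h1, h4, h2⟩, h3⟩; exact ⟨⟨h1, h2, by omega⟩, h4⟩
    · simp only [Finset.mem_filter, Finset.mem_univ, true_and] at hy
      have h3 := hr z y hz hy.1.2.1
      rw [show r y = r z + (j - i - 1).toNat + 1 by omega, pow_succ, pow_add, ← mul_assoc,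
        ← mul_assoc, ← pow_add, ← two_mul, pow_mul]
      simp
  have h2 : ∀ y ∈ ({y | 𝓕 y ∧ z < y ∧ y < x} : Finset α), (r y : ℤ) - 1 ∈ Finset.Ioo i (d : ℤ) := by
    intro y hy
    simp only [Finset.mem_filter, Finset.mem_univ, true_and] at hy
    have h3 := hr z y hz hy.2.1
    have h4 := hr y x hy.1 hy.2.2
    rw [Finset.mem_Ioo]
    omega
  rw [Finset.sum_congr rfl h1, Finset.sum_fiberwise_of_maps_to h2]
  have h3 : ({y | 𝓕 y ∧ z ≤ y ∧ y ≤ x} : Finset α) =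
      insert z (insert x ({y | 𝓕 y ∧ z < y ∧ y < x} : Finset α)) := by
    ext y
    simp only [Finset.mem_filter, Finset.mem_univ, true_and, Finset.mem_insert]
    constructor
    · rintro ⟨h1, h2, h3⟩
      rcases h2.eq_or_lt with rfl | h2
      · exact Or.inl rfl
      rcases h3.eq_or_lt with rfl | h3
      · exact Or.inr (Or.inl rfl)
      exact Or.inr (Or.inr ⟨h1, h2, h3⟩)
    · rintro (rfl | rfl | h)
      · exact ⟨hz, le_rfl, hzx.le⟩
      · exact ⟨hx, hzx.le, le_rfl⟩
      · exact ⟨h.1, h.2.1.le, h.2.2.le⟩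
  rw [h3, Finset.sum_insert (by simp [hzx.ne]), Finset.sum_insert (by simp)] at he
  rw [Finset.sum_neg_distrib, ← Finset.mul_sum,
    show ∑ y with 𝓕 y ∧ z < y ∧ y < x, (-1 : ℤ) ^ r y = -(-1) ^ r z - (-1) ^ r x by linarith]
  have h5 := hr z x hz hzx
  rw [show r x = r z + ((d : ℤ) - i - 1).toNat + 1 by omega, pow_succ, pow_add]
  have h6 : (-1 : ℤ) ^ r z * (-1) ^ r z = 1 := by rw [← pow_add, ← two_mul, pow_mul]; simp
  linear_combination (1 - (-1 : ℤ) ^ ((d : ℤ) - i - 1).toNat) * h6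

open Classical in
/-- Euler's relation for all intervals implies the Bayer-Billera relations. -/
theorem setCount_bayerBillera {𝓕 : α → Prop} {r : α → ℕ}
    (hr : ∀ x y, 𝓕 x → x < y → r x < r y) {b : α} (hb : 𝓕 b) (hb0 : r b = 0) (hb' : ∀ x, b ≤ x)
    (he : ∀ z x, 𝓕 z → 𝓕 x → z < x → ∑ y with 𝓕 y ∧ z ≤ y ∧ y ≤ x, (-1 : ℤ) ^ r y = 0)
    (S : Finset ℕ) : ∀ (d : ℕ) (x : α) (i k : ℤ), 𝓕 x → r x = d + 1 → (∀ a ∈ S, a < d) →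
      (i = -1 ∨ ∃ a ∈ S, i = a) → (k = d ∨ ∃ a ∈ S, k = a) → i < k - 1 →
      (∀ a ∈ S, ¬ (i < a ∧ (a : ℤ) < k)) →
      ∑ j ∈ Finset.Ioo i k, (-1 : ℤ) ^ (j - i - 1).toNat * setCount 𝓕 r (insert j.toNat S) x =
        (1 - (-1) ^ (k - i - 1).toNat) * setCount 𝓕 r S x := by
  induction S using Finset.induction_on_max with
  | empty =>
    intro d x i k hx hd _ hi hk hik _
    obtain rfl : i = -1 := by simpa using hi
    obtain rfl : k = d := by simpa using hk
    have hbx : b < x := lt_of_le_of_ne (hb' x) fun e => by rw [e, hd] at hb0; omega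
    rw [setCount_empty, mul_one, ← sum_Ioo_card hr hb hx hbx (he b x hb hx hbx) (i := -1) (by simp [hb0]) hd]
    refine Finset.sum_congr rfl fun j _ => ?_
    rw [setCount_insert_max _ _ (by simp)]
    simp only [setCount_empty]
    congr 2
    ext y
    simp only [Finset.mem_filter, Finset.mem_univ, true_and, iff_self_and]
    exact fun h => lt_of_le_of_ne (hb' y) fun e => by rw [← e, hb0] at h; omega
  | insert a S ha ih =>
    intro d x i k hx hd hS hi hk hik hgap
    have had := hS a (Finset.mem_insert_self a S)
    -- If the gap lies above the largest element `a` of the set, then `i = a` and `k = d`. Fixing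
    -- the chain element `z` of dimension `a`, the sum counts the elements between `z` and `x`,
    -- where Euler's relation applies.
    by_cases hak : (a : ℤ) < k
    · have hai : (a : ℤ) ≤ i := by
        by_contra h
        exact hgap a (Finset.mem_insert_self a S) ⟨by omega, hak⟩
      have hle : ∀ c ∈ insert a S, c ≤ a := by
        intro c hc
        rcases Finset.mem_insert.1 hc with rfl | hc
        · exact le_rfl
        · exact (ha c hc).le
      obtain rfl : i = a := by
        rcases hi with hi | ⟨c, hc, hi⟩
        · omega
        · have := hle c hc; omega
      obtain rfl : k = d := by
        rcases hk with hk | ⟨c, hc, hk⟩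
        · exact hk
        · have := hle c hc; omega
      rw [setCount_insert_max _ _ ha, Finset.mul_sum]
      have h1 : ∀ j ∈ Finset.Ioo (a : ℤ) d, (-1 : ℤ) ^ (j - a - 1).toNat *
          setCount 𝓕 r (insert j.toNat (insert a S)) x =
          ∑ z with 𝓕 z ∧ z < x ∧ r z = a + 1, (-1 : ℤ) ^ (j - a - 1).toNat *
            (∑ y with (𝓕 y ∧ y < x ∧ r y = j.toNat + 1) ∧ z < y, 1) * setCount 𝓕 r S z := by
        intro j hj
        rw [Finset.mem_Ioo] at hj
        rw [setCount_insert_max _ _ (fun c hc => by have := hle c hc; omega),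
          Finset.sum_congr rfl fun y _ => setCount_insert_max 𝓕 r ha y]
        simp only [mul_assoc]
        rw [← Finset.mul_sum]
        congr 1
        simp only [Finset.sum_mul, one_mul]
        refine Finset.sum_comm' fun y z => ?_
        simp only [Finset.mem_filter, Finset.mem_univ, true_and]
        constructor
        · rintro ⟨h1, h2, h3, h4⟩
          exact ⟨⟨h1, h3⟩, h2, h3.trans h1.2.1, h4⟩
        · rintro ⟨⟨h1, h2⟩, h3, h4, h5⟩
          exact ⟨h1, h3, h2, h5⟩
      rw [Finset.sum_congr rfl h1, Finset.sum_comm]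
      refine Finset.sum_congr rfl fun z hz => ?_
      simp only [Finset.mem_filter, Finset.mem_univ, true_and] at hz
      rw [← Finset.sum_mul, sum_Ioo_card hr hz.1 hx hz.2.1 (he z x hz.1 hx hz.2.1)
        (by rw [hz.2.2]; simp) hd]
    -- The gap lies below `a`: fix the chain element `y` of dimension `a` and use induction below
    -- `y`.
    · push Not at hak
      have h1 : ∀ j ∈ Finset.Ioo i k, (-1 : ℤ) ^ (j - i - 1).toNat *
          setCount 𝓕 r (insert j.toNat (insert a S)) x =
          ∑ y with 𝓕 y ∧ y < x ∧ r y = a + 1, (-1 : ℤ) ^ (j - i - 1).toNat *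
            setCount 𝓕 r (insert j.toNat S) y := by
        intro j hj
        rw [Finset.mem_Ioo] at hj
        rw [Finset.insert_comm, setCount_insert_max, Finset.mul_sum]
        intro c hc
        rcases Finset.mem_insert.1 hc with rfl | hc
        · rcases hi with hi | ⟨e, he, hi⟩ <;> omega
        · exact ha c hc
      rw [Finset.sum_congr rfl h1, Finset.sum_comm, setCount_insert_max _ _ ha, Finset.mul_sum]
      refine Finset.sum_congr rfl fun y hy => ?_
      simp only [Finset.mem_filter, Finset.mem_univ, true_and] at hy
      refine ih a y i k hy.1 hy.2.2 ha ?_ ?_ hik fun c hc => hgap c (Finset.mem_insert_of_mem hc)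
      · rcases hi with hi | ⟨c, hc, hi⟩
        · exact Or.inl hi
        · rcases Finset.mem_insert.1 hc with rfl | hc
          · omega
          · exact Or.inr ⟨c, hc, hi⟩
      · rcases hk with hk | ⟨c, hc, hk⟩
        · omega
        · rcases Finset.mem_insert.1 hc with rfl | hc
          · exact Or.inl hk
          · exact Or.inr ⟨c, hc, hk⟩

end ChainSets

/-! ### Flag numbers as chain counts -/

namespace Presents

variable {ι : Type*} [Fintype ι] {n : ℕ} {v : ι → Fin n → ℝ} {P : Polytope n}

/-- The flags of `P` of type `S` of faces below `W`. -/
def FlagBelow (v : ι → Fin n → ℝ) (P : Polytope n) (S : Finset ℕ) (W : Finset ι) : Type :=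
  {F : {a // a ∈ S} → Face P // (StrictMono F ∧ ∀ a, (F a).dim = a.1) ∧ ∀ a, faceSet v (F a) < W}

theorem finite_face (h : Presents v P) : Finite (Face P) :=
  Finite.of_injective (faceSet v) h.faceSet_injective

theorem sigma_flagBelow_ext {a : ℕ} {S : Finset ℕ} {W : Finset ι}
    {p q : Σ y : {y : Face P // faceSet v y < W ∧ y.dim = a}, FlagBelow v P S (faceSet v y.1)}
    (h : p.1.1 = q.1.1) (h' : ∀ b, p.2.1 b = q.2.1 b) : p = q := by
  obtain ⟨⟨y, hy⟩, F⟩ := p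
  obtain ⟨⟨y', hy'⟩, F'⟩ := q
  obtain rfl : y = y' := h
  obtain rfl : F = F' := Subtype.ext (funext h')
  rfl

/-- A flag is its largest face together with the flag of the other faces. -/
def flagBelowInsertEquiv (h : Presents v P) {a : ℕ} {S : Finset ℕ} (ha : ∀ b ∈ S, b < a)
    (W : Finset ι) : FlagBelow v P (insert a S) W ≃
      Σ y : {y : Face P // faceSet v y < W ∧ y.dim = a}, FlagBelow v P S (faceSet v y.1) where
  toFun F := ⟨⟨F.1 ⟨a, Finset.mem_insert_self a S⟩, F.2.2 _, F.2.1.2 _⟩,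
    ⟨fun b => F.1 ⟨b.1, Finset.mem_insert_of_mem b.2⟩,
      ⟨fun _ _ hbc => F.2.1.1 hbc, fun b => F.2.1.2 ⟨b.1, Finset.mem_insert_of_mem b.2⟩⟩,
      fun b => (h.faceSet_lt_iff _ _).2 (F.2.1.1 (ha b.1 b.2))⟩⟩
  invFun p := ⟨fun b => if hb : b.1 = a then p.1.1 else
      p.2.1 ⟨b.1, (Finset.mem_insert.1 b.2).resolve_left hb⟩, by
    refine ⟨⟨fun b c hbc => ?_, fun b => ?_⟩, fun b => ?_⟩
    · have hbc' : b.1 < c.1 := hbc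
      have hb : b.1 ≠ a := fun e => by
        rcases Finset.mem_insert.1 c.2 with hc | hc
        · omega
        · have := ha _ hc; omega
      have hlt := (h.faceSet_lt_iff _ _).1
        (p.2.2.2 ⟨b.1, (Finset.mem_insert.1 b.2).resolve_left hb⟩)
      by_cases hc : c.1 = a
      · simpa only [hb, hc, dif_pos, dif_neg, not_false_iff] using hlt
      · simp only [hb, hc, dif_neg, not_false_iff]
        exact p.2.2.1.1 hbc'
    · by_cases hb : b.1 = a
      · simp only [hb, dif_pos]; exact p.1.2.2
      · simp only [hb, dif_neg, not_false_iff]; exact p.2.2.1.2 _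
    · by_cases hb : b.1 = a
      · simp only [hb, dif_pos]; exact p.1.2.1
      · simp only [hb, dif_neg, not_false_iff]; exact (p.2.2.2 _).trans p.1.2.1⟩
  left_inv F := by
    refine Subtype.ext (funext fun b => ?_)
    by_cases hb : b.1 = a
    · have : b = ⟨a, Finset.mem_insert_self a S⟩ := Subtype.ext hb
      subst this
      simp
    · simp [hb]
  right_inv p := by
    have e : ∀ b : {b // b ∈ S}, b.1 ≠ a := fun b => (ha b.1 b.2).ne
    exact sigma_flagBelow_ext (by simp) fun b => by simp [e]

open Classical in
theorem card_flagBelow (h : Presents v P) (S : Finset ℕ) : ∀ W : Finset ι,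
    (Nat.card (FlagBelow v P S W) : ℤ) = setCount (IsFaceSet (hom v)) (rk (hom v)) S W := by
  have := h.finite_face
  induction S using Finset.induction_on_max with
  | empty =>
    intro W
    have : Unique (FlagBelow v P ∅ W) :=
      { default := ⟨fun a => absurd a.2 (Finset.notMem_empty _),
          ⟨fun a => absurd a.2 (Finset.notMem_empty _), fun a => absurd a.2 (Finset.notMem_empty _)⟩,
          fun a => absurd a.2 (Finset.notMem_empty _)⟩
        uniq := fun F => Subtype.ext (funext fun a => absurd a.2 (Finset.notMem_empty _)) }
    rw [Nat.card_unique, setCount_empty, Nat.cast_one]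
  | insert a S ha ih =>
    intro W
    have hfin : ∀ W, Finite (FlagBelow v P S W) := fun W => by
      unfold FlagBelow; infer_instance
    have := Fintype.ofFinite {y : Face P // faceSet v y < W ∧ y.dim = a}
    rw [Nat.card_congr (h.flagBelowInsertEquiv ha W), Nat.card_sigma, setCount_insert_max _ _ ha,
      Nat.cast_sum]
    refine Finset.sum_nbij (fun y => faceSet v y.1) ?_ ?_ ?_ fun y _ => ih _
    · intro y _
      simp only [Finset.mem_filter, Finset.mem_univ, true_and]
      exact ⟨(h.isFaceSet_faceSet y.1).1, y.2.1, by rw [h.rk_faceSet, y.2.2]⟩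
    · intro y _ y' _ e
      exact Subtype.ext (h.faceSet_injective e)
    · intro W' hW'
      simp only [Finset.coe_filter, Finset.mem_univ, true_and, Set.mem_ofPred_eq] at hW'
      -- Rank `a + 1` is positive, which rules out the empty face set, the only one that is not a
      -- `Face`.
      obtain ⟨F, rfl⟩ := h.exists_faceSet_eq hW'.1 (Finset.nonempty_iff_ne_empty.2 fun e => by
        rw [e, rk_empty] at hW'; omega)
      have := h.rk_faceSet F
      exact ⟨⟨F, hW'.2.1, by omega⟩, by simp, rfl⟩

/-- Faces of dimension less than `n` are automatically proper, so being below the whole polytope is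
no restriction. -/
theorem flagNumber_eq (h : Presents v P) {S : Finset ℕ} (hS : ∀ a ∈ S, a < n) :
    (flagNumber P S : ℤ) = setCount (IsFaceSet (hom v)) (rk (hom v)) S Finset.univ := by
  classical
  rw [← h.card_flagBelow, flagNumber]
  refine congrArg Nat.cast (Nat.card_congr (Equiv.subtypeEquivRight fun F => ?_))
  refine ⟨fun hF => ⟨hF, fun a => ?_⟩, fun hF => hF.1⟩
  refine lt_of_le_of_ne (Finset.subset_univ _) fun e => ?_
  have h1 := h.rk_faceSet (F a)
  rw [e, h.rk_univ, hF.2 a] at h1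
  have := hS a.1 a.2
  omega

end Presents

/-- The flag numbers of a polytope satisfy the Bayer-Billera relations. -/
theorem flagNumber_bayerBillera {n : ℕ} (P : Polytope n) :
    BayerBillera n fun S => (flagNumber P S : ℤ) := by
  classical
  obtain ⟨ι, _, v, h⟩ := P.exists_presents
  intro S hS i k hi hk hik hgap
  have hS' : ∀ a ∈ S, a < n := fun a ha => Finset.mem_range.1 (hS ha)
  have hkn : k ≤ n := by
    rcases hk with hk | hk | ⟨a, ha, hk⟩
    · omega
    · omega
    · have := hS' a ha; omega
  have hi' : i = -1 ∨ ∃ a ∈ S, i = a := by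
    rcases hi with hi | hi | hi
    · exact Or.inl hi
    · omega
    · exact Or.inr hi
  have hk' : k = n ∨ ∃ a ∈ S, k = a := by
    rcases hk with hk | hk | hk
    · rcases hi' with hi' | ⟨a, ha, hi'⟩ <;> omega
    · exact Or.inl hk
    · exact Or.inr hk
  have hi0 : -1 ≤ i := by rcases hi' with hi' | ⟨a, ha, hi'⟩ <;> omega
  have key := setCount_bayerBillera (fun x y => rk_lt_rk) (isFaceSet_hom_empty v) (rk_empty _)
    (fun x => Finset.empty_subset x) (fun z x hz hx hzx => by
      rw [← sum_isFaceSet_neg_one_pow hz hx hzx]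
      refine Finset.sum_congr ?_ fun _ _ => rfl
      ext y
      simp only [Finset.mem_filter]) S n Finset.univ i k
    (isFaceSet_univ _) h.rk_univ hS' hi' hk' hik hgap
  simp only [h.flagNumber_eq hS']
  rw [← key]
  refine Finset.sum_congr rfl fun j hj => ?_
  rw [Finset.mem_Ioo] at hj
  rw [h.flagNumber_eq]
  intro a ha
  rcases Finset.mem_insert.1 ha with rfl | ha
  · omega
  · exact hS' a ha

/-! ### Shifted sets and the colexicographic order -/

section Shifts

/-- The sets obtained from `S` by lowering the elements of a nonempty final piece by `1`, `-1` being
deleted. -/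
def shiftSets (S : Finset ℕ) : List (Finset ℕ) := (shifts (S.sort (· ≥ ·))).map List.toFinset

/-- The weight `∑ 2 ^ a` orders the finite sets of natural numbers colexicographically. -/
def weight (S : Finset ℕ) : ℕ := ∑ a ∈ S, 2 ^ a

theorem dropHead_sublist (d : ℕ) (l : List ℕ) : (dropHead d l).Sublist l := by
  cases l with
  | nil => exact List.Sublist.refl _
  | cons a l =>
    rw [dropHead]
    split_ifs
    · exact List.sublist_cons_self a l
    · exact List.Sublist.refl _

theorem mem_dropHead_lt {d c : ℕ} {l : List ℕ} (hl : l.Pairwise (· > ·)) (h : ∀ a ∈ l, a ≤ d)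
    (hc : c ∈ dropHead d l) : c < d := by
  cases l with
  | nil => simp [dropHead] at hc
  | cons a l =>
    have h1 := List.pairwise_cons.1 hl
    rw [dropHead] at hc
    split_ifs at hc with had
    · exact had ▸ h1.1 c hc
    · have h2 : a < d := lt_of_le_of_ne (h a (by simp)) had
      rcases List.mem_cons.1 hc with rfl | hc
      · exact h2
      · exact (h1.1 c hc).trans h2

/-- The head is always lowered, which strictly decreases the weight, and the tail never gains
weight. Dropping a head equal to `a - 1` keeps the list strictly decreasing. -/
theorem mem_shifts (l : List ℕ) : ∀ a, (a :: l).Pairwise (· > ·) → ∀ m ∈ shifts (a :: l),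
    m.Pairwise (· > ·) ∧ (∀ c ∈ m, c < a) ∧
      (m.map (2 ^ ·)).sum < ((a :: l).map (2 ^ ·)).sum := by
  induction l with
  | nil =>
    intro a _ m hm
    cases a with
    | zero =>
      obtain rfl : m = [] := by simpa [shifts] using hm
      simp
    | succ a =>
      obtain rfl : m = [a] := by simpa [shifts, dropHead] using hm
      simpa using Nat.pow_lt_pow_right one_lt_two (Nat.lt_succ_self a)
  | cons b l ih =>
    intro a hl m hm
    have h1 := List.pairwise_cons.1 hl
    have hba := h1.1 b (by simp)
    cases a with
    | zero => omega
    | succ a =>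
      rw [shifts, if_neg (Nat.succ_ne_zero a), List.mem_map] at hm
      obtain ⟨m, hm, rfl⟩ := hm
      rw [Nat.add_sub_cancel] at hm ⊢
      have key : m.Pairwise (· > ·) ∧ (∀ c ∈ m, c < a) ∧
          (m.map (2 ^ ·)).sum ≤ ((b :: l).map (2 ^ ·)).sum := by
        rcases List.mem_cons.1 hm with rfl | hm
        · exact ⟨h1.2.sublist (dropHead_sublist _ _), fun c => mem_dropHead_lt h1.2
            fun c hc => Nat.lt_succ_iff.1 (h1.1 c hc),
            ((dropHead_sublist _ _).map _).sum_le_sum fun _ _ => Nat.zero_le _⟩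
        · have := ih b h1.2 m hm
          exact ⟨this.1, fun c hc => (this.2.1 c hc).trans_le (by omega), this.2.2.le⟩
      refine ⟨List.pairwise_cons.2 ⟨key.2.1, key.1⟩, fun c hc => ?_, ?_⟩
      · rcases List.mem_cons.1 hc with rfl | hc
        · exact Nat.lt_succ_self _
        · exact (key.2.1 c hc).trans (Nat.lt_succ_self _)
      · rw [List.map_cons, List.sum_cons, List.map_cons, List.sum_cons, pow_succ]
        have := key.2.2
        have := Nat.two_pow_pos a
        omega

theorem pairwise_gt_sort (S : Finset ℕ) : (S.sort (· ≥ ·)).Pairwise (· > ·) :=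
  S.sortedGT_sort.pairwise

theorem sort_toFinset {l : List ℕ} (hl : l.Pairwise (· > ·)) : l.toFinset.sort (· ≥ ·) = l :=
  (List.toFinset_sort (· ≥ ·) (hl.imp fun h => ne_of_gt h)).2 (hl.imp le_of_lt)

/-- This makes the shift terms negligible in leading-term arguments, and keeps the maximal possible
element `p` out of all shifted sets. -/
theorem mem_shiftSets {S T : Finset ℕ} (hT : T ∈ shiftSets S) :
    weight T < weight S ∧ ∀ p, (∀ a ∈ S, a ≤ p) → ∀ a ∈ T, a < p := by
  obtain ⟨m, hm, rfl⟩ := List.mem_map.1 hT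
  have hp := pairwise_gt_sort S
  have hS : ∀ a, a ∈ S ↔ a ∈ S.sort (· ≥ ·) := fun a => (Finset.mem_sort _).symm
  have hw : weight S = ((S.sort (· ≥ ·)).map (2 ^ ·)).sum := by
    rw [weight, ← List.sum_toFinset _ (hp.imp fun h => ne_of_gt h), Finset.sort_toFinset]
  cases hs : S.sort (· ≥ ·) with
  | nil => rw [hs] at hm; simp [shifts] at hm
  | cons a l =>
    rw [hs] at hm hp hw
    obtain ⟨h1, h2, h3⟩ := mem_shifts l a hp m hm
    refine ⟨?_, fun p hS' c hc => (h2 c (List.mem_toFinset.1 hc)).trans_le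
      (hS' a ((hS a).2 (by simp [hs])))⟩
    rw [hw, weight, List.sum_toFinset _ (h1.imp fun h => ne_of_gt h)]
    exact h3

end Shifts

/-! ### Faces of pyramids and bipyramids -/

section Cones

variable {ι κ : Type*} {p : ℕ}

theorem disjSum_subset_disjSum_iff {W W' : Finset ι} {T T' : Finset κ} :
    W.disjSum T ⊆ W'.disjSum T' ↔ W ⊆ W' ∧ T ⊆ T' := by
  constructor
  · exact fun h => ⟨fun i hi => by simpa using h (Finset.inl_mem_disjSum.2 hi),
      fun c hc => by simpa using h (Finset.inr_mem_disjSum.2 hc)⟩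
  · exact fun h => Finset.disjSum_mono h.1 h.2

theorem disjSum_lt_disjSum_iff {W W' : Finset ι} {T T' : Finset κ} :
    W.disjSum T < W'.disjSum T' ↔ W ≤ W' ∧ T ≤ T' ∧ ¬ (W' ≤ W ∧ T' ≤ T) := by
  rw [lt_iff_le_not_ge, ← and_assoc]
  exact and_congr disjSum_subset_disjSum_iff (not_congr disjSum_subset_disjSum_iff)

theorem exists_disjSum_eq (Y : Finset (ι ⊕ κ)) : ∃ W T, Y = Finset.disjSum W T :=
  ⟨Y.toLeft, Y.toRight, (Finset.toLeft_disjSum_toRight).symm⟩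

theorem disjSum_inj_iff {W W' : Finset ι} {T T' : Finset κ} :
    W.disjSum T = W'.disjSum T' ↔ W = W' ∧ T = T' := by
  rw [subset_antisymm_iff, disjSum_subset_disjSum_iff, disjSum_subset_disjSum_iff,
    subset_antisymm_iff, subset_antisymm_iff]
  tauto

/-- The points `(0, v i)` and the apices `(ε c, b)`. -/
def conePoints (v : ι → Fin p → ℝ) (b : Fin p → ℝ) (ε : κ → ℝ) : ι ⊕ κ → Fin (p + 1) → ℝ :=
  Sum.elim (fun i => Fin.cons 0 (v i)) fun c => Fin.cons (ε c) b

/-- The embedding `x ↦ (0, x)`. -/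
def consZero (p : ℕ) : (Fin p → ℝ) →ₗ[ℝ] (Fin (p + 1) → ℝ) where
  toFun x := Fin.cons 0 x
  map_add' x y := by ext i; refine Fin.cases ?_ (fun i => ?_) i <;> simp
  map_smul' c x := by ext i; refine Fin.cases ?_ (fun i => ?_) i <;> simp

theorem consZero_apply (x : Fin p → ℝ) : consZero p x = Fin.cons 0 x := rfl

theorem consZero_injective : Function.Injective (consZero p) := fun x y h => by
  have : (Fin.cons 0 x : Fin (p + 1) → ℝ) = Fin.cons 0 y := h
  exact (Fin.cons_inj.1 this).2

theorem cons_eq (t : ℝ) (x : Fin p → ℝ) :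
    (Fin.cons t x : Fin (p + 1) → ℝ) = consZero p x + t • Pi.single 0 1 := by
  ext i
  refine Fin.cases ?_ (fun i => ?_) i <;> simp [consZero_apply]

/-- A functional on the larger space is a functional `l` on the base plus a slope `d` in the new
direction. The slope does not affect the base points. -/
theorem isFaceSet_conePoints_iff {v : ι → Fin p → ℝ} {b : Fin p → ℝ} {ε : κ → ℝ} {W : Finset ι}
    {T : Finset κ} : IsFaceSet (hom (conePoints v b ε)) (W.disjSum T) ↔
      ∃ (l : (Fin p → ℝ) →ₗ[ℝ] ℝ) (c d : ℝ), (∀ i, l (v i) ≤ c) ∧ (∀ i, i ∈ W ↔ l (v i) = c) ∧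
        (∀ e, l b + ε e * d ≤ c) ∧ ∀ e, e ∈ T ↔ l b + ε e * d = c := by
  rw [isFaceSet_hom_iff]
  constructor
  · rintro ⟨l, c, h1, h2⟩
    have h3 : ∀ e, l (conePoints v b ε (Sum.inr e)) = (l ∘ₗ consZero p) b +
        ε e * l (Pi.single 0 1) := fun e => by
      rw [conePoints, Sum.elim_inr, cons_eq, map_add, map_smul, smul_eq_mul]
      rfl
    refine ⟨l ∘ₗ consZero p, c, l (Pi.single 0 1), fun i => h1 (Sum.inl i), fun i => ?_,
      fun e => ?_, fun e => ?_⟩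
    · rw [← Finset.inl_mem_disjSum (t := T), h2]
      rfl
    · rw [← h3]; exact h1 _
    · rw [← h3, ← h2, Finset.inr_mem_disjSum]
  · rintro ⟨l, c, d, h1, h2, h3, h4⟩
    set l' : (Fin (p + 1) → ℝ) →ₗ[ℝ] ℝ :=
      l ∘ₗ LinearMap.funLeft ℝ ℝ Fin.succ + d • LinearMap.proj 0 with hl'
    have h5 : ∀ t x, l' (Fin.cons t x) = l x + t * d := fun t x => by
      have : LinearMap.funLeft ℝ ℝ Fin.succ (Fin.cons t x : Fin (p + 1) → ℝ) = x := by
        ext i; simp [LinearMap.funLeft_apply]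
      simp [hl', this, mul_comm]
    refine ⟨l', c, ?_, ?_⟩
    · rintro (i | e)
      · rw [conePoints, Sum.elim_inl, h5, zero_mul, add_zero]; exact h1 i
      · rw [conePoints, Sum.elim_inr, h5]; exact h3 e
    · rintro (i | e)
      · rw [Finset.inl_mem_disjSum, conePoints, Sum.elim_inl, h5, zero_mul, add_zero]; exact h2 i
      · rw [Finset.inr_mem_disjSum, conePoints, Sum.elim_inr, h5]; exact h4 e

theorem rk_disjSum_empty (v : ι → Fin p → ℝ) (b : Fin p → ℝ) (ε : κ → ℝ) (W : Finset ι) :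
    rk (hom (conePoints v b ε)) (W.disjSum ∅) = rk (hom v) W ∧
    Submodule.span ℝ (hom (conePoints v b ε) '' (W.disjSum ∅ : Finset (ι ⊕ κ))) =
      (Submodule.span ℝ (hom v '' W)).map ((consZero p).prodMap LinearMap.id) := by
  have h : Submodule.span ℝ (hom (conePoints v b ε) '' (W.disjSum ∅ : Finset (ι ⊕ κ))) =
      (Submodule.span ℝ (hom v '' W)).map ((consZero p).prodMap LinearMap.id) := by
    rw [Submodule.map_span, Set.image_image]
    congr 1
    ext x
    simp [hom, conePoints, consZero_apply]
  refine ⟨?_, h⟩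
  rw [rk, h, rk]
  refine (LinearEquiv.finrank_eq (Submodule.equivMapOfInjective _ ?_ _)).symm
  rw [LinearMap.coe_prodMap]
  exact consZero_injective.prodMap Function.injective_id

theorem rk_disjSum_singleton (v : ι → Fin p → ℝ) (b : Fin p → ℝ) {ε : κ → ℝ} (W : Finset ι) {c : κ}
    (hc : ε c ≠ 0) : rk (hom (conePoints v b ε)) (W.disjSum {c}) = rk (hom v) W + 1 := by
  obtain ⟨h1, h2⟩ := rk_disjSum_empty v b ε W
  rw [← h1]
  set w := hom (conePoints v b ε) with hw
  set S := Submodule.span ℝ (w '' (W.disjSum {c} : Finset (ι ⊕ κ))) with hS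
  set h : (Fin (p + 1) → ℝ) × ℝ →ₗ[ℝ] ℝ := LinearMap.proj 0 ∘ₗ LinearMap.fst ℝ _ ℝ with hh
  have hl : ∀ i, h (w (Sum.inl i)) = 0 := fun i => by simp [hh, hw, hom, conePoints]
  have hr : h (w (Sum.inr c)) = ε c := by simp [hh, hw, hom, conePoints]
  have hcS : w (Sum.inr c) ∈ S := Submodule.subset_span ⟨_, by simp, rfl⟩
  rw [rk, ← hS, ← finrank_inf_ker_add_one (h := h) hcS (by rw [hr]; exact hc), rk]
  -- Projection along the apex onto the kernel of the new coordinate `h`, which fixes the base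
  -- points and kills the apex.
  have h3 : S ≤ (Submodule.span ℝ (w '' (W.disjSum ∅ : Finset (ι ⊕ κ)))).comap
      (LinearMap.id - ((ε c)⁻¹ • h).smulRight (w (Sum.inr c))) := by
    rw [hS, Submodule.span_le]
    rintro _ ⟨i | e, hi, rfl⟩
    · simp only [Finset.mem_coe, Finset.inl_mem_disjSum] at hi
      simp only [SetLike.mem_coe, Submodule.mem_comap, LinearMap.sub_apply, LinearMap.id_apply,
        LinearMap.smulRight_apply, LinearMap.smul_apply, hl, smul_zero, zero_smul, sub_zero]
      exact Submodule.subset_span ⟨_, by simpa using hi, rfl⟩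
    · obtain rfl : e = c := by simpa using hi
      simp [hr, hc]
  have h4 : S ⊓ LinearMap.ker h = Submodule.span ℝ (w '' (W.disjSum ∅ : Finset (ι ⊕ κ))) := by
    refine le_antisymm (fun x hx => ?_) ?_
    · have h5 : h x = 0 := hx.2
      simpa [h5] using h3 hx.1
    · rw [Submodule.span_le]
      rintro _ ⟨i | e, hi, rfl⟩
      · refine ⟨Submodule.subset_span ⟨_, by simpa using hi, rfl⟩, hl i⟩
      · simp at hi
  rw [h4]

/-- The description of faces in `hG` is required only on `D` because it fails for the whole base of
a bipyramid, which is not a face. -/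
theorem isConing_conePoints {v : ι → Fin p → ℝ} {b : Fin p → ℝ} {ε : κ → ℝ} (hε : ∀ c, ε c ≠ 0)
    {D : Finset ι → Prop} (hD : ∀ x y, D x → y ≤ x → D y)
    (hG : ∀ W T, D W → (IsFaceSet (hom (conePoints v b ε)) (W.disjSum T) ↔
      IsFaceSet (hom v) W ∧ (T = ∅ ∨ ∃ c, T = {c}))) :
    IsConing (IsFaceSet (hom v)) (rk (hom v)) (IsFaceSet (hom (conePoints v b ε)))
      (rk (hom (conePoints v b ε))) D (fun W => W.disjSum ∅) fun c W => W.disjSum {c} where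
  lower := hD
  inj_base W W' h := (disjSum_inj_iff.1 h).1
  inj_cone c W W' h := (disjSum_inj_iff.1 h).1
  ne_base c W W' h := Finset.singleton_ne_empty c (disjSum_inj_iff.1 h).2.symm
  ne_cone c c' W W' hc h := hc (Finset.singleton_injective (disjSum_inj_iff.1 h).2)
  rank_base W _ := (rk_disjSum_empty v b ε W).1
  rank_cone c W _ := rk_disjSum_singleton v b W (hε c)
  lt_base x hx Y := by
    obtain ⟨W, T, rfl⟩ := exists_disjSum_eq Y
    simp only [disjSum_lt_disjSum_iff, disjSum_inj_iff]
    constructor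
    · rintro ⟨h1, h2, h3, h4⟩
      have hT : T = ∅ := Finset.subset_empty.1 h3
      subst hT
      refine ⟨W, ((hG W _ (hD x W hx h2)).1 h1).1, lt_of_le_not_ge h2 fun h => h4 ⟨h, le_rfl⟩,
        rfl, rfl⟩
    · rintro ⟨z, h1, h2, rfl, rfl⟩
      exact ⟨(hG W _ (hD x W hx h2.le)).2 ⟨h1, Or.inl rfl⟩, h2.le, le_rfl,
        fun h => h2.not_ge h.1⟩
  lt_cone c x hx Y := by
    obtain ⟨W, T, rfl⟩ := exists_disjSum_eq Y
    simp only [disjSum_lt_disjSum_iff, disjSum_inj_iff]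
    constructor
    · rintro ⟨h1, h2, h3, h4⟩
      refine ⟨W, ((hG W _ (hD x W hx h2)).1 h1).1, ?_⟩
      rcases Finset.subset_singleton_iff.1 h3 with rfl | rfl
      · exact Or.inl ⟨h2, rfl, rfl⟩
      · exact Or.inr ⟨lt_of_le_not_ge h2 fun h => h4 ⟨h, le_rfl⟩, rfl, rfl⟩
    · rintro ⟨z, h1, ⟨h2, rfl, rfl⟩ | ⟨h2, rfl, rfl⟩⟩
      · exact ⟨(hG W _ (hD x W hx h2)).2 ⟨h1, Or.inl rfl⟩, h2, Finset.empty_subset _,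
          fun h => Finset.singleton_ne_empty c (Finset.subset_empty.1 h.2)⟩
      · exact ⟨(hG W _ (hD x W hx h2.le)).2 ⟨h1, Or.inr ⟨c, rfl⟩⟩, h2.le, le_rfl,
          fun h => h2.not_ge h.1⟩

/-- The free slope `d` can put the apex on the supporting hyperplane (`d = c - l b`) or strictly
inside it. -/
theorem isFaceSet_pyramid {v : ι → Fin p → ℝ} {b : Fin p → ℝ} (W : Finset ι) (T : Finset Unit) :
    IsFaceSet (hom (conePoints v b fun _ : Unit => 1)) (W.disjSum T) ↔
      IsFaceSet (hom v) W ∧ (T = ∅ ∨ ∃ c, T = {c}) := by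
  rw [isFaceSet_conePoints_iff, isFaceSet_hom_iff]
  constructor
  · rintro ⟨l, c, d, h1, h2, -, -⟩
    refine ⟨⟨l, c, h1, h2⟩, ?_⟩
    rcases T.eq_empty_or_nonempty with h | ⟨e, he⟩
    · exact Or.inl h
    · exact Or.inr ⟨e, Finset.eq_singleton_iff_unique_mem.2 ⟨he, fun _ _ => rfl⟩⟩
  · rintro ⟨⟨l, c, h1, h2⟩, rfl | ⟨e, rfl⟩⟩
    · exact ⟨l, c, c - l b - 1, h1, h2, fun e => by linarith,
        fun e => ⟨fun h => by simp at h, fun h => by exfalso; linarith⟩⟩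
    · exact ⟨l, c, c - l b, h1, h2, fun e => by linarith, fun e => by simp⟩

variable [Fintype ι] [Fintype κ]

/-- The convex hull of the points `(0, v i)` and of the apices. -/
theorem exists_presents_conePoints [Nonempty κ] {v : ι → Fin p → ℝ} {P : Polytope p}
    (h : Presents v P) (b : Fin p → ℝ) {ε : κ → ℝ} (hε : ∀ c, ε c ≠ 0) :
    ∃ Q : Polytope (p + 1), Presents (conePoints v b ε) Q := by
  classical
  have c := Classical.arbitrary κ
  refine ⟨⟨convexHull ℝ (Set.range (conePoints v b ε)),
    ⟨Finset.univ.image (conePoints v b ε), by simp⟩, ?_⟩, rfl⟩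
  rw [affineSpan_convexHull, ← Set.image_univ, ← Finset.coe_univ]
  have hne : (Finset.univ : Finset (ι ⊕ κ)).Nonempty := ⟨Sum.inr c, Finset.mem_univ _⟩
  rw [AffineSubspace.affineSpan_eq_top_iff_vectorSpan_eq_top_of_nonempty ℝ _ _
    (Set.Nonempty.image _ (by exact_mod_cast hne))]
  refine Submodule.eq_top_of_finrank_eq (le_antisymm (Submodule.finrank_le _) ?_)
  have h1 := rk_hom (v := conePoints v b ε) hne
  have h2 := rk_disjSum_singleton v b Finset.univ (hε c)
  have h3 : rk (hom (conePoints v b ε)) (Finset.univ.disjSum {c}) ≤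
      rk (hom (conePoints v b ε)) Finset.univ :=
    Submodule.finrank_mono (Submodule.span_mono (Set.image_mono
      (by exact_mod_cast Finset.subset_univ _)))
  rw [h.rk_univ] at h2
  simp only [Module.finrank_fintype_fun_eq_card, Fintype.card_fin]
  omega

/-- The centroid of a family of points. -/
noncomputable def centroid (v : ι → Fin p → ℝ) : Fin p → ℝ := (Fintype.card ι : ℝ)⁻¹ • ∑ i, v i

/-- The defect `c - l` at the centroid is the average of the nonnegative defects at the points.
Hence the centroid lies on no proper face. -/
theorem le_centroid [Nonempty ι] {v : ι → Fin p → ℝ} {l : (Fin p → ℝ) →ₗ[ℝ] ℝ} {c : ℝ}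
    (h : ∀ i, l (v i) ≤ c) : l (centroid v) ≤ c ∧ (l (centroid v) = c ↔ ∀ i, l (v i) = c) := by
  have hp : (0 : ℝ) < Fintype.card ι := by exact_mod_cast Fintype.card_pos
  have h1 : c - l (centroid v) = (Fintype.card ι : ℝ)⁻¹ * ∑ i, (c - l (v i)) := by
    rw [centroid, map_smul, map_sum, smul_eq_mul, Finset.sum_sub_distrib, Finset.sum_const,
      Finset.card_univ, nsmul_eq_mul]
    field_simp
  have h2 : ∀ i ∈ Finset.univ, 0 ≤ c - l (v i) := fun i _ => sub_nonneg.2 (h i)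
  refine ⟨sub_nonneg.1 (h1 ▸ mul_nonneg (inv_nonneg.2 hp.le) (Finset.sum_nonneg h2)), ?_⟩
  rw [eq_comm, ← sub_eq_zero, h1, mul_eq_zero, or_iff_right (inv_ne_zero hp.ne'),
    Finset.sum_eq_zero_iff_of_nonneg h2]
  simp only [Finset.mem_univ, true_imp_iff, sub_eq_zero]
  exact forall_congr' fun i => eq_comm

/-- The heights `1` and `-1` of the apices of a bipyramid. -/
def bipyramidHeight (c : Bool) : ℝ := if c then 1 else -1

/-- The values at the apices are `l (centroid v) ± d`, and `l (centroid v) < c` for proper `W`. So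
both cannot equal `c`, while `d = 0` reaches neither and `d = ±(c - l (centroid v))` exactly one. -/
theorem isFaceSet_bipyramid [Nonempty ι] {v : ι → Fin p → ℝ} {W : Finset ι} (hW : W ≠ Finset.univ)
    (T : Finset Bool) :
    IsFaceSet (hom (conePoints v (centroid v) bipyramidHeight)) (W.disjSum T) ↔
      IsFaceSet (hom v) W ∧ (T = ∅ ∨ ∃ c, T = {c}) := by
  rw [isFaceSet_conePoints_iff, isFaceSet_hom_iff]
  have key : ∀ (l : (Fin p → ℝ) →ₗ[ℝ] ℝ) c, (∀ i, l (v i) ≤ c) → (∀ i, i ∈ W ↔ l (v i) = c) →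
      l (centroid v) < c := by
    intro l c h1 h2
    refine lt_of_le_of_ne (le_centroid h1).1 fun e => hW ?_
    exact Finset.eq_univ_iff_forall.2 fun i => (h2 i).2 ((le_centroid h1).2.1 e i)
  constructor
  · rintro ⟨l, c, d, h1, h2, h3, h4⟩
    refine ⟨⟨l, c, h1, h2⟩, ?_⟩
    have h5 := key l c h1 h2
    rcases T.eq_empty_or_nonempty with h | ⟨e, he⟩
    · exact Or.inl h
    · refine Or.inr ⟨e, Finset.eq_singleton_iff_unique_mem.2 ⟨he, fun f hf => ?_⟩⟩
      have h6 := (h4 e).1 he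
      have h7 := (h4 f).1 hf
      cases e <;> cases f <;> first | rfl | skip
      all_goals
        simp only [bipyramidHeight, if_true, Bool.false_eq_true, if_false] at h6 h7
        exfalso
        linarith
  · rintro ⟨⟨l, c, h1, h2⟩, rfl | ⟨e, rfl⟩⟩
    · have h5 := key l c h1 h2
      exact ⟨l, c, 0, h1, h2, fun e => by linarith, fun e => by simp [h5.ne]⟩
    · have h5 := key l c h1 h2
      refine ⟨l, c, bipyramidHeight e * (c - l (centroid v)), h1, h2, fun f => ?_, fun f => ?_⟩
      · cases e <;> cases f <;>
          simp only [bipyramidHeight, if_true, Bool.false_eq_true, if_false] <;> linarith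
      · cases e <;> cases f <;>
          simp only [bipyramidHeight, if_true, Bool.false_eq_true, if_false,
            Finset.mem_singleton, true_iff, false_iff, Bool.true_eq_false] <;>
          linarith

/-- If `l` is constant on the base, the centroid has value `c` and the two apices force `d = 0`. -/
theorem isFaceSet_bipyramid_univ [Nonempty ι] {v : ι → Fin p → ℝ} {T : Finset Bool}
    (h : IsFaceSet (hom (conePoints v (centroid v) bipyramidHeight)) (Finset.univ.disjSum T)) :
    T = Finset.univ := by
  obtain ⟨l, c, d, h1, h2, h3, h4⟩ := isFaceSet_conePoints_iff.1 h
  have h5 := (le_centroid h1).2.2 fun i => (h2 i).1 (Finset.mem_univ i)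
  have h6 := h3 true
  have h7 := h3 false
  simp only [bipyramidHeight, if_true, Bool.false_eq_true, if_false] at h6 h7
  have hd : d = 0 := by linarith
  exact Finset.eq_univ_iff_forall.2 fun e => (h4 e).2 (by rw [hd, mul_zero, add_zero, h5])

end Cones

/-! ### Flag numbers of pyramids and bipyramids -/

theorem sort_erase_max {p : ℕ} {S : Finset ℕ} (hS : ∀ a ∈ S, a ≤ p) :
    (S.erase p).sort (· ≥ ·) = dropHead p (S.sort (· ≥ ·)) := by
  have h1 := pairwise_gt_sort S
  rw [← sort_toFinset (h1.sublist (dropHead_sublist p _))]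
  congr 1
  ext c
  rw [List.mem_toFinset, Finset.mem_erase]
  constructor
  · rintro ⟨h2, h3⟩
    rw [← Finset.mem_sort (· ≥ ·)] at h3
    cases h : S.sort (· ≥ ·) with
    | nil => simp [h] at h3
    | cons a l =>
      rw [h] at h3
      rw [dropHead]
      split_ifs with had
      · exact (List.mem_cons.1 h3).resolve_left fun e => h2 (e.trans had)
      · exact h3
  · intro h2
    exact ⟨(mem_dropHead_lt h1 (fun a ha => hS a ((Finset.mem_sort _).1 ha)) h2).ne,
      (Finset.mem_sort (· ≥ ·)).1 ((dropHead_sublist p _).subset h2)⟩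

namespace Presents

variable {ι : Type*} [Fintype ι] {p : ℕ} {v : ι → Fin p → ℝ} {P : Polytope p}

theorem sum_shiftSets (h : Presents v P) {S : Finset ℕ} (hS : ∀ a ∈ S, a ≤ p) :
    ((shiftSets S).map fun T => (flagNumber P T : ℤ)).sum =
      ((shifts (S.sort (· ≥ ·))).map fun m =>
        chainCount (IsFaceSet (hom v)) (rk (hom v)) m Finset.univ).sum := by
  rw [shiftSets, List.map_map]
  congr 1
  refine List.map_congr_left fun m hm => ?_
  rw [Function.comp_apply, h.flagNumber_eq fun a ha =>
    (mem_shiftSets (List.mem_map.2 ⟨m, hm, rfl⟩)).2 p hS a ha, setCount]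
  congr 1
  have hp := pairwise_gt_sort S
  cases hs : S.sort (· ≥ ·) with
  | nil => rw [hs] at hm; simp [shifts] at hm
  | cons a l =>
    rw [hs] at hm hp
    exact sort_toFinset (mem_shifts l a hp m hm).1

end Presents

theorem coneCount_hom {ι : Type*} [Fintype ι] {p : ℕ} {v : ι → Fin p → ℝ} {l : List ℕ} (hl : l.Pairwise (· > ·)) (d : ℕ)
    (W : Finset ι) (hW : IsFaceSet (hom v) W) (hd : rk (hom v) W = d + 1) (hc : ∀ c ∈ l, c ≤ d) :
    coneCount (IsFaceSet (hom v)) (rk (hom v)) l W =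
      chainCount (IsFaceSet (hom v)) (rk (hom v)) (dropHead d l) W +
        ((shifts l).map fun m => chainCount (IsFaceSet (hom v)) (rk (hom v)) m W).sum :=
  coneCount_eq (isFaceSet_hom_empty v) (rk_empty _) (fun _ _ => eq_empty_of_rk_hom)
    (fun x => Finset.empty_subset x) (fun _ _ => rk_lt_rk) l hl d W hW hd hc

/-- Every polytope has a pyramid over it. -/
theorem exists_pyramid {p : ℕ} (P : Polytope p) : ∃ Q : Polytope (p + 1), ∀ S : Finset ℕ,
    (∀ a ∈ S, a ≤ p) → (flagNumber Q S : ℤ) = flagNumber P (S.erase p) +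
      ((shiftSets S).map fun T => (flagNumber P T : ℤ)).sum := by
  obtain ⟨ι, _, v, h⟩ := P.exists_presents
  obtain ⟨Q, hQ⟩ := exists_presents_conePoints h 0 (ε := fun _ : Unit => 1) fun _ => one_ne_zero
  have hC := isConing_conePoints (v := v) (b := 0) (ε := fun _ : Unit => 1)
    (fun _ => one_ne_zero) (D := fun _ => True) (fun _ _ _ _ => trivial)
    fun W T _ => isFaceSet_pyramid W T
  refine ⟨Q, fun S hS => ?_⟩
  rw [hQ.flagNumber_eq fun a ha => Nat.lt_succ_of_le (hS a ha), h.sum_shiftSets hS,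
    h.flagNumber_eq, setCount, setCount, sort_erase_max hS]
  -- The pyramid is itself the cone over its whole base, so its chains are counted by `coneCount`.
  · have h1 : (Finset.univ : Finset (ι ⊕ Unit)) = Finset.univ.disjSum {()} := by
      ext x; cases x <;> simp
    rw [h1, hC.chainCount_cone () _ Finset.univ trivial,
      coneCount_hom (pairwise_gt_sort S) p _ (isFaceSet_univ _) h.rk_univ
        fun c hc => hS c ((Finset.mem_sort _).1 hc)]
  · intro a ha
    exact lt_of_le_of_ne (hS a (Finset.mem_of_mem_erase ha)) (Finset.ne_of_mem_erase ha)

/-- Every polytope has a bipyramid over it. -/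
theorem exists_bipyramid {p : ℕ} (P : Polytope p) : ∃ Q : Polytope (p + 1), ∀ S : Finset ℕ,
    (∀ a ∈ S, a ≤ p) → (flagNumber Q S : ℤ) = (if p ∈ S then 0 else (flagNumber P S : ℤ)) +
      2 * ((shiftSets S).map fun T => (flagNumber P T : ℤ)).sum := by
  classical
  obtain ⟨ι, _, v, h⟩ := P.exists_presents
  have := h.nonempty
  have hε : ∀ c, bipyramidHeight c ≠ 0 := fun c => by cases c <;> simp [bipyramidHeight]
  obtain ⟨Q, hQ⟩ := exists_presents_conePoints h (centroid v) hε
  have hC := isConing_conePoints (v := v) (b := centroid v) hε (D := fun W => W ≠ Finset.univ)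
    (fun x y hx hy e => hx (Finset.univ_subset_iff.1 (e ▸ hy)))
    fun W T hW => isFaceSet_bipyramid hW T
  refine ⟨Q, fun S hS => ?_⟩
  rw [hQ.flagNumber_eq fun a ha => Nat.lt_succ_of_le (hS a ha), h.sum_shiftSets hS, setCount]
  have hl := pairwise_gt_sort S
  have hmem : ∀ c, c ∈ S ↔ c ∈ S.sort (· ≥ ·) := fun c => (Finset.mem_sort _).symm
  have hfl : p ∉ S → (flagNumber P S : ℤ) =
      chainCount (IsFaceSet (hom v)) (rk (hom v)) (S.sort (· ≥ ·)) Finset.univ := fun hp =>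
    h.flagNumber_eq fun a ha => lt_of_le_of_ne (hS a ha) fun e => hp (e ▸ ha)
  cases hs : S.sort (· ≥ ·) with
  | nil =>
    have hp : p ∉ S := fun hp => by rw [hmem, hs] at hp; simp at hp
    rw [if_neg hp, hfl hp, hs]
    simp [chainCount, shifts]
  | cons a l =>
    rw [hs] at hl
    have hl' := List.pairwise_cons.1 hl
    have hap : a ≤ p := hS a ((hmem a).2 (by simp [hs]))
    have hlt : ∀ W : Finset ι, W < Finset.univ ↔ W ≠ Finset.univ := fun W => by
      rw [Finset.ssubset_univ_iff]
    rw [hC.chainCount_top (x := Finset.univ) (fun y hy => (hlt y).1 hy) ?_ a l,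
      sum_coneCount (isFaceSet_hom_empty v) (rk_empty _) (fun _ _ => eq_empty_of_rk_hom) hl
        (coneCount_hom hl'.2) ((hlt _).2 Finset.univ_nonempty.ne_empty.symm)]
    · congr 1
      split_ifs with hp
      -- If `p ∈ S`, then `a = p`, and no proper face of the base has dimension `p`.
      · refine chainCount_cons_eq_zero fun y h1 h2 h3 => ?_
        have h4 := rk_lt_rk h1 h2
        rw [h.rk_univ] at h4
        have : p ≤ a := by
          rw [hmem, hs] at hp
          rcases List.mem_cons.1 hp with rfl | hp
          · exact le_rfl
          · exact (hl'.1 p hp).le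
        omega
      · rw [hfl hp, hs]
    · intro Y
      obtain ⟨W, T, rfl⟩ := exists_disjSum_eq Y
      simp only [disjSum_inj_iff, hlt]
      rw [Finset.ssubset_univ_iff]
      constructor
      · rintro ⟨h1, h2⟩
        have hW : W ≠ Finset.univ := by
          rintro rfl
          obtain rfl := isFaceSet_bipyramid_univ h1
          exact h2 (by ext x; cases x <;> simp)
        obtain ⟨h3, h4⟩ := (isFaceSet_bipyramid hW T).1 h1
        refine ⟨W, h3, hW, ?_⟩
        rcases h4 with h4 | ⟨c, h4⟩
        · exact Or.inl ⟨rfl, h4⟩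
        · exact Or.inr ⟨c, rfl, h4⟩
      · rintro ⟨z, h1, h2, h3⟩
        obtain rfl : W = z := by rcases h3 with h3 | ⟨c, h3⟩ <;> exact h3.1
        refine ⟨(isFaceSet_bipyramid h2 T).2 ⟨h1, h3.imp (fun h => h.2) fun ⟨c, h⟩ => ⟨c, h.2⟩⟩,
          fun e => h2 ?_⟩
        refine Finset.eq_univ_iff_forall.2 fun i => ?_
        have := Finset.mem_univ (Sum.inl i : ι ⊕ Bool)
        rw [← e] at this
        simpa using this

/-! The lattice of the flag numbers -/

/-- The combinatorial polytope of a polytope. -/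
def Polytope.toComb {n : ℕ} (P : Polytope n) : CombPolytope n := Quotient.mk (combSetoid n) P

theorem exists_toComb_eq {n : ℕ} (Q : CombPolytope n) : ∃ P : Polytope n, P.toComb = Q :=
  Quotient.exists_rep Q

theorem flagNumber_toComb {n : ℕ} (P : Polytope n) : P.toComb.flagNumber = flagNumber P := rfl

/-- The flag numbers of the elements of `𝒫ⁿ`. -/
noncomputable def flagVec (n : ℕ) : PolytopeGroup n →ₗ[ℤ] (Finset ℕ → ℤ) :=
  Finsupp.linearCombination ℤ fun Q S => (Q.flagNumber S : ℤ)

theorem flagVec_single {n : ℕ} (Q : CombPolytope n) (c : ℤ) (S : Finset ℕ) :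
    flagVec n (Finsupp.single Q c) S = c * Q.flagNumber S := by
  simp [flagVec]

/-- The sum of the values on the sets of `shiftSets S`. -/
def shiftSum (S : Finset ℕ) : (Finset ℕ → ℤ) →ₗ[ℤ] ℤ where
  toFun c := ((shiftSets S).map c).sum
  map_add' _ _ := List.sum_map_add
  map_smul' _ _ := List.sum_map_mul_left _ _ _

theorem shiftSum_apply (S : Finset ℕ) (c : Finset ℕ → ℤ) :
    shiftSum S c = ((shiftSets S).map c).sum := rfl

theorem shiftSum_congr {S : Finset ℕ} {c d : Finset ℕ → ℤ} (h : ∀ T ∈ shiftSets S, c T = d T) :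
    shiftSum S c = shiftSum S d := by
  rw [shiftSum_apply, shiftSum_apply, List.map_congr_left h]

/-- Linear extension of constructions of polytopes. -/
theorem exists_flagVec_eq {n n' : ℕ} {p : Finset ℕ → Prop} (Φ : Finset ℕ → (Finset ℕ → ℤ) →ₗ[ℤ] ℤ)
    (h : ∀ P : Polytope n, ∃ Q : Polytope n', ∀ S, p S →
      (flagNumber Q S : ℤ) = Φ S fun T => (flagNumber P T : ℤ)) (x : PolytopeGroup n) :
    ∃ y : PolytopeGroup n', ∀ S, p S → flagVec n' y S = Φ S (flagVec n x) := by
  induction x using Finsupp.induction_linear with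
  | zero => exact ⟨0, fun S _ => by simp⟩
  | add x x' hx hx' =>
    obtain ⟨y, hy⟩ := hx
    obtain ⟨y', hy'⟩ := hx'
    exact ⟨y + y', fun S hS => by
      rw [map_add, map_add, map_add, Pi.add_apply, hy S hS, hy' S hS]⟩
  | single P c =>
    obtain ⟨P, rfl⟩ := exists_toComb_eq P
    obtain ⟨Q, hQ⟩ := h P
    refine ⟨Finsupp.single Q.toComb c, fun S hS => ?_⟩
    have e : flagVec n (Finsupp.single P.toComb c) =
        c • fun T => (flagNumber P T : ℤ) := by
      ext T
      rw [flagVec_single]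
      rfl
    rw [flagVec_single, e, map_smul, ← hQ S hS, smul_eq_mul, flagNumber_toComb]

theorem exists_pyramid_group {n : ℕ} (x : PolytopeGroup n) : ∃ y : PolytopeGroup (n + 1),
    ∀ S : Finset ℕ, (∀ a ∈ S, a ≤ n) →
      flagVec _ y S = flagVec n x (S.erase n) + shiftSum S (flagVec n x) :=
  exists_flagVec_eq (fun S => LinearMap.proj (S.erase n) + shiftSum S) exists_pyramid x

theorem exists_bipyramid_group {n : ℕ} (x : PolytopeGroup n) : ∃ y : PolytopeGroup (n + 1),
    ∀ S : Finset ℕ, (∀ a ∈ S, a ≤ n) →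
      flagVec _ y S = (if n ∈ S then 0 else flagVec n x S) + 2 * shiftSum S (flagVec n x) := by
  have := exists_flagVec_eq (fun S => (if n ∈ S then 0 else LinearMap.proj S) + 2 • shiftSum S)
    (p := fun S => ∀ a ∈ S, a ≤ n) (fun P => (exists_bipyramid P).imp fun Q hQ S hS => by
      rw [hQ S hS]
      split_ifs <;> simp [shiftSum_apply]) x
  refine this.imp fun y hy S hS => ?_
  rw [hy S hS]
  split_ifs <;> simp

/-- The commutator of the pyramid and bipyramid operations. -/
theorem exists_commutator {n : ℕ} (x : PolytopeGroup n) : ∃ y : PolytopeGroup (n + 2),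
    ∀ S : Finset ℕ, (∀ a ∈ S, a ≤ n) →
      flagVec _ y S = if n ∈ S then flagVec n x (S.erase n) else 0 := by
  obtain ⟨c, hc⟩ := exists_pyramid_group x
  obtain ⟨b, hb⟩ := exists_bipyramid_group x
  obtain ⟨bc, hbc⟩ := exists_bipyramid_group c
  obtain ⟨cb, hcb⟩ := exists_pyramid_group b
  refine ⟨bc - cb, fun S hS => ?_⟩
  have hS' : ∀ a ∈ S, a ≤ n + 1 := fun a ha => (hS a ha).trans (Nat.le_succ n)
  have hn : n + 1 ∉ S := fun h => absurd (hS _ h) (by omega)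
  have hT : ∀ T ∈ shiftSets S, (∀ a ∈ T, a ≤ n) ∧ n ∉ T := fun T hT =>
    ⟨fun a ha => ((mem_shiftSets hT).2 n hS a ha).le,
      fun h => ((mem_shiftSets hT).2 n hS n h).false⟩
  -- Write `σ` for `shiftSum` and `x` for the flag vector. The sets occurring in `σ` do not contain
  -- `n`, so `C` acts there as `x + σx` and `B` as `x + 2σx`. In `BC - CB` all terms with `σ`
  -- cancel, and `x (S \ {n})` minus `x S` if `n ∉ S` remains.
  have e1 : shiftSum S (flagVec _ c) =
      shiftSum S (flagVec n x + fun T => shiftSum T (flagVec n x)) :=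
    shiftSum_congr fun T h => by
      rw [hc T (hT T h).1, Finset.erase_eq_of_notMem (hT T h).2]; rfl
  have e2 : shiftSum S (flagVec _ b) =
      shiftSum S (flagVec n x + (2 : ℤ) • fun T => shiftSum T (flagVec n x)) :=
    shiftSum_congr fun T h => by
      rw [hb T (hT T h).1, if_neg (hT T h).2]; rfl
  rw [map_sub, Pi.sub_apply, hbc S hS', hcb S hS', if_neg hn, Finset.erase_eq_of_notMem hn, hc S hS,
    hb S hS, e1, e2, map_add, map_add, map_smul, smul_eq_mul]
  split_ifs with h
  · ring
  · rw [Finset.erase_eq_of_notMem h]; ring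

theorem nonempty_polytope (n : ℕ) : Nonempty (Polytope n) := by
  induction n with
  | zero =>
    refine ⟨⟨Set.univ, ⟨{0}, ?_⟩, AffineSubspace.span_univ ℝ _ _⟩⟩
    simp only [Finset.coe_singleton, convexHull_singleton]
    ext x
    simp [Subsingleton.elim x 0]
  | succ n ih =>
    obtain ⟨P⟩ := ih
    exact (exists_pyramid P).nonempty

theorem two_pow_le_weight {a : ℕ} {S : Finset ℕ} (h : a ∈ S) : 2 ^ a ≤ weight S :=
  Finset.single_le_sum (f := fun a => 2 ^ a) (fun _ _ => Nat.zero_le _) h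

theorem weight_lt {m : ℕ} {S : Finset ℕ} (h : ∀ a ∈ S, a < m) : weight S < 2 ^ m :=
  Nat.geomSum_lt le_rfl h

theorem lt_of_weight_le {m : ℕ} {S T : Finset ℕ} (hT : ∀ a ∈ T, a < m) (h : weight S ≤ weight T) :
    ∀ a ∈ S, a < m := fun _ ha =>
  (Nat.pow_lt_pow_iff_right one_lt_two).1 (((two_pow_le_weight ha).trans h).trans_lt (weight_lt hT))

theorem weight_erase_add {a : ℕ} {S : Finset ℕ} (h : a ∈ S) :
    weight (S.erase a) + 2 ^ a = weight S := Finset.sum_erase_add S _ h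

theorem flagNumber_empty {n : ℕ} (P : Polytope n) : (flagNumber P ∅ : ℤ) = 1 := by
  obtain ⟨ι, _, v, h⟩ := P.exists_presents
  rw [h.flagNumber_eq (by simp), setCount_empty]

/-- For each set without two consecutive elements there is a combination of polytopes the flag
numbers of which are `1` at this set and `0` at the colexicographically smaller sets. -/
theorem exists_leading : ∀ (n : ℕ) (T : Finset ℕ), (∀ a ∈ T, a + 2 ≤ n) → (∀ a ∈ T, a + 1 ∉ T) →
    ∃ e : PolytopeGroup n, flagVec n e T = 1 ∧ ∀ S : Finset ℕ, S ≠ T → weight S ≤ weight T →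
      flagVec n e S = 0
  | 0, T, h, _ | 1, T, h, _ => by
    obtain rfl : T = ∅ := Finset.eq_empty_of_forall_notMem fun a ha => by have := h a ha; omega
    obtain ⟨P⟩ := nonempty_polytope _
    refine ⟨Finsupp.single P.toComb 1, ?_, fun S hS hw => ?_⟩
    · rw [flagVec_single, one_mul, flagNumber_toComb]
      exact flagNumber_empty P
    · obtain ⟨a, ha⟩ := Finset.nonempty_iff_ne_empty.2 hS
      exact absurd (lt_of_weight_le (m := 0) (by simp) hw a ha) (by omega)
  | n + 2, T, h, hT => by
    by_cases hn : n ∈ T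
    -- As `T` has no consecutive elements, `n - 1 ∉ T`, so `T \ {n}` is admissible in dimension `n`;
    -- the commutator then inserts `n`.
    · obtain ⟨e, he, he'⟩ := exists_leading n (T.erase n) (fun a ha => by
        obtain ⟨h1, h2⟩ := Finset.mem_erase.1 ha
        have h3 := h a h2
        have h4 : a + 1 ≠ n := fun e => hT a h2 (e ▸ hn)
        omega) (fun a ha h' => hT a (Finset.mem_of_mem_erase ha) (Finset.mem_of_mem_erase h'))
      obtain ⟨y, hy⟩ := exists_commutator e
      have hT' : ∀ a ∈ T, a < n + 1 := fun a ha => by have := h a ha; omega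
      refine ⟨y, ?_, fun S hS hw => ?_⟩
      · rw [hy T fun a ha => Nat.lt_succ_iff.1 (hT' a ha), if_pos hn, he]
      · rw [hy S fun a ha => Nat.lt_succ_iff.1 (lt_of_weight_le hT' hw a ha)]
        split_ifs with hnS
        · refine he' _ (fun e => hS ?_) ?_
          · rw [← Finset.insert_erase hnS, e, Finset.insert_erase hn]
          · have h1 := weight_erase_add hn
            have h2 := weight_erase_add hnS
            omega
        · rfl
    · have hT' : ∀ a ∈ T, a < n := fun a ha => by
        have h1 := h a ha
        have h2 : a ≠ n := fun e => hn (e ▸ ha)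
        omega
      obtain ⟨e, he, he'⟩ := exists_leading (n + 1) T (fun a ha => by have := hT' a ha; omega) hT
      obtain ⟨y, hy⟩ := exists_pyramid_group e
      -- Shifts of `S` are strictly smaller than `T`, where `e` vanishes, so a pyramid does not
      -- change the values up to `T`.
      have key : ∀ S, weight S ≤ weight T → flagVec _ y S = flagVec _ e S := by
        intro S hw
        have hS := lt_of_weight_le hT' hw
        have h0 : shiftSum S (flagVec _ e) = shiftSum S 0 := shiftSum_congr fun U hU => by
          have := (mem_shiftSets hU).1
          exact he' U (fun e => by rw [e] at this; omega) (by omega)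
        rw [hy S fun a ha => by have := hS a ha; omega, h0, map_zero, add_zero,
          Finset.erase_eq_of_notMem fun h' => by have := hS _ h'; omega]
      exact ⟨y, by rw [key T le_rfl, he], fun S hS hw => by rw [key S hw, he' S hS hw]⟩

theorem BayerBillera.add {n : ℕ} {c d : Finset ℕ → ℤ} (hc : BayerBillera n c)
    (hd : BayerBillera n d) : BayerBillera n (c + d) := by
  intro S hS i k hi hk hik hg
  simp only [Pi.add_apply, mul_add, Finset.sum_add_distrib]
  rw [hc S hS i k hi hk hik hg, hd S hS i k hi hk hik hg]

theorem BayerBillera.smul {n : ℕ} {c : Finset ℕ → ℤ} (hc : BayerBillera n c) (a : ℤ) :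
    BayerBillera n (a • c) := by
  intro S hS i k hi hk hik hg
  simp only [Pi.smul_apply, smul_eq_mul, mul_left_comm _ a]
  rw [← Finset.mul_sum, hc S hS i k hi hk hik hg]

theorem bayerBillera_flagVec {n : ℕ} (x : PolytopeGroup n) : BayerBillera n (flagVec n x) := by
  induction x using Finsupp.induction_linear with
  | zero =>
    rw [map_zero]
    intro S hS i k hi hk hik hg
    simp
  | add x y hx hy => rw [map_add]; exact hx.add hy
  | single P c =>
    obtain ⟨P, rfl⟩ := exists_toComb_eq P
    convert (flagNumber_bayerBillera P).smul c using 1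
    ext S
    rw [flagVec_single]
    rfl

/-- The relations express the value at a set with two consecutive elements, or with the element
`n - 1`, by the values at colexicographically smaller sets. -/
theorem BayerBillera.eq_zero {n : ℕ} {c : Finset ℕ → ℤ} (hc : BayerBillera n c) {S : Finset ℕ}
    (hS : S ⊆ Finset.range n) (h : ∀ T ⊆ Finset.range n, weight T < weight S → c T = 0) {j : ℕ}
    (hj : j ∈ S) (hj' : j + 1 = n ∨ j + 1 ∈ S) : c S = 0 := by
  have hw := weight_erase_add hj
  have hSj : S.erase j ⊆ Finset.range n := (Finset.erase_subset j S).trans hS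
  have hjn := Finset.mem_range.1 (hS hj)
  -- `i` is the predecessor of `j` in `S`, or `-1`. In the relation for `S \ {j}` and the gap from
  -- `i` to `j + 1`, the value at `S` has coefficient `±1` and every other set is smaller.
  obtain ⟨i, hi, hij, hgap⟩ : ∃ i : ℤ, (i = -1 ∨ ∃ a ∈ S.erase j, i = a) ∧ i < j ∧
      ∀ a ∈ S, a < j → (a : ℤ) ≤ i := by
    by_cases hne : (S.filter (· < j)).Nonempty
    · have hm := Finset.mem_filter.1 (Finset.max'_mem _ hne)
      refine ⟨((S.filter (· < j)).max' hne : ℕ), Or.inr ⟨_, Finset.mem_erase.2 ⟨hm.2.ne, hm.1⟩, rfl⟩,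
        by exact_mod_cast hm.2, fun a ha haj => ?_⟩
      exact_mod_cast Finset.le_max' _ a (Finset.mem_filter.2 ⟨ha, haj⟩)
    · refine ⟨-1, Or.inl rfl, by omega, fun a ha haj => ?_⟩
      exact absurd ⟨a, Finset.mem_filter.2 ⟨ha, haj⟩⟩ hne
  have hi1 : -1 ≤ i := by rcases hi with hi | ⟨a, _, hi⟩ <;> omega
  have key := hc (S.erase j) hSj i (j + 1) (hi.imp_right Or.inr) ?_ (by omega) ?_
  · rw [h _ hSj (by have := Nat.two_pow_pos j; omega), mul_zero,
      Finset.sum_eq_single_of_mem (j : ℤ) (Finset.mem_Ioo.2 ⟨hij, by omega⟩), Int.toNat_natCast,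
      Finset.insert_erase hj, mul_eq_zero] at key
    · exact key.resolve_left (pow_ne_zero _ (by norm_num))
    · intro l hl hlj
      rw [Finset.mem_Ioo] at hl
      rw [h, mul_zero]
      · refine Finset.insert_subset (Finset.mem_range.2 (by omega)) hSj
      · have h1 : weight (insert l.toNat (S.erase j)) ≤ weight (S.erase j) + 2 ^ l.toNat := by
          by_cases hm : l.toNat ∈ S.erase j
          · rw [Finset.insert_eq_of_mem hm]; exact Nat.le_add_right _ _
          · rw [weight, Finset.sum_insert hm, add_comm]; rfl
        have h2 : 2 ^ l.toNat < 2 ^ j := Nat.pow_lt_pow_right one_lt_two (by omega)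
        omega
  · rcases hj' with hj' | hj'
    · exact Or.inr (Or.inl (by rw [← hj']; simp))
    · exact Or.inr (Or.inr ⟨j + 1, Finset.mem_erase.2 ⟨by omega, hj'⟩, by simp⟩)
  · rintro a ha ⟨h1, h2⟩
    obtain ⟨h3, h4⟩ := Finset.mem_erase.1 ha
    have := hgap a h4 (by omega)
    omega

/-- All integer solutions of the Bayer-Billera relations are flag numbers of integer combinations of
polytopes. -/
theorem exists_flagVec_eq_of_bayerBillera {n : ℕ} {c : Finset ℕ → ℤ} (hc : BayerBillera n c) :
    ∃ x : PolytopeGroup n, ∀ S ⊆ Finset.range n, flagVec n x S = c S := by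
  -- Each weight belongs to one set `T`. If `T` is admissible for `exists_leading`, a multiple of
  -- the combination with leading set `T` corrects the value there; otherwise agreement at `T` is
  -- forced by the relations.
  have key : ∀ N, ∃ x : PolytopeGroup n, ∀ S ⊆ Finset.range n, weight S < N →
      flagVec n x S = c S := by
    intro N
    induction N with
    | zero => exact ⟨0, fun S _ h => absurd h (by omega)⟩
    | succ N ih =>
      obtain ⟨x, hx⟩ := ih
      by_cases hN : ∃ T ⊆ Finset.range n, weight T = N
      · obtain ⟨T, hT, rfl⟩ := hN
        have huniq : ∀ S, S ≠ T → weight S ≠ weight T := fun S hS h =>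
          hS (Finset.geomSum_injective le_rfl h)
        by_cases hΨ : (∀ a ∈ T, a + 2 ≤ n) ∧ ∀ a ∈ T, a + 1 ∉ T
        · obtain ⟨e, he, he'⟩ := exists_leading n T hΨ.1 hΨ.2
          refine ⟨x + (c T - flagVec n x T) • e, fun S hS hw => ?_⟩
          rw [map_add, map_smul, Pi.add_apply, Pi.smul_apply, smul_eq_mul]
          by_cases hST : S = T
          · subst hST
            rw [he]; ring
          · have := huniq S hST
            rw [he' S hST (by omega), hx S hS (by omega)]; ring
        · refine ⟨x, fun S hS hw => ?_⟩
          by_cases hST : S = T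
          · subst hST
            have hd : BayerBillera n (flagVec n x + (-1 : ℤ) • c) :=
              (bayerBillera_flagVec x).add (hc.smul _)
            have h0 : ∀ U ⊆ Finset.range n, weight U < weight S →
                (flagVec n x + (-1 : ℤ) • c) U = 0 := fun U hU hUw => by
              simp [hx U hU hUw]
            have : (flagVec n x + (-1 : ℤ) • c) S = 0 := by
              rcases not_and_or.1 hΨ with h | h
              · push Not at h
                obtain ⟨a, ha, h⟩ := h
                have := Finset.mem_range.1 (hS ha)
                exact hd.eq_zero hS h0 ha (Or.inl (by omega))
              · push Not at h
                obtain ⟨a, ha, h⟩ := h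
                exact hd.eq_zero hS h0 ha (Or.inr h)
            simp only [Pi.add_apply, Pi.smul_apply, smul_eq_mul] at this
            linarith
          · have := huniq S hST
            exact hx S hS (by omega)
      · exact ⟨x, fun S hS hw => hx S hS (lt_of_le_of_ne (Nat.lt_succ_iff.1 hw) fun h =>
          hN ⟨S, hS, h⟩)⟩
  obtain ⟨x, hx⟩ := key (2 ^ n)
  exact ⟨x, fun S hS => hx S hS (weight_lt fun a ha => Finset.mem_range.1 (hS ha))⟩

/-! Coefficients of quasi-symmetric polynomials -/

section Coefficients

variable {m : ℕ}

/-- The exponents of `t_1, …, t_m`. -/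
def expList (d : Option (Fin m) →₀ ℕ) : List ℕ := List.ofFn fun i => d (some i)

/-- The indices of the variables `t_i` of positive exponent. -/
def posIndices (d : Option (Fin m) →₀ ℕ) : List (Fin m) :=
  (List.finRange m).filter fun i => 0 < d (some i)

theorem filter_expList (d : Option (Fin m) →₀ ℕ) :
    (expList d).filter (0 < ·) = (posIndices d).map fun i => d (some i) := by
  rw [expList, posIndices, List.ofFn_eq_map, List.filter_map]
  rfl

theorem sortedLT_posIndices (d : Option (Fin m) →₀ ℕ) : (posIndices d).SortedLT :=
  ((List.pairwise_lt_finRange m).filter _).sortedLT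

theorem mem_posIndices {d : Option (Fin m) →₀ ℕ} {i : Fin m} :
    i ∈ posIndices d ↔ 0 < d (some i) := by
  simp [posIndices]

/-- The exponent of `α ^ a * ∏ t (l i) ^ ω i`. -/
noncomputable def monomialExp (a : ℕ) (ω : List ℕ) (l : Fin ω.length → Fin m) :
    Option (Fin m) →₀ ℕ :=
  Finsupp.single none a + ∑ i, Finsupp.single (some (l i)) (ω.get i)

theorem monomialExp_none (a : ℕ) (ω : List ℕ) (l : Fin ω.length → Fin m) :
    monomialExp a ω l none = a := by
  simp [monomialExp]

theorem monomialExp_some (a : ℕ) (ω : List ℕ) (l : Fin ω.length → Fin m) (j : Fin m) :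
    monomialExp a ω l (some j) = ∑ i, if l i = j then ω.get i else 0 := by
  simp [monomialExp, Finsupp.single_apply]

theorem monomialExp_apply {a : ℕ} {ω : List ℕ} {l : Fin ω.length → Fin m}
    (hl : Function.Injective l) (i : Fin ω.length) : monomialExp a ω l (some (l i)) = ω.get i := by
  rw [monomialExp_some, Finset.sum_eq_single_of_mem i (Finset.mem_univ i), if_pos rfl]
  exact fun j _ hj => if_neg fun e => hj (hl e)

/-- Because the parts are positive and `l` increases, `l` lists the variables that occur and is
recovered from the exponent. So the monomials of `M_ω` are distinct. -/
theorem monomialExp_eq_iff {a : ℕ} {ω : List ℕ} (hω : ∀ j ∈ ω, 0 < j) {l : Fin ω.length → Fin m}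
    (hl : StrictMono l) {d : Option (Fin m) →₀ ℕ} : monomialExp a ω l = d ↔
      d none = a ∧ List.ofFn l = posIndices d ∧ ∀ i, d (some (l i)) = ω.get i := by
  constructor
  · rintro rfl
    refine ⟨monomialExp_none a ω l, ?_, monomialExp_apply hl.injective⟩
    refine (List.sortedLT_ofFn_iff.2 hl).eq_of_mem_iff (sortedLT_posIndices _) fun j => ?_
    rw [mem_posIndices, List.mem_ofFn]
    constructor
    · rintro ⟨i, rfl⟩
      rw [monomialExp_apply hl.injective]
      exact hω _ (List.get_mem ω i)
    · intro h
      by_contra hj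
      rw [monomialExp_some, Finset.sum_eq_zero fun i _ => if_neg fun e => hj ⟨i, e⟩] at h
      exact h.false
  · rintro ⟨rfl, h1, h2⟩
    ext v
    rcases v with _ | j
    · exact monomialExp_none _ ω l
    · by_cases hj : j ∈ posIndices d
      · rw [← h1, List.mem_ofFn] at hj
        obtain ⟨i, rfl⟩ := hj
        rw [monomialExp_apply hl.injective, h2]
      · have h3 : d (some j) = 0 := by
          rw [mem_posIndices] at hj
          omega
        rw [h3, monomialExp_some]
        refine Finset.sum_eq_zero fun i _ => if_neg fun e => hj ?_
        rw [← h1, List.mem_ofFn]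
        exact ⟨i, e⟩

theorem alpha_pow_mul_M (a : ℕ) (ω : List ℕ) [DecidablePred fun l : Fin ω.length → Fin m => StrictMono l] :
    α m ^ a * M m ω = ∑ l : Fin ω.length → Fin m with StrictMono l,
      monomial (monomialExp a ω l) (1 : ℤ) := by
  rw [M, Finset.mul_sum]
  refine Finset.sum_congr (by ext; simp) fun l _ => ?_
  rw [monomialExp, ← mul_one (1 : ℤ), ← monomial_mul, monomial_sum_one]
  simp only [α, t, X_pow_eq_monomial]

open Classical in
/-- The coefficients of `α ^ a * M_ω`. -/
theorem coeff_alpha_pow_mul_M (a : ℕ) {ω : List ℕ} (hω : ∀ j ∈ ω, 0 < j)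
    (d : Option (Fin m) →₀ ℕ) : coeff d (α m ^ a * M m ω) =
      if d none = a ∧ (expList d).filter (0 < ·) = ω then 1 else 0 := by
  rw [alpha_pow_mul_M, coeff_sum]
  simp only [coeff_monomial]
  split_ifs with h
  · obtain ⟨h1, h2⟩ := h
    rw [filter_expList] at h2
    have h3 : (posIndices d).length = ω.length := by rw [← h2, List.length_map]
    obtain ⟨l, hl⟩ : ∃ l : Fin ω.length → Fin m, List.ofFn l = posIndices d := by
      rw [← h3]
      exact ⟨_, List.ofFn_get _⟩
    have hmono : StrictMono l := List.sortedLT_ofFn_iff.1 (hl ▸ sortedLT_posIndices d)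
    have h4 : ∀ i, d (some (l i)) = ω.get i := by
      rw [← hl, List.map_ofFn] at h2
      have := List.ofFn_injective (h2.trans (List.ofFn_get ω).symm)
      exact fun i => congrFun this i
    rw [Finset.sum_eq_single_of_mem l (by simpa using hmono),
      if_pos ((monomialExp_eq_iff hω hmono).2 ⟨h1, hl, h4⟩)]
    intro l' hl' hne
    refine if_neg fun e => hne (List.ofFn_injective ?_)
    rw [hl, ((monomialExp_eq_iff hω (by simpa using hl')).1 e).2.1]
  · refine Finset.sum_eq_zero fun l hl => if_neg fun e => h ?_
    obtain ⟨h1, h2, h3⟩ := (monomialExp_eq_iff hω (by simpa using hl)).1 e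
    refine ⟨h1, ?_⟩
    rw [filter_expList, ← h2, List.map_ofFn]
    exact (congrArg List.ofFn (funext h3)).trans (List.ofFn_get ω)

/-- The set of the numbers `n - (e_1 + ⋯ + e_l)` that are less than `n`. -/
def partialSums (n : ℕ) : List ℕ → Finset ℕ
  | [] => ∅
  | e :: E => if e = 0 then partialSums n E else insert (n - e) (partialSums (n - e) E)

/-- `comp` and `low` undo `partialSums` up to zero exponents, which leave no trace in the set. -/
theorem partialSums_spec (E : List ℕ) : ∀ n, E.sum ≤ n →
    (∀ a ∈ partialSums n E, a < n) ∧ comp n (partialSums n E) = E.filter (0 < ·) ∧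
      low n (partialSums n E) = n - E.sum := by
  induction E with
  | nil => intro n _; simp [partialSums, comp, low]
  | cons e E ih =>
    intro n hn
    rw [List.sum_cons] at hn
    rw [partialSums]
    split_ifs with he
    · subst he
      simpa using ih n (by omega)
    · obtain ⟨h1, h2, h3⟩ := ih (n - e) (by omega)
      have hs := sort_insert_max h1
      refine ⟨fun a ha => ?_, ?_, ?_⟩
      · rcases Finset.mem_insert.1 ha with rfl | ha
        · omega
        · have := h1 a ha; omega
      · rw [comp, hs, List.zipWith_cons_cons, ← comp, h2, List.filter_cons_of_pos (by simpa using Nat.pos_of_ne_zero he)]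
        congr 1
        omega
      · rw [low, hs, List.getLastD_cons, ← low, h3, List.sum_cons]
        omega

theorem mem_partialSums (E : List ℕ) : ∀ n, E.sum ≤ n → ∀ a, a ∈ partialSums n E ↔
    a < n ∧ ∃ k ≤ E.length, a = n - (E.take k).sum := by
  induction E with
  | nil => intro n _ a; simp [partialSums]; omega
  | cons e E ih =>
    intro n hn a
    rw [List.sum_cons] at hn
    have hk : (∃ k ≤ (e :: E).length, a = n - ((e :: E).take k).sum) ↔
        a = n ∨ ∃ k ≤ E.length, a = n - e - (E.take k).sum := by
      constructor
      · rintro ⟨k, hk, h⟩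
        cases k with
        | zero => exact Or.inl (by simpa using h)
        | succ k =>
          rw [List.take_succ_cons, List.sum_cons] at h
          exact Or.inr ⟨k, by simpa using hk, by omega⟩
      · rintro (h | ⟨k, hk, h⟩)
        · exact ⟨0, by simp, by simpa using h⟩
        · refine ⟨k + 1, by simpa using hk, ?_⟩
          rw [List.take_succ_cons, List.sum_cons]
          omega
    rw [partialSums, hk]
    split_ifs with he
    · subst he
      rw [ih n (by omega)]
      refine and_congr_right fun h => ?_
      rw [Nat.sub_zero, or_iff_right h.ne]
    · rw [Finset.mem_insert, ih (n - e) (by omega)]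
      constructor
      · rintro (h | ⟨h1, h2⟩)
        · exact ⟨by omega, Or.inr ⟨0, by simp, by simpa using h⟩⟩
        · exact ⟨by omega, Or.inr h2⟩
      · rintro ⟨h1, h2 | ⟨k, h2, h3⟩⟩
        · omega
        · by_cases h4 : (E.take k).sum = 0
          · exact Or.inl (by omega)
          · have := (List.take_sublist k E).sum_le_sum fun _ _ => Nat.zero_le _
            exact Or.inr ⟨by omega, k, h2, h3⟩

theorem zipWith_sub_spec (s : List ℕ) : ∀ n, (n :: s).Pairwise (· > ·) →
    (∀ c ∈ List.zipWith (· - ·) (n :: s) s, 0 < c) ∧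
    (List.zipWith (· - ·) (n :: s) s).sum + s.getLastD n = n ∧
    partialSums n (List.zipWith (· - ·) (n :: s) s) = s.toFinset ∧ s.length ≤ n := by
  induction s with
  | nil => intro n _; simp [partialSums]
  | cons a s ih =>
    intro n hn
    have h1 := List.pairwise_cons.1 hn
    have han := h1.1 a (by simp)
    obtain ⟨h2, h3, h4, h5⟩ := ih a h1.2
    rw [List.zipWith_cons_cons]
    refine ⟨fun c hc => ?_, ?_, ?_, ?_⟩
    · rcases List.mem_cons.1 hc with rfl | hc
      · omega
      · exact h2 c hc
    · rw [List.sum_cons, List.getLastD_cons]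
      omega
    · rw [partialSums, if_neg (by omega), show n - (n - a) = a by omega, h4, List.toFinset_cons]
    · rw [List.length_cons]
      omega

theorem comp_spec {n : ℕ} {S : Finset ℕ} (hS : S ⊆ Finset.range n) :
    (∀ c ∈ comp n S, 0 < c) ∧ (comp n S).sum + low n S = n ∧ partialSums n (comp n S) = S ∧
      (comp n S).length ≤ n := by
  have h := zipWith_sub_spec (S.sort (· ≥ ·)) n (List.pairwise_cons.2
    ⟨fun a ha => Finset.mem_range.1 (hS ((Finset.mem_sort _).1 ha)), pairwise_gt_sort S⟩)
  rw [Finset.sort_toFinset] at h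
  refine ⟨h.1, h.2.1, h.2.2.1, ?_⟩
  rw [comp, List.length_zipWith]
  exact (min_le_right _ _).trans h.2.2.2

/-- The exponent of `α ^ a_1 t_1 ^ (n - a_k) ⋯ t_k ^ (a_2 - a_1)`. -/
noncomputable def flagExp (n m : ℕ) (S : Finset ℕ) : Option (Fin m) →₀ ℕ :=
  Finsupp.equivFunOnFinite.symm fun v => v.elim (low n S) fun i => (comp n S).getD i 0

theorem flagCoeff_eq (n : ℕ) (g : Poly m) (S : Finset ℕ) :
    flagCoeff n g S = coeff (flagExp n m S) g := rfl

theorem ofFn_getD {C : List ℕ} (h : C.length ≤ m) :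
    (List.ofFn fun i : Fin m => C.getD i 0) = C ++ List.replicate (m - C.length) 0 := by
  refine List.ext_getElem (by simp; omega) fun i h1 h2 => ?_
  simp only [List.getElem_ofFn, List.getElem_append, List.getD_eq_getElem?_getD]
  split_ifs with hi
  · simp [hi]
  · simp [List.getElem?_eq_none (not_lt.1 hi)]

theorem partialSums_replicate (n k : ℕ) : partialSums n (List.replicate k 0) = ∅ := by
  induction k with
  | zero => rfl
  | succ k ih => rw [List.replicate_succ, partialSums, if_pos rfl, ih]

theorem partialSums_append_replicate (C : List ℕ) (k : ℕ) : ∀ n,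
    partialSums n (C ++ List.replicate k 0) = partialSums n C := by
  induction C with
  | nil => intro n; exact partialSums_replicate n k
  | cons c C ih => intro n; simp only [List.cons_append, partialSums, ih]

theorem degree_eq (d : Option (Fin m) →₀ ℕ) : d.degree = d none + (expList d).sum := by
  rw [Finsupp.degree_eq_sum, Fintype.sum_option, expList, List.sum_ofFn]

theorem expList_flagExp {n : ℕ} (hnm : n ≤ m) {S : Finset ℕ} (hS : S ⊆ Finset.range n) :
    expList (flagExp n m S) = comp n S ++ List.replicate (m - (comp n S).length) 0 :=
  ofFn_getD ((comp_spec hS).2.2.2.trans hnm)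

theorem degree_flagExp {n : ℕ} (hnm : n ≤ m) {S : Finset ℕ} (hS : S ⊆ Finset.range n) :
    (flagExp n m S).degree = n := by
  rw [degree_eq, expList_flagExp hnm hS, List.sum_append, List.sum_replicate]
  have := (comp_spec hS).2.1
  change low n S + _ = n
  simp
  omega

theorem partialSums_flagExp {n : ℕ} (hnm : n ≤ m) {S : Finset ℕ} (hS : S ⊆ Finset.range n) :
    partialSums n (expList (flagExp n m S)) = S := by
  rw [expList_flagExp hnm hS, partialSums_append_replicate, (comp_spec hS).2.2.1]

theorem partialSums_subset {n : ℕ} {d : Option (Fin m) →₀ ℕ} (hd : d.degree = n) :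
    partialSums n (expList d) ⊆ Finset.range n := fun a ha =>
  Finset.mem_range.2 ((partialSums_spec (expList d) n (by rw [degree_eq] at hd; omega)).1 a ha)

/-- The coefficients of a quasi-symmetric polynomial depend only on the set of partial sums. -/
theorem coeff_eq_of_partialSums_eq {n : ℕ} {g : Poly m} (hg : g ∈ QsymPoly m)
    {d d' : Option (Fin m) →₀ ℕ} (hd : d.degree = n) (hd' : d'.degree = n)
    (h : partialSums n (expList d) = partialSums n (expList d')) : coeff d g = coeff d' g := by
  classical
  have h1 := partialSums_spec (expList d) n (by rw [degree_eq] at hd; omega)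
  have h2 := partialSums_spec (expList d') n (by rw [degree_eq] at hd'; omega)
  have h3 : (expList d).filter (0 < ·) = (expList d').filter (0 < ·) := by
    rw [← h1.2.1, ← h2.2.1, h]
  have h4 : d none = d' none := by
    have h5 := h1.2.2
    rw [h, h2.2.2] at h5
    rw [degree_eq] at hd hd'
    omega
  induction hg using Submodule.span_induction with
  | mem g hg =>
    obtain ⟨a, ω, hω, rfl⟩ := hg
    rw [coeff_alpha_pow_mul_M a hω, coeff_alpha_pow_mul_M a hω, h3, h4]
  | zero => simp
  | add f g _ _ hf hg => rw [coeff_add, coeff_add, hf, hg]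
  | smul c g _ hg => rw [coeff_smul, coeff_smul, hg]

/-- The composition of a set `S ⊆ {0, …, n - 1}` has at most `n` parts, so `n ≤ m` guarantees that
it fits into the variables and that `S` has a representing exponent. -/
theorem coeff_eq_flagCoeff {n : ℕ} (hnm : n ≤ m) {g : Poly m} (hg : g ∈ QsymPoly m)
    {d : Option (Fin m) →₀ ℕ} (hd : d.degree = n) :
    coeff d g = flagCoeff n g (partialSums n (expList d)) :=
  coeff_eq_of_partialSums_eq hg hd (degree_flagExp hnm (partialSums_subset hd))
    (partialSums_flagExp hnm (partialSums_subset hd)).symm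

theorem eq_of_flagCoeff_eq {n : ℕ} (hnm : n ≤ m) {g g' : Poly m} (hg : g ∈ QsymPoly m)
    (hg' : g' ∈ QsymPoly m) (hn : g.IsHomogeneous n) (hn' : g'.IsHomogeneous n)
    (h : ∀ S ⊆ Finset.range n, flagCoeff n g S = flagCoeff n g' S) : g = g' := by
  ext d
  by_cases hd : d.degree = n
  · rw [coeff_eq_flagCoeff hnm hg hd, coeff_eq_flagCoeff hnm hg' hd, h _ (partialSums_subset hd)]
  · rw [hn.coeff_eq_zero hd, hn'.coeff_eq_zero hd]

theorem isHomogeneous_M (ω : List ℕ) : (M m ω).IsHomogeneous ω.sum := by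
  classical
  refine IsHomogeneous.sum _ _ _ fun l _ => ?_
  have h1 : ω.sum = ∑ i, ω.get i := by rw [← List.sum_ofFn, List.ofFn_get]
  rw [h1]
  exact IsHomogeneous.prod _ _ _ fun i _ => isHomogeneous_X_pow _ _

theorem fPoly_mem (n : ℕ) (P : CombPolytope n) :
    P.fPoly m ∈ QsymPoly m ∧ P.fPoly m ∈ homogeneousSubmodule (Option (Fin m)) ℤ n := by
  constructor
  · refine Submodule.sum_mem _ fun S hS => Submodule.smul_mem _ _ (Submodule.subset_span ?_)
    exact ⟨_, _, (comp_spec (Finset.mem_powerset.1 hS)).1, rfl⟩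
  · refine Submodule.sum_mem _ fun S hS => Submodule.smul_mem _ _ ?_
    have := (comp_spec (Finset.mem_powerset.1 hS)).2.1
    have h : (α m ^ low n S * M m (comp n S)).IsHomogeneous (low n S + (comp n S).sum) :=
      (isHomogeneous_X_pow _ _).mul (isHomogeneous_M _)
    rwa [show low n S + (comp n S).sum = n by omega] at h

theorem fMap_mem (n : ℕ) (p : PolytopeGroup n) :
    fMap n m p ∈ QsymPoly m ∧ (fMap n m p).IsHomogeneous n := by
  rw [fMap, Finsupp.linearCombination_apply, ← mem_homogeneousSubmodule]
  exact ⟨Submodule.sum_mem _ fun P _ => Submodule.smul_mem _ _ (fPoly_mem n P).1,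
    Submodule.sum_mem _ fun P _ => Submodule.smul_mem _ _ (fPoly_mem n P).2⟩

theorem flagCoeff_fPoly {n : ℕ} (hnm : n ≤ m) (P : CombPolytope n) {S : Finset ℕ}
    (hS : S ⊆ Finset.range n) : flagCoeff n (P.fPoly m) S = P.flagNumber S := by
  classical
  rw [flagCoeff_eq, CombPolytope.fPoly, coeff_sum,
    Finset.sum_eq_single_of_mem S (Finset.mem_powerset.2 hS)]
  · rw [coeff_smul, coeff_alpha_pow_mul_M _ (comp_spec hS).1, if_pos, smul_eq_mul, mul_one]
    have h := partialSums_spec (expList (flagExp n m S)) n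
      (by have := degree_flagExp hnm hS; rw [degree_eq] at this; omega)
    rw [partialSums_flagExp hnm hS] at h
    exact ⟨rfl, h.2.1.symm⟩
  · intro T hT hne
    have hT := Finset.mem_powerset.1 hT
    rw [coeff_smul, coeff_alpha_pow_mul_M _ (comp_spec hT).1, if_neg, smul_zero]
    rintro ⟨-, h⟩
    have h' := partialSums_spec (expList (flagExp n m S)) n
      (by have := degree_flagExp hnm hS; rw [degree_eq] at this; omega)
    rw [partialSums_flagExp hnm hS] at h'
    rw [← h'.2.1] at h
    refine hne ?_
    rw [← (comp_spec hT).2.2.1, ← h, (comp_spec hS).2.2.1]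

theorem flagCoeff_fMap {n : ℕ} (hnm : n ≤ m) (p : PolytopeGroup n) {S : Finset ℕ}
    (hS : S ⊆ Finset.range n) : flagCoeff n (fMap n m p) S = flagVec n p S := by
  induction p using Finsupp.induction_linear with
  | zero => simp [flagCoeff_eq]
  | add p q hp hq =>
    rw [flagCoeff_eq] at hp hq ⊢
    rw [map_add, map_add, coeff_add, hp, hq, Pi.add_apply]
  | single P c =>
    rw [fMap, Finsupp.linearCombination_single, flagVec_single, ← flagCoeff_fPoly hnm P hS,
      flagCoeff_eq, flagCoeff_eq, coeff_smul, smul_eq_mul]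

end Coefficients

/-! Substitutions -/

section Substitutions

variable {σ : Type*}

/-- Exponents are sums of exponents that vanish at `p` and `q` and of exponents at `p` and `q`. -/
theorem exists_eq_add_single_add_single {p q : σ} (hpq : p ≠ q) (e : σ →₀ ℕ) :
    ∃ e₀ : σ →₀ ℕ, e₀ p = 0 ∧ e₀ q = 0 ∧
      e = e₀ + Finsupp.single p (e p) + Finsupp.single q (e q) := by
  classical
  refine ⟨(e.erase p).erase q, ?_, Finsupp.erase_same, ?_⟩
  · rw [Finsupp.erase_ne hpq, Finsupp.erase_same]
  · ext v
    by_cases hv : v = p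
    · subst hv
      simp [Finsupp.erase_ne hpq, hpq]
    · by_cases hv' : v = q
      · subst hv'
        simp [Ne.symm hv]
      · simp [Finsupp.erase_ne hv, Finsupp.erase_ne hv', hv, hv']

theorem add_single_add_single_inj {p q : σ} (hpq : p ≠ q) {d e : σ →₀ ℕ} (hd : d p = 0)
    (hd' : d q = 0) (he : e p = 0) (he' : e q = 0) {x y x' y' : ℕ} :
    d + Finsupp.single p x + Finsupp.single q y = e + Finsupp.single p x' + Finsupp.single q y' ↔
      d = e ∧ x = x' ∧ y = y' := by
  classical
  constructor
  · intro h
    have h1 : x = x' := by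
      have := DFunLike.congr_fun h p
      simpa [hd, he, hpq, Finsupp.single_apply, hpq.symm] using this
    have h2 : y = y' := by
      have := DFunLike.congr_fun h q
      simpa [hd', he', hpq, Finsupp.single_apply, hpq.symm] using this
    subst h1 h2
    exact ⟨add_right_cancel (add_right_cancel h), rfl, rfl⟩
  · rintro ⟨rfl, rfl, rfl⟩; rfl

/-- The substitution of `± X p` for `X p` and `X q` in a monomial. -/
theorem aeval_merge_monomial {p q : σ} {f : σ → MvPolynomial σ ℤ} {s s' : ℤ}
    (hp : f p = C s * X p) (hq : f q = C s' * X p) (hf : ∀ v, v ≠ p → v ≠ q → f v = X v)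
    {e : σ →₀ ℕ} (he : e p = 0) (he' : e q = 0) (x y : ℕ) (r : ℤ) :
    aeval f (monomial (e + Finsupp.single p x + Finsupp.single q y) r) =
      monomial (e + Finsupp.single p (x + y)) (r * s ^ x * s' ^ y) := by
  have h0 : aeval f (monomial e r) = monomial e r := by
    rw [aeval_monomial, monomial_eq]
    congr 1
    refine Finsupp.prod_congr fun v hv => ?_
    rw [Finsupp.mem_support_iff] at hv
    rw [hf v (fun h => hv (h ▸ he)) (fun h => hv (h ▸ he'))]
  have h1 : monomial (e + Finsupp.single p x + Finsupp.single q y) r =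
      monomial e r * X p ^ x * X q ^ y := by
    rw [monomial_add_single, monomial_add_single]
  rw [h1, map_mul, map_mul, h0, map_pow, map_pow, aeval_X, aeval_X, hp, hq, mul_pow, mul_pow,
    ← C_pow, ← C_pow, monomial_add_single, pow_add,
    show r * s ^ x * s' ^ y = s ^ x * s' ^ y * r by ring, ← C_mul_monomial, C_mul]
  ring

/-- Monomials that differ only in the distribution of a total exponent `k` over `p` and `q` collapse
to one. Equation 1 is the case of signs `1, -1`, equation 2 that of `-1, 1`. -/
theorem coeff_aeval_merge {p q : σ} (hpq : p ≠ q) {f : σ → MvPolynomial σ ℤ} {s s' : ℤ}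
    (hp : f p = C s * X p) (hq : f q = C s' * X p) (hf : ∀ v, v ≠ p → v ≠ q → f v = X v)
    (g : MvPolynomial σ ℤ) :
    (∀ d : σ →₀ ℕ, d q ≠ 0 → coeff d (aeval f g) = 0) ∧
    ∀ d : σ →₀ ℕ, d p = 0 → d q = 0 → ∀ k, coeff (d + Finsupp.single p k) (aeval f g) =
      ∑ xy ∈ Finset.HasAntidiagonal.antidiagonal k, s ^ xy.1 * s' ^ xy.2 *
        coeff (d + Finsupp.single p xy.1 + Finsupp.single q xy.2) g := by
  classical
  induction g using MvPolynomial.induction_on' with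
  | monomial e r =>
    obtain ⟨e₀, h1, h2, h3⟩ := exists_eq_add_single_add_single hpq e
    rw [h3, aeval_merge_monomial hp hq hf h1 h2]
    generalize e p = x
    generalize e q = y
    simp only [coeff_monomial]
    constructor
    · intro d hd
      refine if_neg fun h => hd ?_
      rw [← h]
      simp [h2, hpq]
    · intro d hd hd' k
      have key : e₀ + Finsupp.single p (x + y) = d + Finsupp.single p k ↔ e₀ = d ∧ x + y = k := by
        have := add_single_add_single_inj hpq h1 h2 hd hd' (x := x + y) (y := 0) (x' := k) (y' := 0)
        simpa using this
      simp only [add_single_add_single_inj hpq h1 h2 hd hd', key]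
      by_cases h : e₀ = d ∧ x + y = k
      · obtain ⟨rfl, rfl⟩ := h
        rw [if_pos ⟨rfl, rfl⟩, Finset.sum_eq_single_of_mem (x, y)
          (Finset.HasAntidiagonal.mem_antidiagonal.2 rfl), if_pos ⟨rfl, rfl, rfl⟩]
        · ring
        · rintro ⟨x', y'⟩ _ hne
          rw [if_neg, mul_zero]
          rintro ⟨-, rfl, rfl⟩
          exact hne rfl
      · rw [if_neg h]
        refine (Finset.sum_eq_zero ?_).symm
        rintro ⟨x', y'⟩ hxy
        rw [if_neg, mul_zero]
        rintro ⟨rfl, rfl, rfl⟩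
        exact h ⟨rfl, Finset.HasAntidiagonal.mem_antidiagonal.1 hxy⟩
  | add g g' hg hg' =>
    refine ⟨fun d hd => ?_, fun d hd hd' k => ?_⟩
    · rw [map_add, coeff_add, hg.1 d hd, hg'.1 d hd, add_zero]
    · rw [map_add, coeff_add, hg.2 d hd hd', hg'.2 d hd hd', ← Finset.sum_add_distrib]
      exact Finset.sum_congr rfl fun xy _ => by rw [coeff_add, mul_add]

open Classical in
/-- The substitution of `0` for some variables. -/
theorem coeff_aeval_zero {Z : σ → Prop} {f : σ → MvPolynomial σ ℤ} (h0 : ∀ v, Z v → f v = 0)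
    (hf : ∀ v, ¬ Z v → f v = X v) (g : MvPolynomial σ ℤ) (d : σ →₀ ℕ) :
    coeff d (aeval f g) = if ∀ v, Z v → d v = 0 then coeff d g else 0 := by
  induction g using MvPolynomial.induction_on' with
  | monomial e r =>
    by_cases he : ∀ v, Z v → e v = 0
    · have : aeval f (monomial e r) = monomial e r := by
        rw [aeval_monomial, monomial_eq]
        congr 1
        refine Finsupp.prod_congr fun v hv => ?_
        rw [Finsupp.mem_support_iff] at hv
        rw [hf v fun h => hv (he v h)]
      rw [this, coeff_monomial]
      by_cases hed : e = d
      · subst hed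
        rw [if_pos rfl, if_pos he]
      · rw [if_neg hed, ite_self]
    · push Not at he
      obtain ⟨v, hv, he⟩ := he
      have : aeval f (monomial e r) = 0 := by
        rw [aeval_monomial, Finsupp.prod, Finset.prod_eq_zero (Finsupp.mem_support_iff.2 he),
          mul_zero]
        rw [h0 v hv, zero_pow he]
      rw [this, coeff_zero, coeff_monomial]
      by_cases hed : e = d
      · subst hed
        rw [if_neg fun h => he (h v hv)]
      · rw [if_neg hed, ite_self]
  | add g g' hg hg' =>
    rw [map_add, coeff_add, hg, hg', coeff_add]
    split_ifs <;> simp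

end Substitutions

/-! ### The functional equations in terms of coefficients -/

section Equations

variable {m : ℕ}

/-- The right side of the equation keeps just the monomials free of both variables. They are the
case `k = 0`, where the two sides agree anyway. -/
theorem eqs1_iff (g : Poly m) : Eqs1 g ↔ ∀ q q' : Fin m, q.1 + 1 = q'.1 →
    ∀ d : Option (Fin m) →₀ ℕ, d (some q) = 0 → d (some q') = 0 → ∀ k, 0 < k →
      ∑ xy ∈ Finset.HasAntidiagonal.antidiagonal k, (-1) ^ xy.2 *
        coeff (d + Finsupp.single (some q) xy.1 + Finsupp.single (some q') xy.2) g = 0 := by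
  classical
  refine forall_congr' fun q => forall_congr' fun q' => forall_congr' fun hq => ?_
  have hne : q ≠ q' := fun h => by rw [h] at hq; omega
  have hne' : some q ≠ some q' := fun h => hne (Option.some_injective _ h)
  have hl := coeff_aeval_merge (p := some q) (q := some q') (s := 1) (s' := -1) hne'
    (f := fun v : Option (Fin m) => v.elim (α m) (Function.update (t m) q' (-t m q)))
    (by simp [hne, t]) (by simp [t]) (fun v h1 h2 => by
      rcases v with _ | v
      · rfl
      · have : v ≠ q' := fun h => h2 (h ▸ rfl)
        simp [this, t]) g
  have hr := coeff_aeval_zero (Z := fun v => v = some q ∨ v = some q')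
    (f := fun v : Option (Fin m) =>
      v.elim (α m) (Function.update (Function.update (t m) q 0) q' 0))
    (by rintro v (rfl | rfl) <;> simp [hne]) (fun v hv => by
      rcases v with _ | v
      · rfl
      · have h1 : v ≠ q' := fun h => hv (Or.inr (h ▸ rfl))
        have h2 : v ≠ q := fun h => hv (Or.inl (h ▸ rfl))
        simp [h1, h2, t]) g
  simp only [one_pow, one_mul] at hl
  constructor
  · intro h d hd hd' k hk
    rw [← hl.2 d hd hd' k]
    refine (congrArg (coeff (d + Finsupp.single (some q) k)) h).trans
      ((hr _).trans (if_neg fun h2 => ?_))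
    have := h2 (some q) (Or.inl rfl)
    simp at this
    omega
  · intro h
    ext d
    refine Eq.trans ?_ (hr d).symm
    by_cases hd : d (some q') = 0
    · obtain ⟨d₀, h1, h2, h3⟩ := exists_eq_add_single_add_single hne' d
      rw [hd, Finsupp.single_zero, add_zero] at h3
      rcases Nat.eq_zero_or_pos (d (some q)) with h4 | h4
      · rw [if_pos (by rintro v (rfl | rfl); exacts [h4, hd])]
        have h5 := hl.2 d₀ h1 h2 0
        rw [h4] at h3
        rw [← h3] at h5
        refine h5.trans ?_
        rw [Finsupp.single_zero, add_zero] at h3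
        simp [h3]
      · rw [if_neg fun h6 => by have := h6 _ (Or.inl rfl); omega]
        rw [h3]
        exact (hl.2 d₀ h1 h2 _).trans (h d₀ h1 h2 _ h4)
    · rw [if_neg fun h6 => hd (h6 _ (Or.inr rfl))]
      exact hl.1 d hd

theorem eq2_iff (g : Poly m) : Eq2 g ↔ ∀ l : Fin m, l.1 + 1 = m →
    ∀ d : Option (Fin m) →₀ ℕ, d none = 0 → d (some l) = 0 → ∀ k,
      ∑ xy ∈ Finset.HasAntidiagonal.antidiagonal k, (-1) ^ xy.1 *
        coeff (d + Finsupp.single none xy.1 + Finsupp.single (some l) xy.2) g =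
        coeff (d + Finsupp.single none k) g := by
  classical
  refine forall_congr' fun l => forall_congr' fun _ => ?_
  have hne : (none : Option (Fin m)) ≠ some l := Option.some_ne_none l |>.symm
  have hl := coeff_aeval_merge (p := none) (q := some l) (s := -1) (s' := 1) hne
    (f := fun v : Option (Fin m) => v.elim (-α m) (Function.update (t m) l (α m)))
    (by simp [α]) (by simp [α]) (fun v h1 h2 => by
      rcases v with _ | v
      · exact absurd rfl h1
      · have : v ≠ l := fun h => h2 (h ▸ rfl)
        simp [this, t]) g
  have hr := coeff_aeval_zero (Z := fun v => v = some l)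
    (f := fun v : Option (Fin m) => v.elim (α m) (Function.update (t m) l 0))
    (by rintro v rfl; simp) (fun v hv => by
      rcases v with _ | v
      · rfl
      · have h1 : v ≠ l := fun h => hv (h ▸ rfl)
        simp [h1, t]) g
  simp only [one_pow, mul_one] at hl
  constructor
  · intro h d hd hd' k
    rw [← hl.2 d hd hd' k]
    refine (congrArg (coeff (d + Finsupp.single none k)) h).trans ((hr _).trans (if_pos ?_))
    rintro v rfl
    simp [hd']
  · intro h
    ext d
    refine Eq.trans ?_ (hr d).symm
    by_cases hd : d (some l) = 0
    · obtain ⟨d₀, h1, h2, h3⟩ := exists_eq_add_single_add_single hne d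
      rw [hd, Finsupp.single_zero, add_zero] at h3
      rw [if_pos (by rintro v rfl; exact hd), h3]
      exact (hl.2 d₀ h1 h2 _).trans (h d₀ h1 h2 _)
    · rw [if_neg fun h6 => hd (h6 _ rfl)]
      exact hl.1 d hd

end Equations

/-! Coefficients of quasi-symmetric polynomials at exponents with a zero -/

section Levels

variable {m : ℕ}

/-- The sum of the exponents of `α` and of the variables with an index that is at least `k`. -/
def level (d : Option (Fin m) →₀ ℕ) (k : ℕ) : ℕ :=
  d none + ∑ j : Fin m, if k ≤ j.1 then d (some j) else 0

theorem level_add (d e : Option (Fin m) →₀ ℕ) (k : ℕ) :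
    level (d + e) k = level d k + level e k := by
  simp only [level, Finsupp.add_apply]
  rw [add_add_add_comm, ← Finset.sum_add_distrib]
  congr 1
  exact Finset.sum_congr rfl fun j _ => by split_ifs <;> rfl

theorem level_single_none (x k : ℕ) :
    level (Finsupp.single none x : Option (Fin m) →₀ ℕ) k = x := by
  simp [level]

theorem level_single_some (q : Fin m) (x k : ℕ) :
    level (Finsupp.single (some q) x) k = if k ≤ q.1 then x else 0 := by
  classical
  rw [level, Finset.sum_eq_single_of_mem q (Finset.mem_univ q)]
  · simp
  · intro j _ hj
    simp [hj.symm]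

theorem level_antitone (d : Option (Fin m) →₀ ℕ) : Antitone (level d) := fun k l h => by
  refine Nat.add_le_add_left (Finset.sum_le_sum fun j _ => ?_) _
  split_ifs <;> omega

theorem level_zero (d : Option (Fin m) →₀ ℕ) : level d 0 = d.degree := by
  simp [level, Finsupp.degree_eq_sum, Fintype.sum_option]

theorem level_last (d : Option (Fin m) →₀ ℕ) : level d m = d none := by
  rw [level, Finset.sum_eq_zero, add_zero]
  exact fun j _ => if_neg (not_le.2 j.2)

theorem level_succ (d : Option (Fin m) →₀ ℕ) (q : Fin m) :
    level d q = level d (q + 1) + d (some q) := by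
  classical
  have : d (some q) = ∑ j : Fin m, if j = q then d (some j) else 0 := by simp
  rw [this, level, level, add_assoc, ← Finset.sum_add_distrib]
  congr 1
  refine Finset.sum_congr rfl fun j _ => ?_
  by_cases h : j = q
  · subst h; simp
  · have : j.1 ≠ q.1 := fun e => h (Fin.ext e)
    rw [if_neg h]
    split_ifs <;> omega

theorem sum_take_expList (d : Option (Fin m) →₀ ℕ) (k : ℕ) :
    ((expList d).take k).sum + level d k = d.degree := by
  rw [expList, List.sum_take_ofFn, ← level_zero, level, level, add_left_comm, Finset.sum_filter,
    ← Finset.sum_add_distrib]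
  congr 1
  refine Finset.sum_congr rfl fun j _ => ?_
  split_ifs <;> omega

/-- In degree `n` the level at `k` is `n` minus the sum of the first `k` exponents, so the set of a
monomial consists of its levels below `n`. -/
theorem mem_partialSums_expList {n : ℕ} {d : Option (Fin m) →₀ ℕ} (hd : d.degree = n) {a : ℕ} :
    a ∈ partialSums n (expList d) ↔ a < n ∧ ∃ k ≤ m, a = level d k := by
  rw [mem_partialSums _ _ (by rw [degree_eq] at hd; omega)]
  refine and_congr_right fun _ => exists_congr fun k => ?_
  have := sum_take_expList d k
  rw [expList, List.length_ofFn, ← expList]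
  refine and_congr_right fun _ => ?_
  omega

/-- Exponents that differ in two consecutive variables. -/
theorem partialSums_add_single_add_single {n : ℕ} {q q' : Fin m} (hq : q.1 + 1 = q'.1)
    {d : Option (Fin m) →₀ ℕ} (hd : d (some q) = 0) (hd' : d (some q') = 0) {k : ℕ} (hk : 0 < k)
    (hn : d.degree + k = n) :
    ∃ S ⊆ Finset.range n, level d q' ∈ S ∧ (level d q' + k = n ∨ level d q' + k ∈ S) ∧
      (∀ a ∈ S, a ≤ level d q' ∨ level d q' + k ≤ a) ∧ ∀ x y, x + y = k →
      partialSums n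
        (expList (d + Finsupp.single (some q) x + Finsupp.single (some q') y)) =
        if 0 < y ∧ y < k then insert (level d q' + y) S else S := by
  have h1 := level_succ d q
  have h2 := level_succ d q'
  rw [hd, hq] at h1
  rw [hd'] at h2
  have hdeg : ∀ x y, x + y = k →
      (d + Finsupp.single (some q) x + Finsupp.single (some q') y).degree = n := fun x y h => by
    rw [map_add, map_add, Finsupp.degree_single, Finsupp.degree_single]
    omega
  have hlev : ∀ x y l, level (d + Finsupp.single (some q) x + Finsupp.single (some q') y) l =
      level d l + (if l ≤ q.1 then x else 0) + (if l ≤ q'.1 then y else 0) := fun x y l => by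
    rw [level_add, level_add, level_single_some, level_single_some]
  -- Only the level at `q'` depends on the split, and it is `level d q' + y`. For `y = 0` it repeats
  -- the next level and for `y = k` the previous one, so both ends give the same set `S`.
  have hmem : ∀ x y, x + y = k → ∀ a, a ∈ partialSums n
      (expList (d + Finsupp.single (some q) x + Finsupp.single (some q') y)) ↔
      a < n ∧ ((∃ l ≤ q.1, a = level d l + k) ∨ a = level d q' + y ∨
        ∃ l ≤ m, q'.1 < l ∧ a = level d l) := by
    intro x y h a
    rw [mem_partialSums_expList (hdeg x y h)]
    refine and_congr_right fun _ => ⟨?_, ?_⟩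
    · rintro ⟨l, hl, rfl⟩
      rw [hlev]
      rcases lt_trichotomy l q'.1 with h3 | h3 | h3
      · refine Or.inl ⟨l, by omega, ?_⟩
        rw [if_pos (by omega), if_pos (by omega)]
        omega
      · refine Or.inr (Or.inl ?_)
        rw [if_neg (by omega), if_pos (by omega), h3]
        omega
      · refine Or.inr (Or.inr ⟨l, hl, h3, ?_⟩)
        rw [if_neg (by omega), if_neg (by omega)]
        omega
    · rintro (⟨l, hl, rfl⟩ | rfl | ⟨l, hl, h3, rfl⟩)
      · refine ⟨l, by omega, ?_⟩
        rw [hlev, if_pos (by omega), if_pos (by omega)]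
        omega
      · refine ⟨q', by omega, ?_⟩
        rw [hlev, if_neg (by omega), if_pos (by omega)]
        omega
      · refine ⟨l, hl, ?_⟩
        rw [hlev, if_neg (by omega), if_neg (by omega)]
        omega
  have hle : level d q' ≤ d.degree := level_zero d ▸ level_antitone d (Nat.zero_le _)
  refine ⟨_, partialSums_subset (hdeg k 0 rfl), ?_, ?_, ?_, ?_⟩
  · exact (hmem k 0 rfl _).2 ⟨by omega, Or.inr (Or.inl rfl)⟩
  · refine or_iff_not_imp_left.2 fun h => (hmem k 0 rfl _).2 ⟨by omega, Or.inl ⟨q, le_rfl, ?_⟩⟩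
    omega
  · intro a ha
    rcases ((hmem k 0 rfl _).1 ha).2 with ⟨l, hl, rfl⟩ | rfl | ⟨l, hl, h3, rfl⟩
    · have := level_antitone d hl
      omega
    · exact Or.inl le_rfl
    · exact Or.inl (level_antitone d h3.le)
  · intro x y h
    ext a
    rw [hmem x y h]
    split_ifs with hy
    · rw [Finset.mem_insert, hmem k 0 rfl]
      constructor
      · rintro ⟨h4, h5 | h5 | h5⟩
        exacts [Or.inr ⟨h4, Or.inl h5⟩, Or.inl h5, Or.inr ⟨h4, Or.inr (Or.inr h5)⟩]
      · rintro (h5 | ⟨h4, h5 | h5 | h5⟩)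
        · exact ⟨by omega, Or.inr (Or.inl h5)⟩
        · exact ⟨h4, Or.inl h5⟩
        · exact ⟨h4, Or.inr (Or.inr ⟨q' + 1, q'.2, by omega, by omega⟩)⟩
        · exact ⟨h4, Or.inr (Or.inr h5)⟩
    · rw [hmem k 0 rfl]
      refine and_congr_right fun h4 => ⟨?_, ?_⟩
      · rintro (h5 | h5 | h5)
        · exact Or.inl h5
        · by_cases hy0 : y = 0
          · exact Or.inr (Or.inl (by omega))
          · exact Or.inl ⟨q, le_rfl, by omega⟩
        · exact Or.inr (Or.inr h5)
      · rintro (h5 | h5 | h5)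
        · exact Or.inl h5
        · exact Or.inr (Or.inr ⟨q' + 1, q'.2, by omega, by omega⟩)
        · exact Or.inr (Or.inr h5)

/-- Exponents that differ in `α` and in the last variable. -/
theorem partialSums_add_single_none_add_single {n : ℕ} {q : Fin m} (hq : q.1 + 1 = m)
    {d : Option (Fin m) →₀ ℕ} (hd : d none = 0) (hd' : d (some q) = 0) {k : ℕ}
    (hn : d.degree + k = n) :
    ∃ S ⊆ Finset.range n, (k = n ∨ k ∈ S) ∧ (∀ a ∈ S, k ≤ a) ∧ ∀ x y, x + y = k →
      partialSums n (expList (d + Finsupp.single none x + Finsupp.single (some q) y)) =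
        if x < k then insert x S else S := by
  have h1 := level_succ d q
  have h2 := level_last d
  rw [hd', hq, h2, hd] at h1
  have hdeg : ∀ x y, x + y = k →
      (d + Finsupp.single none x + Finsupp.single (some q) y).degree = n := fun x y h => by
    rw [map_add, map_add, Finsupp.degree_single, Finsupp.degree_single]
    omega
  have hlev : ∀ x y l, level (d + Finsupp.single none x + Finsupp.single (some q) y) l =
      level d l + x + (if l ≤ q.1 then y else 0) := fun x y l => by
    rw [level_add, level_add, level_single_none, level_single_some]
  -- Only the last level, the exponent `x` of `α`, depends on the split; for `x = k` it repeats the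
  -- level before it.
  have hmem : ∀ x y, x + y = k → ∀ a, a ∈ partialSums n
      (expList (d + Finsupp.single none x + Finsupp.single (some q) y)) ↔
      a < n ∧ ((∃ l ≤ q.1, a = level d l + k) ∨ a = x) := by
    intro x y h a
    rw [mem_partialSums_expList (hdeg x y h)]
    refine and_congr_right fun _ => ⟨?_, ?_⟩
    · rintro ⟨l, hl, rfl⟩
      rw [hlev]
      by_cases h3 : l ≤ q.1
      · refine Or.inl ⟨l, h3, ?_⟩
        rw [if_pos h3]
        omega
      · refine Or.inr ?_
        rw [if_neg h3, show l = m by omega, h2, hd]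
        omega
    · rintro (⟨l, hl, rfl⟩ | rfl)
      · refine ⟨l, by omega, ?_⟩
        rw [hlev, if_pos hl]
        omega
      · refine ⟨m, le_rfl, ?_⟩
        rw [hlev, if_neg (by omega), h2, hd]
        omega
  refine ⟨_, partialSums_subset (hdeg k 0 rfl), ?_, ?_, ?_⟩
  · exact or_iff_not_imp_left.2 fun h => (hmem k 0 rfl _).2 ⟨by omega, Or.inr rfl⟩
  · intro a ha
    rcases ((hmem k 0 rfl _).1 ha).2 with ⟨l, hl, rfl⟩ | rfl
    · omega
    · exact le_rfl
  · intro x y h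
    ext a
    rw [hmem x y h]
    split_ifs with hy
    · rw [Finset.mem_insert, hmem k 0 rfl]
      constructor
      · rintro ⟨h4, h5 | h5⟩
        exacts [Or.inr ⟨h4, Or.inl h5⟩, Or.inl h5]
      · rintro (h5 | ⟨h4, h5 | h5⟩)
        · exact ⟨by omega, Or.inr h5⟩
        · exact ⟨h4, Or.inl h5⟩
        · exact ⟨h4, Or.inl ⟨q, le_rfl, by omega⟩⟩
    · rw [hmem k 0 rfl, show x = k by omega]

end Levels

/-! The functional equations and the Bayer-Billera relations -/

section Relations

theorem sum_Ioo_eq_sum_range (c : Finset ℕ → ℤ) (S : Finset ℕ) {i : ℤ} (hi : -1 ≤ i) (l : ℕ) :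
    ∑ j ∈ Finset.Ioo i (i + l + 1), (-1) ^ (j - i - 1).toNat * c (insert j.toNat S) =
      ∑ y ∈ Finset.range l, (-1) ^ y * c (insert ((i + 1).toNat + y) S) := by
  refine (Finset.sum_nbij' (fun y : ℕ => i + 1 + y) (fun j => (j - i - 1).toNat) ?_ ?_ ?_ ?_
    ?_).symm
  · intro y hy
    rw [Finset.mem_range] at hy
    rw [Finset.mem_Ioo]
    omega
  · intro j hj
    rw [Finset.mem_Ioo] at hj
    rw [Finset.mem_range]
    omega
  · intro y _
    omega
  · intro j hj
    rw [Finset.mem_Ioo] at hj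
    omega
  · intro y _
    rw [show (i + 1 + (y : ℤ) - i - 1).toNat = y by omega,
      show (i + 1 + (y : ℤ)).toNat = (i + 1).toNat + y by omega]

theorem BayerBillera.congr {n : ℕ} {c c' : Finset ℕ → ℤ} (h : BayerBillera n c)
    (hc : ∀ S ⊆ Finset.range n, c S = c' S) : BayerBillera n c' := by
  intro S hS i k hi hk hik hgap
  have hi' : -1 ≤ i := by rcases hi with rfl | rfl | ⟨a, _, rfl⟩ <;> omega
  have hk' : k ≤ n := by
    rcases hk with rfl | rfl | ⟨a, ha, rfl⟩
    · omega
    · exact le_rfl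
    · have := Finset.mem_range.1 (hS ha)
      omega
  rw [← hc S hS, ← h S hS i k hi hk hik hgap]
  refine Finset.sum_congr rfl fun j hj => ?_
  rw [Finset.mem_Ioo] at hj
  rw [hc _ (Finset.insert_subset (Finset.mem_range.2 (by omega)) hS)]

/-- The relation for two consecutive elements `i`, `i + k` of `S ∪ {n}`. -/
def InnerRelation (c : Finset ℕ → ℤ) (S : Finset ℕ) (i k : ℕ) : Prop :=
  ∑ y ∈ Finset.range (k + 1), (-1) ^ y * c (if 0 < y ∧ y < k then insert (i + y) S else S) = 0

/-- The relation for the least element `k` of `S ∪ {n}`. -/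
def OuterRelation (c : Finset ℕ → ℤ) (S : Finset ℕ) (k : ℕ) : Prop :=
  ∑ x ∈ Finset.range (k + 1), (-1) ^ x * c (if x < k then insert x S else S) = c S

/-- The two end terms `y = 0` and `y = l + 1` contribute `1 - (-1) ^ l` times `c S`, which is the
right side of the Bayer-Billera relation. -/
theorem innerRelation_iff (c : Finset ℕ → ℤ) (S : Finset ℕ) (i l : ℕ) :
    InnerRelation c S i (l + 1) ↔
      ∑ j ∈ Finset.Ioo (i : ℤ) (i + l + 1), (-1) ^ (j - i - 1).toNat * c (insert j.toNat S) =
        (1 - (-1) ^ l) * c S := by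
  rw [sum_Ioo_eq_sum_range c S (by omega), InnerRelation, Finset.sum_range_succ,
    Finset.sum_range_succ', if_neg (by omega), if_neg (by omega)]
  have : ∑ y ∈ Finset.range l, (-1) ^ (y + 1) *
      c (if 0 < y + 1 ∧ y + 1 < l + 1 then insert (i + (y + 1)) S else S) =
      -∑ y ∈ Finset.range l, (-1) ^ y * c (insert (((i : ℤ) + 1).toNat + y) S) := by
    rw [← Finset.sum_neg_distrib]
    refine Finset.sum_congr rfl fun y hy => ?_
    rw [Finset.mem_range] at hy
    rw [if_pos (by omega), show ((i : ℤ) + 1).toNat + y = i + (y + 1) by omega]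
    ring
  rw [this, pow_zero, pow_succ]
  constructor <;> intro h <;> linarith

theorem outerRelation_iff (c : Finset ℕ → ℤ) (S : Finset ℕ) (l : ℕ) :
    OuterRelation c S l ↔
      ∑ j ∈ Finset.Ioo (-1 : ℤ) (-1 + l + 1), (-1) ^ (j - -1 - 1).toNat * c (insert j.toNat S) =
        (1 - (-1) ^ l) * c S := by
  rw [sum_Ioo_eq_sum_range c S le_rfl, OuterRelation, Finset.sum_range_succ, if_neg (by omega)]
  have : ∑ x ∈ Finset.range l, (-1) ^ x * c (if x < l then insert x S else S) =
      ∑ y ∈ Finset.range l, (-1) ^ y * c (insert (((-1 : ℤ) + 1).toNat + y) S) := by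
    refine Finset.sum_congr rfl fun y hy => ?_
    rw [if_pos (Finset.mem_range.1 hy), show ((-1 : ℤ) + 1).toNat + y = y by simp]
  rw [this]
  constructor <;> intro h <;> linarith

/-- The empty gaps excluded by `i < k - 1` give trivial identities, so they may be admitted on the
right. -/
theorem bayerBillera_iff (n : ℕ) (c : Finset ℕ → ℤ) : BayerBillera n c ↔
    (∀ S ⊆ Finset.range n, ∀ i ∈ S, ∀ k, 0 < k → (i + k = n ∨ i + k ∈ S) →
      (∀ a ∈ S, a ≤ i ∨ i + k ≤ a) → InnerRelation c S i k) ∧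
    ∀ S ⊆ Finset.range n, ∀ k, (k = n ∨ k ∈ S) → (∀ a ∈ S, k ≤ a) → OuterRelation c S k := by
  constructor
  · intro h
    constructor
    · intro S hS i hi k hk hk' hgap
      obtain ⟨l, rfl⟩ : ∃ l, k = l + 1 := ⟨k - 1, by omega⟩
      rw [innerRelation_iff]
      rcases Nat.eq_zero_or_pos l with rfl | hl
      · rw [sum_Ioo_eq_sum_range c S (by omega)]
        simp
      · have := h S hS i (i + l + 1) (Or.inr (Or.inr ⟨i, hi, rfl⟩))
          (Or.inr (hk'.imp (fun h => by omega) fun h => ⟨_, h, by push_cast; ring⟩)) (by omega)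
          (fun a ha => by have := hgap a ha; omega)
        rwa [show ((i : ℤ) + l + 1 - i - 1).toNat = l by omega] at this
    · intro S hS k hk hgap
      rw [outerRelation_iff]
      rcases Nat.eq_zero_or_pos k with rfl | hl
      · rw [sum_Ioo_eq_sum_range c S le_rfl]
        simp
      · have := h S hS (-1) (-1 + k + 1) (Or.inl rfl)
          (Or.inr (hk.imp (fun h => by omega) fun h => ⟨_, h, by omega⟩)) (by omega)
          (fun a ha => by have := hgap a ha; omega)
        rwa [show (-1 + (k : ℤ) + 1 - -1 - 1).toNat = k by omega] at this
  · rintro ⟨h1, h2⟩ S hS i k hi hk hik hgap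
    have hk' : k ≤ n ∧ (-1 ≤ i → k = n ∨ ∃ a ∈ S, k = a) := by
      rcases hk with rfl | rfl | ⟨a, ha, rfl⟩
      · exact ⟨by omega, by omega⟩
      · exact ⟨le_rfl, fun _ => Or.inl rfl⟩
      · have := Finset.mem_range.1 (hS ha)
        exact ⟨by omega, fun _ => Or.inr ⟨a, ha, rfl⟩⟩
    obtain ⟨l, hl⟩ : ∃ l : ℕ, k = i + l + 1 := ⟨(k - i - 1).toNat, by omega⟩
    rw [show (k - i - 1).toNat = l by omega, hl]
    rcases hi with rfl | rfl | ⟨a, ha, rfl⟩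
    · rw [← outerRelation_iff]
      refine h2 S hS l ?_ fun a ha => ?_
      · refine (hk'.2 le_rfl).imp (fun h => by omega) ?_
        rintro ⟨a, ha, h⟩
        rwa [show l = a by omega]
      · have := hgap a ha
        omega
    · omega
    · rw [← innerRelation_iff]
      refine h1 S hS a ha (l + 1) (by omega) ?_ fun b hb => ?_
      · refine (hk'.2 (by omega)).imp (fun h => by omega) ?_
        rintro ⟨b, hb, h⟩
        rwa [show a + (l + 1) = b by omega]
      · have := hgap b hb
        omega

end Relations

/-! ### Equivalence of the functional equations and the relations -/

section Equivalence

variable {m : ℕ}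

theorem sum_antidiagonal_snd (k : ℕ) (f : ℕ → ℤ) (F : ℕ × ℕ → ℤ)
    (h : ∀ x y, x + y = k → F (x, y) = f y) :
    ∑ xy ∈ Finset.HasAntidiagonal.antidiagonal k, F xy = ∑ y ∈ Finset.range (k + 1), f y := by
  rw [← Finset.Nat.sum_antidiagonal_swap, Finset.Nat.sum_antidiagonal_eq_sum_range_succ_mk]
  refine Finset.sum_congr rfl fun y hy => h _ _ ?_
  rw [Finset.mem_range] at hy
  omega

theorem sum_antidiagonal_fst (k : ℕ) (f : ℕ → ℤ) (F : ℕ × ℕ → ℤ)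
    (h : ∀ x y, x + y = k → F (x, y) = f x) :
    ∑ xy ∈ Finset.HasAntidiagonal.antidiagonal k, F xy = ∑ x ∈ Finset.range (k + 1), f x := by
  rw [Finset.Nat.sum_antidiagonal_eq_sum_range_succ_mk]
  refine Finset.sum_congr rfl fun y hy => h _ _ ?_
  rw [Finset.mem_range] at hy
  omega

theorem sum_eq_innerRelation {n : ℕ} (hnm : n ≤ m) {g : Poly m} (hg : g ∈ QsymPoly m)
    {p q : Option (Fin m)} {d : Option (Fin m) →₀ ℕ} {k i : ℕ} (hn : d.degree + k = n)
    {S : Finset ℕ} (h : ∀ x y, x + y = k →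
      partialSums n (expList (d + Finsupp.single p x + Finsupp.single q y)) =
        if 0 < y ∧ y < k then insert (i + y) S else S) :
    ∑ xy ∈ Finset.HasAntidiagonal.antidiagonal k, (-1) ^ xy.2 *
        coeff (d + Finsupp.single p xy.1 + Finsupp.single q xy.2) g = 0 ↔
      InnerRelation (flagCoeff n g) S i k := by
  rw [InnerRelation, sum_antidiagonal_snd]
  intro x y hxy
  simp only
  rw [coeff_eq_flagCoeff hnm hg, h x y hxy]
  rw [map_add, map_add, Finsupp.degree_single, Finsupp.degree_single]
  omega

theorem sum_eq_outerRelation {n : ℕ} (hnm : n ≤ m) {g : Poly m} (hg : g ∈ QsymPoly m)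
    {p q : Option (Fin m)} {d : Option (Fin m) →₀ ℕ} {k : ℕ} (hn : d.degree + k = n)
    {S : Finset ℕ} (h : ∀ x y, x + y = k →
      partialSums n (expList (d + Finsupp.single p x + Finsupp.single q y)) =
        if x < k then insert x S else S) :
    ∑ xy ∈ Finset.HasAntidiagonal.antidiagonal k, (-1) ^ xy.1 *
        coeff (d + Finsupp.single p xy.1 + Finsupp.single q xy.2) g =
        coeff (d + Finsupp.single p k) g ↔
      OuterRelation (flagCoeff n g) S k := by
  have hdeg : ∀ x y, x + y = k →
      (d + Finsupp.single p x + Finsupp.single q y).degree = n := fun x y h => by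
    rw [map_add, map_add, Finsupp.degree_single, Finsupp.degree_single]
    omega
  have h0 : coeff (d + Finsupp.single p k) g = flagCoeff n g S := by
    have h1 := coeff_eq_flagCoeff hnm hg (hdeg k 0 rfl)
    rwa [h k 0 rfl, if_neg (lt_irrefl k), Finsupp.single_zero, add_zero] at h1
  rw [OuterRelation, h0, sum_antidiagonal_fst]
  intro x y hxy
  simp only
  rw [coeff_eq_flagCoeff hnm hg (hdeg x y hxy), h x y hxy]

theorem eqs1_iff_innerRelation {n : ℕ} (hnm : n ≤ m) {g : Poly m} (hg : g ∈ QsymPoly m)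
    (hn : g.IsHomogeneous n) : Eqs1 g ↔
    ∀ S ⊆ Finset.range n, ∀ i ∈ S, ∀ k, 0 < k → (i + k = n ∨ i + k ∈ S) →
      (∀ a ∈ S, a ≤ i ∨ i + k ≤ a) → InnerRelation (flagCoeff n g) S i k := by
  rw [eqs1_iff]
  constructor
  · intro h S hS i hi k hk hk' hgap
    have hin := Finset.mem_range.1 (hS hi)
    by_cases hk1 : k = 1
    · subst hk1
      simp [InnerRelation, Finset.sum_range_succ]
    have hkn : i + k ≤ n := by
      rcases hk' with h | h
      · exact h.le
      · exact (Finset.mem_range.1 (hS h)).le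
    -- The monomial of `S ∪ {i + 1}` has exponents `k - 1` and `1` in two adjacent variables. It is
    -- the term `y = 1` of the wanted sum, so the equation for these variables gives the relation.
    set S' := insert (i + 1) S with hS'
    have hS'n : S' ⊆ Finset.range n :=
      Finset.insert_subset (Finset.mem_range.2 (by omega)) hS
    set e := flagExp n m S' with he
    have hdeg : e.degree = n := degree_flagExp hnm hS'n
    have hmem : ∀ a, a ∈ S' ↔ a < n ∧ ∃ l ≤ m, a = level e l := fun a => by
      rw [← mem_partialSums_expList hdeg, he, partialSums_flagExp hnm hS'n]
    have hanti := level_antitone e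
    have hl0 : level e 0 = n := by rw [level_zero, hdeg]
    obtain ⟨-, l₀, hl₀, hi₀⟩ := (hmem i).1 (Finset.mem_insert_of_mem hi)
    obtain ⟨-, l₁, hl₁, hi₁⟩ := (hmem (i + 1)).1 (Finset.mem_insert_self _ _)
    obtain ⟨l₂, hl₂, hi₂⟩ : ∃ l ≤ m, i + k = level e l := by
      rcases hk' with h | h
      · exact ⟨0, Nat.zero_le _, by omega⟩
      · exact ((hmem _).1 (Finset.mem_insert_of_mem h)).2
    have hgap' : ∀ l ≤ m, level e l ≤ i ∨ level e l = i + 1 ∨ i + k ≤ level e l := fun l hl => by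
      have h1 : level e l ≤ n := hl0 ▸ hanti (Nat.zero_le l)
      rcases h1.eq_or_lt with h1 | h1
      · omega
      · rcases Finset.mem_insert.1 ((hmem _).2 ⟨h1, l, hl, rfl⟩) with h2 | h2
        · omega
        · have := hgap _ h2
          omega
    -- The levels descend from `n`; `r` is the last index with level above `i`. There the level is
    -- `i + 1`, and at `r + 1` it is `i`.
    obtain ⟨r, hr, hr'⟩ : ∃ r, i < level e r ∧ level e (r + 1) ≤ i := by
      by_contra! hc
      have : ∀ r, i < level e r := fun r => by
        induction r with
        | zero => omega
        | succ r ih => exact hc r ih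
      have := this l₀
      omega
    have hrl : ∀ {l}, i < level e l → l ≤ r := fun {l} h => by
      by_contra! h'
      have : level e l ≤ level e (r + 1) := hanti h'
      omega
    have hrl' : ∀ {l}, level e l ≤ i → r + 1 ≤ l := fun {l} h => by
      by_contra! h'
      have : level e r ≤ level e l := hanti (by omega)
      omega
    have hrm : r < m := (hrl' hi₀.symm.le).trans hl₀
    have hr1 : level e r = i + 1 := by
      have : level e r ≤ level e l₁ := hanti (hrl (by omega))
      omega
    have hr0 : level e (r + 1) = i := by
      have : level e l₀ ≤ level e (r + 1) := hanti (hrl' hi₀.symm.le)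
      omega
    have hr2 : l₂ < r := lt_of_le_of_ne (hrl (by omega)) (by rintro rfl; omega)
    obtain ⟨s, rfl⟩ : ∃ s, r = s + 1 := ⟨r - 1, by omega⟩
    set q : Fin m := ⟨s, by omega⟩
    set q' : Fin m := ⟨s + 1, hrm⟩
    have hne : some q ≠ some q' := fun h => by
      have := congrArg Fin.val (Option.some_injective _ h)
      simp [q, q'] at this
    have hq' : e (some q') = 1 := by
      have : level e (s + 1) = level e (s + 1 + 1) + e (some q') := level_succ e q'
      omega
    -- A composition has no zero parts before its end, so no variable between the two levels is
    -- skipped.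
    have hq0 : 0 < e (some q) := by
      have h1 : e (some q') = (comp n S').getD (s + 1) 0 := rfl
      have h2 : e (some q) = (comp n S').getD s 0 := rfl
      have h3 : s + 1 < (comp n S').length := by
        by_contra! h4
        rw [List.getD_eq_default _ _ h4] at h1
        omega
      rw [h2, List.getD_eq_getElem _ _ (by omega)]
      exact (comp_spec hS'n).1 _ (List.getElem_mem _)
    have hq : e (some q) + 1 = k := by
      have h1 : level e s = level e (s + 1) + e (some q) := level_succ e q
      have h2 := hgap' s (by omega)
      have h3 : level e s ≤ level e l₂ := hanti (by omega)
      omega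
    obtain ⟨d, hd, hd', hde⟩ := exists_eq_add_single_add_single hne e
    have hdk : d.degree + k = n := by
      rw [hde, map_add, map_add, Finsupp.degree_single, Finsupp.degree_single] at hdeg
      omega
    have hdi : level d q' = i := by
      have h1 : level e (s + 1 + 1) = _ := congrArg (fun e => level e (s + 1 + 1)) hde
      simp only [level_add, level_single_some] at h1
      rw [if_neg (by simp [q]), if_neg (by simp [q'])] at h1
      have h2 : level d (s + 1) = level d (s + 1 + 1) + d (some q') := level_succ d q'
      change level d (s + 1) = i
      omega
    obtain ⟨T, hT, h1, h2, h3, h4⟩ :=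
      partialSums_add_single_add_single (n := n) rfl hd hd' hk hdk
    rw [hdi] at h1 h2 h3 h4
    have hTS : T = S := by
      have h5 := h4 (e (some q)) (e (some q')) (by omega)
      rw [← hde, he, partialSums_flagExp hnm hS'n, ← he, hq', if_pos (by omega), hS'] at h5
      have h6 : i + 1 ∉ S := fun h => by have := hgap _ h; omega
      have h7 : i + 1 ∉ T := fun h => by have := h3 _ h; omega
      rw [← Finset.erase_insert h6, ← Finset.erase_insert h7, h5]
    rw [hTS] at h4
    exact (sum_eq_innerRelation hnm hg hdk h4).1 (h q q' rfl d hd hd' k hk)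
  · intro h q q' hq d hd hd' k hk
    by_cases hdk : d.degree + k = n
    · obtain ⟨S, hS, h1, h2, h3, h4⟩ :=
        partialSums_add_single_add_single hq hd hd' hk hdk
      exact (sum_eq_innerRelation hnm hg hdk h4).2 (h S hS _ h1 k hk h2 h3)
    -- In degrees other than `n` all coefficients vanish by homogeneity.
    · refine Finset.sum_eq_zero fun xy hxy => ?_
      rw [Finset.HasAntidiagonal.mem_antidiagonal] at hxy
      rw [hn.coeff_eq_zero, mul_zero]
      rw [map_add, map_add, Finsupp.degree_single, Finsupp.degree_single]
      omega

theorem eq2_iff_outerRelation {n : ℕ} (hnm : n ≤ m) {g : Poly m} (hg : g ∈ QsymPoly m)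
    (hn : g.IsHomogeneous n) : Eq2 g ↔
    ∀ S ⊆ Finset.range n, ∀ k, (k = n ∨ k ∈ S) → (∀ a ∈ S, k ≤ a) →
      OuterRelation (flagCoeff n g) S k := by
  rw [eq2_iff]
  constructor
  · intro h S hS k hk hgap
    rcases Nat.eq_zero_or_pos k with rfl | hk0
    · simp [OuterRelation]
    have hkn : k ≤ n := by
      rcases hk with h | h
      · exact h.le
      · exact (Finset.mem_range.1 (hS h)).le
    set e := flagExp n m S with he
    have hdeg : e.degree = n := degree_flagExp hnm hS
    have hmem : ∀ a, a ∈ S ↔ a < n ∧ ∃ l ≤ m, a = level e l := fun a => by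
      rw [← mem_partialSums_expList hdeg, he, partialSums_flagExp hnm hS]
    have hl0 : level e 0 = n := by rw [level_zero, hdeg]
    have hek : e none = k := by
      rw [← level_last]
      refine le_antisymm ?_ ?_
      · rcases hk with h | h
        · rw [h, ← hl0]
          exact level_antitone e (Nat.zero_le _)
        · obtain ⟨-, l, hl, h'⟩ := (hmem k).1 h
          rw [h']
          exact level_antitone e hl
      · have h1 : level e m ≤ n := hl0 ▸ level_antitone e (Nat.zero_le _)
        rcases h1.eq_or_lt with h1 | h1
        · omega
        · exact hgap _ ((hmem _).2 ⟨h1, m, le_rfl, rfl⟩)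
    set q : Fin m := ⟨m - 1, by omega⟩
    have hq : q.1 + 1 = m := by simp only [q]; omega
    -- The composition has sum `n - k < m`, hence fewer than `m` parts, and the last variable does
    -- not occur. So `e` is the term `x = k`, whose set is `S`.
    have heq : e (some q) = 0 := by
      have h1 : e (some q) = (comp n S).getD (m - 1) 0 := rfl
      have h2 : (comp n S).length ≤ (comp n S).sum :=
        List.length_le_sum_of_one_le _ (comp_spec hS).1
      have h3 := (comp_spec hS).2.1
      have h4 : e none = low n S := rfl
      rw [h1, List.getD_eq_default _ _ (by omega)]
    obtain ⟨d, hd, hd', hde⟩ := exists_eq_add_single_add_single (Option.some_ne_none q).symm e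
    have hdk : d.degree + k = n := by
      rw [hde, map_add, map_add, Finsupp.degree_single, Finsupp.degree_single] at hdeg
      omega
    obtain ⟨T, hT, h1, h2, h4⟩ := partialSums_add_single_none_add_single hq hd hd' hdk
    have hTS : T = S := by
      have h5 := h4 (e none) (e (some q)) (by omega)
      rw [← hde, he, partialSums_flagExp hnm hS, ← he, hek, if_neg (lt_irrefl k)] at h5
      exact h5.symm
    rw [hTS] at h4
    exact (sum_eq_outerRelation hnm hg hdk h4).1 (h q hq d hd hd' k)
  · intro h q hq d hd hd' k
    by_cases hdk : d.degree + k = n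
    · obtain ⟨S, hS, h1, h2, h4⟩ := partialSums_add_single_none_add_single hq hd hd' hdk
      exact (sum_eq_outerRelation hnm hg hdk h4).2 (h S hS k h1 h2)
    · have h0 : coeff (d + Finsupp.single none k) g = 0 := by
        rw [hn.coeff_eq_zero]
        rwa [map_add, Finsupp.degree_single]
      rw [h0]
      refine Finset.sum_eq_zero fun xy hxy => ?_
      rw [Finset.HasAntidiagonal.mem_antidiagonal] at hxy
      rw [hn.coeff_eq_zero, mul_zero]
      rw [map_add, map_add, Finsupp.degree_single, Finsupp.degree_single]
      omega

theorem eqs1_and_eq2_iff_bayerBillera {n : ℕ} (hnm : n ≤ m) {g : Poly m} (hg : g ∈ QsymPoly m)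
    (hn : g.IsHomogeneous n) : Eqs1 g ∧ Eq2 g ↔ BayerBillera n (flagCoeff n g) := by
  rw [bayerBillera_iff, eqs1_iff_innerRelation hnm hg hn, eq2_iff_outerRelation hnm hg hn]

end Equivalence

end FlagPoly

theorem theorem2 (n m : ℕ) (hnm : n ≤ m) :
    (∀ g : FlagPoly.Poly m,
      (∃ p : FlagPoly.PolytopeGroup n, FlagPoly.fMap n m p = g) ↔
        (g ∈ FlagPoly.QsymPoly m ∧ g.IsHomogeneous n ∧ FlagPoly.Eqs1 g ∧ FlagPoly.Eq2 g)) ∧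
    (∀ g : FlagPoly.Poly m, g ∈ FlagPoly.QsymPoly m → g.IsHomogeneous n →
      ((FlagPoly.Eqs1 g ∧ FlagPoly.Eq2 g) ↔
        FlagPoly.BayerBillera n (FlagPoly.flagCoeff n g))) := by
  refine ⟨fun g => ⟨?_, ?_⟩, fun g hg hn => FlagPoly.eqs1_and_eq2_iff_bayerBillera hnm hg hn⟩
  · rintro ⟨p, rfl⟩
    obtain ⟨hg, hn⟩ := FlagPoly.fMap_mem (m := m) n p
    refine ⟨hg, hn, (FlagPoly.eqs1_and_eq2_iff_bayerBillera hnm hg hn).2 ?_⟩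
    exact (FlagPoly.bayerBillera_flagVec p).congr fun S hS =>
      (FlagPoly.flagCoeff_fMap hnm p hS).symm
  · rintro ⟨hg, hn, h⟩
    obtain ⟨p, hp⟩ := FlagPoly.exists_flagVec_eq_of_bayerBillera
      ((FlagPoly.eqs1_and_eq2_iff_bayerBillera hnm hg hn).1 h)
    obtain ⟨hg', hn'⟩ := FlagPoly.fMap_mem (m := m) n p
    exact ⟨p, FlagPoly.eq_of_flagCoeff_eq hnm hg' hg hn' hn fun S hS => by
      rw [FlagPoly.flagCoeff_fMap hnm p hS, hp S hS]⟩
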